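/- Let $N\ge 2$ and $\lambda_r,\lambda_c>0$. Consider $N$ agents labelled $1,\dots,N$, each holding a value. Initial values are i.i.d. with mean $0$ and variance $\sigma^2$. Each agent is replaced at the times of a Poisson clock of rate $\lambda_r$ on $(0,\infty)$: the new agent keeps the label, draws a new value from the same distribution, and everything else held by the replaced agent is erased. In the Gossip model each unordered pair of distinct agents $\{i,j\}$ interacts at the times of a Poisson clock of rate $\lambda_c/(N-1)$, and at such a time $j$ sends its information to $i$ and $i$ to $j$. All clocks and all values are independent. Write $x_i(t)$ for the value of agent $i$ at time $t$ and $\bar x(t)=\frac1N\sum_i x_i(t)$. The knowledge set $\mathcal K_i(t)$ is initialized at every arrival time $t_0$ of agent $i$ (time $0$ or a replacement of $i$) as $\{(x_i(t_0),i,t_0)\}$, and when $j$ sends its information to $i$ at time $\tau$ it becomes $\mathcal K_i(\tau^-)\cup\mathcal K_j(\tau^-)\cup\{(x_j(\tau),j,\tau)\}\cup\{(j\to i,\tau)\}$. An algorithm that can be implemented on the knowledge sets gives every agent $i$ at every time $t$ an estimate $y_i(t)$ that is a (measurable) function of $\mathcal K_i(t)$; this function may depend on $i$, $t$ and all parameters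 of the model. Let $C(t)=\frac1N\sum_{i=1}^N(\bar x(t)-y_i(t))^2$. Let $w\in\mathbb R^N$, $w_k=\frac{k-1}{N-1}$, let $e_1$ be the first standard basis vector, and let $A\in\mathbb R^{N\times N}$ be the tridiagonal matrix with $A_{k,k}=-\left(\frac{k(N-k)}{N-1}\lambda_c+(k-1)\lambda_r\right)$, $A_{k,k+1}=k\lambda_r$ and $A_{k+1,k}=\frac{k(N-k)}{N-1}\lambda_c$. Then $2\lambda_r I-A$ is invertible and, for every algorithm that can be implemented on the knowledge sets of the Gossip model, $$\liminf_{t\to\infty}\mathbb E[C(t)]\ \ge\ \frac{N-1}{N^2}\left(1-w^TA(2\lambda_r I-A)^{-1}e_1\right)\sigma^2 .$$ Moreover, with $\rho=\lambda_c/\lambda_r$ and $C_N=\frac{N-5}{(N-1)(N-2)}=\mathcal O(N^{-1})$, for $N\ge 3$ $$\frac{N-1}{N^2}\left(1-w^TA(2\lambda_r I-A)^{-1}e_1\right)\sigma^2\ \ge\ \frac{N-1}{N^2}\left(\frac72+\log\frac{N-2}{2}+C_N\right)\rho^{-1}\sigma^2+\mathcal O\!\left(\frac{N}{\rho^2}\right)\sigma^2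 ,$$ where the $\mathcal O$ is uniform: the inequality holds with $-K\frac{N}{\rho^2}\sigma^2$ as the last term, for one absolute constant $K$ and all $N\ge3$, $\lambda_r,\lambda_c>0$, $\sigma$. -/

import Mathlib

open MeasureTheory ProbabilityTheory

noncomputable section

/-- One realization of the events of an open system of `N` agents, replaced agents keeping their
label: `repl i` is the set of replacement times of agent `i`, `exch j i` the set of times at which
`j` sends its information to `i`, and `val i n` the value of agent `i` after its `n`-th
replacement (`val i 0` is its initial value). -/
structure EventSeq (N : ℕ) where
  repl : Fin N → Set ℝ
  exch : Fin N → Fin N → Set ℝ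
  val : Fin N → ℕ → ℝ

/-- Pieces of information: `Sum.inl (x, j, τ)` says that agent `j` has value `x` at time `τ`;
`Sum.inr (j, i, τ)` says that `j` sent its information to `i` at time `τ`. -/
abbrev Info (N : ℕ) : Type := (ℝ × Fin N × ℝ) ⊕ (Fin N × Fin N × ℝ)

/-- The value `x_i(t)`. -/
def EventSeq.value {N : ℕ} (e : EventSeq N) (i : Fin N) (t : ℝ) : ℝ :=
  e.val i (e.repl i ∩ Set.Ioc 0 t).ncard

/-- The average of the values of the agents that are in the system at time `t`. -/
def EventSeq.average {N : ℕ} (e : EventSeq N) (t : ℝ) : ℝ :=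
  (1 / (N : ℝ)) * ∑ i, e.value i t

/-- `e.Knows i t q`: the knowledge set of agent `i` at time `t` (after a possible event at time
`t`) contains the piece of information `q`. -/
inductive EventSeq.Knows {N : ℕ} (e : EventSeq N) : Fin N → ℝ → Info N → Prop
  /-- at its arrival (at time `0`, or at a replacement) an agent knows its own value -/
  | arrival (i : Fin N) (t : ℝ) (h : t = 0 ∨ t ∈ e.repl i) :
      EventSeq.Knows e i t (Sum.inl (e.value i t, i, t))
  /-- an agent keeps what it knows as long as it is not replaced -/
  | keep (i : Fin N) (s t : ℝ) (q : Info N) (hq : EventSeq.Knows e i s q) (hst : s ≤ t)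
      (hr : ∀ r ∈ e.repl i, r ∉ Set.Ioc s t) : EventSeq.Knows e i t q
  /-- when `j` sends its information to `i` at time `t`, then `i` learns all that `j` knew just
  before `t` -/
  | receive (j i : Fin N) (s t : ℝ) (q : Info N) (ht : t ∈ e.exch j i)
      (hq : EventSeq.Knows e j s q) (hst : s < t) (hr : ∀ r ∈ e.repl j, r ∉ Set.Ioo s t) :
      EventSeq.Knows e i t q
  /-- it also learns the value of `j` at time `t` -/
  | learn (j i : Fin N) (t : ℝ) (ht : t ∈ e.exch j i) :
      EventSeq.Knows e i t (Sum.inl (e.value j t, j, t))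
  /-- and it records the exchange -/
  | record (j i : Fin N) (t : ℝ) (ht : t ∈ e.exch j i) :
      EventSeq.Knows e i t (Sum.inr (j, i, t))

/-- The knowledge set of agent `i` at time `t`. -/
def EventSeq.knowledge {N : ℕ} (e : EventSeq N) (i : Fin N) (t : ℝ) : Set (Info N) :=
  {q | e.Knows i t q}

/-- The usual σ-algebra on (locally finite) sets of pieces of information, generated by the
events that the set meets `B`, with `B` measurable. -/
def knowledgeSigma (N : ℕ) : MeasurableSpace (Set (Info N)) :=
  MeasurableSpace.generateFrom
    {H | ∃ B : Set (Info N), MeasurableSet B ∧ H = {S | (S ∩ B).Nonempty}}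

/-- The number of elements of `T` in `(a, b]`. -/
def tickCount (T : Set ℝ) (a b : ℝ) : ℕ := (T ∩ Set.Ioc a b).ncard

/-- The random set of times `T` is a Poisson clock (the set of points of a homogeneous Poisson
process on `(0, ∞)`) of rate `r`. -/
structure IsPoissonClock {Ω : Type*} [MeasurableSpace Ω] (μ : Measure Ω) (r : ℝ)
    (T : Ω → Set ℝ) : Prop where
  pos : ∀ ω, T ω ⊆ Set.Ioi 0
  finite : ∀ ω b, (T ω ∩ Set.Iic b).Finite
  measurable_count : ∀ a b, Measurable (fun ω => tickCount (T ω) a b)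
  law_count : ∀ a b, 0 ≤ a → a ≤ b →
    μ.map (fun ω => tickCount (T ω) a b) = poissonMeasure (r * (b - a)).toNNReal
  indep_increments : ∀ t : ℕ → ℝ, 0 ≤ t 0 → Monotone t →
    iIndepFun (fun (k : ℕ) ω => tickCount (T ω) (t k) (t (k + 1))) μ

/-- The σ-algebra generated by a random set of times. -/
def clockSigma {Ω : Type*} (T : Ω → Set ℝ) : MeasurableSpace Ω :=
  ⨆ p : ℝ × ℝ, MeasurableSpace.comap (fun ω => tickCount (T ω) p.1 p.2) ⊤

/-- Unordered pairs of distinct agents. -/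
abbrev AgentPair (N : ℕ) : Type := {p : Fin N × Fin N // p.1 < p.2}

/-- The σ-algebras of the individual sources of randomness: the replacement clocks of the
agents, the interaction clocks of the pairs, and the values. -/
def sourceSigma {N : ℕ} {Ω : Type*} (E : Ω → EventSeq N) :
    (Fin N ⊕ AgentPair N) ⊕ (Fin N × ℕ) → MeasurableSpace Ω
  | Sum.inl (Sum.inl i) => clockSigma (fun ω => (E ω).repl i)
  | Sum.inl (Sum.inr p) => clockSigma (fun ω => (E ω).exch p.1.1 p.1.2)
  | Sum.inr v => MeasurableSpace.comap (fun ω => (E ω).val v.1 v.2) (borel ℝ)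

/-- The random event sequence `E` follows the Gossip model with replacement rate `lamR`,
communication rate `lamC` and distribution `ν` of the values: each agent is replaced at the times
of a Poisson clock of rate `lamR`, each pair of distinct agents exchanges information in both
directions at the times of a Poisson clock of rate `lamC / (N - 1)`, the values are drawn from
`ν`, and all the clocks and all the values are independent. -/
structure IsGossipModel {N : ℕ} {Ω : Type*} [MeasurableSpace Ω] (μ : Measure Ω)
    (lamR lamC : ℝ) (ν : Measure ℝ) (E : Ω → EventSeq N) : Prop where
  exch_symm : ∀ ω i j, (E ω).exch i j = (E ω).exch j i
  exch_self : ∀ ω i, (E ω).exch i i = ∅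
  repl_clock : ∀ i, IsPoissonClock μ lamR (fun ω => (E ω).repl i)
  exch_clock : ∀ i j, i < j →
    IsPoissonClock μ (lamC / ((N : ℝ) - 1)) (fun ω => (E ω).exch i j)
  measurable_val : ∀ i n, Measurable (fun ω => (E ω).val i n)
  law_val : ∀ i n, μ.map (fun ω => (E ω).val i n) = ν
  indep : iIndep (sourceSigma E) μ

/-- The mean squared error `C(t)` of the algorithm in which agent `i` computes at time `t` the
estimate `y i t` of the average from its knowledge set. -/
def squaredError {N : ℕ} (y : Fin N → ℝ → Set (Info N) → ℝ) (e : EventSeq N) (t : ℝ) : ℝ :=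
  (1 / (N : ℝ)) * ∑ i, (e.average t - y i t (e.knowledge i t)) ^ 2

/-- The `N × N` tridiagonal matrix `A`; the index `k : Fin N` stands for `k + 1 ∈ {1, …, N}`. -/
def gossipMatrix (N : ℕ) (lamR lamC : ℝ) : Matrix (Fin N) (Fin N) ℝ :=
  let up : ℝ → ℝ := fun k => k * (N - k) / ((N : ℝ) - 1) * lamC
  fun i j =>
    if i = j then -(up ((i : ℕ) + 1) + ((i : ℕ) : ℝ) * lamR)
    else if (j : ℕ) = (i : ℕ) + 1 then (((i : ℕ) : ℝ) + 1) * lamR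
    else if (i : ℕ) = (j : ℕ) + 1 then up ((j : ℕ) + 1)
    else 0

/-- The vector `w`, with `w_k = (k - 1) / (N - 1)` for `k = 1, …, N`. -/
def gossipWeight (N : ℕ) : Fin N → ℝ := fun i => ((i : ℕ) : ℝ) / ((N : ℝ) - 1)

/-- The first vector of the standard basis. -/
def firstVec (N : ℕ) : Fin N → ℝ := fun i => if (i : ℕ) = 0 then 1 else 0

/-- The matrix `2 λ_r I - A`. -/
def shiftedMatrix (N : ℕ) (lamR lamC : ℝ) : Matrix (Fin N) (Fin N) ℝ :=
  (2 * lamR) • (1 : Matrix (Fin N) (Fin N) ℝ) - gossipMatrix N lamR lamC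

/-- The bound `(N - 1) / N² (1 - wᵀ A (2 λ_r - A)⁻¹ e₁) σ²`. -/
def gossipBound (N : ℕ) (lamR lamC σ : ℝ) : ℝ :=
  ((N : ℝ) - 1) / (N : ℝ) ^ 2 *
    (1 - gossipWeight N ⬝ᵥ
      ((gossipMatrix N lamR lamC * (shiftedMatrix N lamR lamC)⁻¹).mulVec (firstVec N))) * σ ^ 2

end

noncomputable section

/-- The generator of the number of further informed agents, applied to a function `f`: from `k`
(that is, `k + 1` informed agents) the number goes up or down by one. -/
def gossipGen (N : ℕ) (lamR lamC : ℝ) (f : ℕ → ℝ) (k : ℕ) : ℝ :=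
  ((k : ℝ) + 1) * (N - ((k : ℝ) + 1)) / ((N : ℝ) - 1) * lamC * (f (k + 1) - f k)
    + k * lamR * (f (k - 1) - f k)

lemma vecMul_gossipMatrix (N : ℕ) (lamR lamC : ℝ) (f : ℕ → ℝ) (k : Fin N) :
    Matrix.vecMul (fun i : Fin N => f i) (gossipMatrix N lamR lamC) k
      = gossipGen N lamR lamC f k := by
  obtain ⟨k, hk⟩ := k
  have h1 : Matrix.vecMul (fun i : Fin N => f i) (gossipMatrix N lamR lamC) ⟨k, hk⟩
      = ∑ i ∈ Finset.range N,
        ((if i = k then f k * -(((k : ℝ) + 1) * (N - ((k : ℝ) + 1)) / ((N : ℝ) - 1) * lamC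
            + k * lamR) else 0)
          + (if i + 1 = k then f (k - 1) * (k * lamR) else 0)
          + (if i = k + 1 then
              f (k + 1) * (((k : ℝ) + 1) * (N - ((k : ℝ) + 1)) / ((N : ℝ) - 1) * lamC) else 0)) := by
    rw [← Fin.sum_univ_eq_sum_range (fun i : ℕ =>
      ((if i = k then f k * -(((k : ℝ) + 1) * (N - ((k : ℝ) + 1)) / ((N : ℝ) - 1) * lamC
            + k * lamR) else 0)
          + (if i + 1 = k then f (k - 1) * (k * lamR) else 0)
          + (if i = k + 1 then
              f (k + 1) * (((k : ℝ) + 1) * (N - ((k : ℝ) + 1)) / ((N : ℝ) - 1) * lamC) else 0)))]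
    simp only [Matrix.vecMul, dotProduct]
    refine Finset.sum_congr rfl fun i _ => ?_
    obtain ⟨i, hi⟩ := i
    simp only [gossipMatrix, Fin.mk.injEq]
    by_cases h1 : i = k
    · subst h1; simp
    · by_cases h2 : k = i + 1
      · subst h2
        have h4 : i ≠ i + 1 + 1 := by omega
        simp [h4]
      · by_cases h3 : i = k + 1
        · subst h3
          have h4 : k ≠ k + 1 + 1 := by omega
          have h5 : k + 1 + 1 ≠ k := by omega
          simp [h4, h5]
        · have : ¬ i + 1 = k := fun h => h2 h.symm
          simp [h1, h2, h3, this]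
  rw [h1, Finset.sum_add_distrib, Finset.sum_add_distrib]
  have e1 : ∀ c : ℝ, ∑ i ∈ Finset.range N, (if i = k then c else 0) = c := by
    intro c; rw [Finset.sum_ite_eq']; simp [hk]
  have e2 : ∀ c : ℝ, ∑ i ∈ Finset.range N, (if i + 1 = k then c * (k * lamR) else 0)
      = c * (k * lamR) := by
    intro c
    rcases k with _ | k
    · simp
    · simp only [add_left_inj]
      rw [Finset.sum_ite_eq']
      have : k < N := by omega
      simp [this]
  have e3 : ∀ c : ℝ, ∑ i ∈ Finset.range N, (if i = k + 1 then
      c * (((k : ℝ) + 1) * (N - ((k : ℝ) + 1)) / ((N : ℝ) - 1) * lamC) else 0)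
      = c * (((k : ℝ) + 1) * (N - ((k : ℝ) + 1)) / ((N : ℝ) - 1) * lamC) := by
    intro c
    rw [Finset.sum_ite_eq']
    by_cases h : k + 1 < N
    · simp [h]
    · have : N = k + 1 := by omega
      subst this
      simp
  rw [e1, e2, e3]
  simp only [gossipGen]
  ring

lemma vecMul_shiftedMatrix (N : ℕ) (lamR lamC : ℝ) (f : ℕ → ℝ) (k : Fin N) :
    Matrix.vecMul (fun i : Fin N => f i) (shiftedMatrix N lamR lamC) k
      = 2 * lamR * f k - gossipGen N lamR lamC f k := by
  rw [shiftedMatrix, Matrix.vecMul_sub, Pi.sub_apply, vecMul_gossipMatrix, Matrix.vecMul_smul,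
    Matrix.vecMul_one]
  simp

/-- The values of `v`, extended by `0`. -/
def extendFin {N : ℕ} (v : Fin N → ℝ) (k : ℕ) : ℝ := if h : k < N then v ⟨k, h⟩ else 0

lemma extendFin_coe {N : ℕ} (v : Fin N → ℝ) (i : Fin N) : extendFin v i = v i := by
  simp [extendFin]

/-- The minimum principle. -/
lemma nonneg_of_vecMul_shiftedMatrix_nonneg {N : ℕ} {lamR lamC : ℝ} (hN : 2 ≤ N)
    (hr : 0 < lamR) (hc : 0 < lamC) (v : Fin N → ℝ)
    (h : ∀ k, 0 ≤ Matrix.vecMul v (shiftedMatrix N lamR lamC) k) (k : Fin N) : 0 ≤ v k := by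
  have : Nonempty (Fin N) := ⟨k⟩
  obtain ⟨m, hm⟩ := Finite.exists_min v
  refine le_trans ?_ (hm k)
  have hv : v = fun i : Fin N => extendFin v i := funext fun i => (extendFin_coe v i).symm
  have h1 := h m
  rw [hv, vecMul_shiftedMatrix, extendFin_coe] at h1
  have hN' : (0 : ℝ) < (N : ℝ) - 1 := by
    have : (2 : ℝ) ≤ N := by exact_mod_cast hN
    linarith
  have h2 : 0 ≤ gossipGen N lamR lamC (extendFin v) m := by
    unfold gossipGen
    rw [extendFin_coe]
    apply add_nonneg
    · by_cases hm1 : (m : ℕ) + 1 < N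
      · have : (((m : ℕ) : ℝ) + 1) ≤ N := by exact_mod_cast hm1.le
        have h3 := hm ⟨m + 1, hm1⟩
        have h4 : extendFin v (m + 1) = v ⟨m + 1, hm1⟩ := by simp [extendFin, hm1]
        rw [h4]
        apply mul_nonneg _ (by linarith)
        apply mul_nonneg _ hc.le
        apply div_nonneg _ hN'.le
        exact mul_nonneg (by positivity) (by linarith)
      · have : (N : ℝ) = (m : ℕ) + 1 := by
          have : N = (m : ℕ) + 1 := by omega
          exact_mod_cast this
        rw [this]; simp
    · have h3 := hm ⟨m - 1, by omega⟩
      have h4 : extendFin v (m - 1) = v ⟨m - 1, by omega⟩ := by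
        have : (m : ℕ) - 1 < N := by omega
        simp [extendFin, this]
      rw [h4]
      exact mul_nonneg (by positivity) (by linarith)
  nlinarith

theorem isUnit_shiftedMatrix {N : ℕ} {lamR lamC : ℝ} (hN : 2 ≤ N)
    (hr : 0 < lamR) (hc : 0 < lamC) : IsUnit (shiftedMatrix N lamR lamC) := by
  rw [← Matrix.vecMul_injective_iff_isUnit]
  intro v v' h
  have key : ∀ a b : Fin N → ℝ, Matrix.vecMul a (shiftedMatrix N lamR lamC)
      = Matrix.vecMul b (shiftedMatrix N lamR lamC) → ∀ k, a k ≤ b k := by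
    intro a b hab k
    have := nonneg_of_vecMul_shiftedMatrix_nonneg hN hr hc (b - a)
      (by intro k; rw [Matrix.sub_vecMul, hab]; simp) k
    simpa using this
  exact funext fun k => le_antisymm (key _ _ h k) (key _ _ h.symm k)

lemma gossipBound_eq {N : ℕ} {lamR lamC : ℝ} (σ : ℝ) (hN : 2 ≤ N)
    (hr : 0 < lamR) (hc : 0 < lamC) :
    gossipBound N lamR lamC σ = ((N : ℝ) - 1) / (N : ℝ) ^ 2 *
      (1 - 2 * lamR * (gossipWeight N ⬝ᵥ
        (shiftedMatrix N lamR lamC)⁻¹.mulVec (firstVec N))) * σ ^ 2 := by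
  have hu : IsUnit (shiftedMatrix N lamR lamC).det :=
    (Matrix.isUnit_iff_isUnit_det _).1 (isUnit_shiftedMatrix hN hr hc)
  have hA : gossipMatrix N lamR lamC = (2 * lamR) • (1 : Matrix (Fin N) (Fin N) ℝ)
      - shiftedMatrix N lamR lamC := by
    simp [shiftedMatrix]
  have hw : gossipWeight N ⬝ᵥ firstVec N = 0 := by
    simp only [dotProduct]
    refine Finset.sum_eq_zero fun i _ => ?_
    by_cases h : (i : ℕ) = 0 <;> simp [gossipWeight, firstVec, h]
  unfold gossipBound
  rw [hA, Matrix.sub_mul, Matrix.mul_nonsing_inv _ hu, Matrix.sub_mulVec, Matrix.one_mulVec,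
    dotProduct_sub, hw, Matrix.smul_mul, Matrix.one_mul, Matrix.smul_mulVec, dotProduct_smul]
  simp

/-- The vector `g` with `gᵀ (2 λ_r - A) = wᵀ`, as a function on the natural numbers. -/
lemma exists_gossip_potential {N : ℕ} {lamR lamC : ℝ} (hN : 2 ≤ N)
    (hr : 0 < lamR) (hc : 0 < lamC) : ∃ g : ℕ → ℝ,
      (∀ k < N, 2 * lamR * g k - gossipGen N lamR lamC g k = (k : ℝ) / ((N : ℝ) - 1)) ∧
      ∀ σ, gossipBound N lamR lamC σ
        = ((N : ℝ) - 1) / (N : ℝ) ^ 2 * (1 - 2 * lamR * g 0) * σ ^ 2 := by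
  have hu : IsUnit (shiftedMatrix N lamR lamC).det :=
    (Matrix.isUnit_iff_isUnit_det _).1 (isUnit_shiftedMatrix hN hr hc)
  set v := Matrix.vecMul (gossipWeight N) (shiftedMatrix N lamR lamC)⁻¹ with hv
  refine ⟨extendFin v, fun k hk => ?_, fun σ => ?_⟩
  · rw [show (k : ℕ) = ((⟨k, hk⟩ : Fin N) : ℕ) from rfl, ← vecMul_shiftedMatrix]
    rw [show (fun i : Fin N => extendFin v i) = v from funext fun i => extendFin_coe v i, hv,
      Matrix.vecMul_vecMul, Matrix.nonsing_inv_mul _ hu, Matrix.vecMul_one]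
    rfl
  · rw [gossipBound_eq σ hN hr hc, Matrix.dotProduct_mulVec, ← hv]
    have : v ⬝ᵥ firstVec N = extendFin v 0 := by
      have h0 : 0 < N := by omega
      simp only [dotProduct, firstVec, extendFin, h0, dif_pos]
      rw [Finset.sum_eq_single ⟨0, h0⟩]
      · simp
      · intro b _ hb
        have : (b : ℕ) ≠ 0 := fun h => hb (Fin.ext h)
        simp [this]
      · simp
    rw [this]

/-- Existence of the law of the number of further informed agents at an independent exponential
time of rate `2 λ_r`. -/
lemma exists_gossip_law {N : ℕ} {lamR lamC : ℝ} (hN : 2 ≤ N)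
    (hr : 0 < lamR) (hc : 0 < lamC) : ∃ p : ℕ → ℝ, (∀ k, 0 ≤ p k) ∧
      (∀ f : ℕ → ℝ, ∑ k ∈ Finset.range N,
        p k * (2 * lamR * f k - gossipGen N lamR lamC f k) = 2 * lamR * f 0) ∧
      ∀ σ, gossipBound N lamR lamC σ
        = ((N : ℝ) - 1) / (N : ℝ) ^ 2 *
          (1 - ∑ k ∈ Finset.range N, p k * ((k : ℝ) / ((N : ℝ) - 1))) * σ ^ 2 := by
  have hu : IsUnit (shiftedMatrix N lamR lamC).det :=
    (Matrix.isUnit_iff_isUnit_det _).1 (isUnit_shiftedMatrix hN hr hc)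
  have h0 : 0 < N := by omega
  set z := (shiftedMatrix N lamR lamC)⁻¹.mulVec (firstVec N) with hz
  have hfirst : ∀ v : Fin N → ℝ, v ⬝ᵥ firstVec N = v ⟨0, h0⟩ := by
    intro v
    simp only [dotProduct, firstVec]
    rw [Finset.sum_eq_single ⟨0, h0⟩]
    · simp
    · intro b _ hb
      have : (b : ℕ) ≠ 0 := fun h => hb (Fin.ext h)
      simp [this]
    · simp
  have hpair : ∀ v : Fin N → ℝ, Matrix.vecMul v (shiftedMatrix N lamR lamC) ⬝ᵥ z
      = v ⟨0, h0⟩ := by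
    intro v
    rw [hz, Matrix.dotProduct_mulVec, Matrix.vecMul_vecMul, Matrix.mul_nonsing_inv _ hu,
      Matrix.vecMul_one, hfirst]
  have hzn : ∀ k, 0 ≤ z k := by
    intro k
    have h1 := hpair (Matrix.vecMul (Pi.single k 1) (shiftedMatrix N lamR lamC)⁻¹)
    rw [Matrix.vecMul_vecMul, Matrix.nonsing_inv_mul _ hu, Matrix.vecMul_one,
      single_one_dotProduct] at h1
    rw [h1]
    apply nonneg_of_vecMul_shiftedMatrix_nonneg hN hr hc
    intro j
    rw [Matrix.vecMul_vecMul, Matrix.nonsing_inv_mul _ hu, Matrix.vecMul_one]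
    by_cases h : j = k
    · subst h; simp
    · simp [h]
  refine ⟨fun k => 2 * lamR * extendFin z k, fun k => ?_, fun f => ?_, fun σ => ?_⟩
  · apply mul_nonneg (by linarith)
    unfold extendFin
    split_ifs
    · exact hzn _
    · exact le_rfl
  · have h1 := hpair (fun i : Fin N => f i)
    simp only [dotProduct, vecMul_shiftedMatrix] at h1
    rw [← h1, Finset.mul_sum, ← Fin.sum_univ_eq_sum_range
      (fun k => 2 * lamR * extendFin z k * (2 * lamR * f k - gossipGen N lamR lamC f k))]
    refine Finset.sum_congr rfl fun i _ => ?_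
    rw [extendFin_coe]; ring
  · rw [gossipBound_eq σ hN hr hc, ← hz]
    congr 3
    rw [← Fin.sum_univ_eq_sum_range (fun k => 2 * lamR * extendFin z k * ((k : ℝ) / ((N : ℝ) - 1))),
      dotProduct, Finset.mul_sum]
    refine Finset.sum_congr rfl fun i _ => ?_
    rw [extendFin_coe, gossipWeight]; ring

lemma log_target_le {N : ℕ} (hN : 3 ≤ N) :
    7 / 2 + Real.log (((N : ℝ) - 2) / 2) + ((N : ℝ) - 5) / (((N : ℝ) - 1) * ((N : ℝ) - 2))
      ≤ 2 * ∑ m ∈ Finset.range (N - 1), 1 / ((m : ℝ) + 1) + 1 := by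
  have hlog2 := Real.log_two_gt_d9
  rcases hN.eq_or_lt with h3 | h4
  · subst h3
    norm_num [Finset.sum_range_succ]
    have : Real.log (1 / 2) ≤ 0 := Real.log_nonpos (by norm_num) (by norm_num)
    linarith
  · have hN4 : (4 : ℝ) ≤ N := by exact_mod_cast h4
    set H := ∑ m ∈ Finset.range (N - 1), 1 / ((m : ℝ) + 1) with hH
    have h1 : Real.log N ≤ H := by
      have h := log_add_one_le_harmonic (N - 1)
      have hc : ((N - 1 : ℕ) : ℝ) + 1 = N := by
        rw [Nat.cast_sub (by omega)]; simp
      have e : ((N - 1 : ℕ) + 1 : ℕ) = N := by omega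
      rw [e] at h
      refine h.trans (le_of_eq ?_)
      rw [harmonic]
      push_cast
      rw [hH]
      exact Finset.sum_congr rfl fun i _ => by rw [one_div]
    have h2 : (11 : ℝ) / 6 ≤ H := by
      have : ∑ m ∈ Finset.range 3, 1 / ((m : ℝ) + 1) ≤ H := by
        apply Finset.sum_le_sum_of_subset_of_nonneg
        · intro x; simp only [Finset.mem_range]; omega
        · intros; positivity
      norm_num [Finset.sum_range_succ] at this
      linarith
    have h3 : Real.log (((N : ℝ) - 2) / 2) = Real.log ((N : ℝ) - 2) - Real.log 2 :=
      Real.log_div (by linarith) (by norm_num)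
    have h5 : 2 / (N : ℝ) ≤ Real.log N - Real.log ((N : ℝ) - 2) := by
      have h6 := Real.one_sub_inv_le_log_of_pos (x := (N : ℝ) / ((N : ℝ) - 2))
        (by apply div_pos <;> linarith)
      rw [Real.log_div (by linarith) (by linarith)] at h6
      refine le_trans (le_of_eq ?_) h6
      have : (N : ℝ) - 2 ≠ 0 := by linarith
      field_simp
      ring
    have h7 : ((N : ℝ) - 5) / (((N : ℝ) - 1) * ((N : ℝ) - 2)) ≤ 2 / (N : ℝ) := by
      rw [div_le_div_iff₀ (by apply mul_pos <;> linarith) (by linarith)]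
      nlinarith
    linarith

theorem gossipBound_asymptotic {N : ℕ} {lamR lamC : ℝ} (σ : ℝ) (hN : 3 ≤ N)
    (hr : 0 < lamR) (hc : 0 < lamC) :
    ((N : ℝ) - 1) / (N : ℝ) ^ 2 *
          (7 / 2 + Real.log (((N : ℝ) - 2) / 2)
            + ((N : ℝ) - 5) / (((N : ℝ) - 1) * ((N : ℝ) - 2))) *
          (lamC / lamR)⁻¹ * σ ^ 2
        - 6 * ((N : ℝ) / (lamC / lamR) ^ 2) * σ ^ 2 ≤ gossipBound N lamR lamC σ := by
  obtain ⟨p, hp0, hp, hb⟩ := exists_gossip_law (lamR := lamR) (lamC := lamC) (by omega : 2 ≤ N) hr hc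
  have hN3 : (3 : ℝ) ≤ N := by exact_mod_cast hN
  set ρ := lamC / lamR with hρ
  have hρ0 : 0 < ρ := div_pos hc hr
  have hcρ : lamC = ρ * lamR := by rw [hρ]; field_simp
  set H := ∑ m ∈ Finset.range (N - 1), 1 / ((m : ℝ) + 1) with hH
  set D := ∑ k ∈ Finset.range N, p k * ((N : ℝ) - 1 - k) with hD
  have hle : ∀ k ∈ Finset.range N, (k : ℝ) ≤ N - 1 := by
    intro k hk
    have h : k + 1 ≤ N := Finset.mem_range.1 hk
    have : (k : ℝ) + 1 ≤ N := by exact_mod_cast h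
    linarith
  have hD0 : 0 ≤ D := Finset.sum_nonneg fun k hk =>
    mul_nonneg (hp0 k) (by linarith [hle k hk])
  have hsum : ∑ k ∈ Finset.range N, p k = 1 := by
    have h1 := hp (fun _ => 1)
    simp only [gossipGen, sub_self, mul_zero, add_zero, sub_zero, mul_one] at h1
    rw [← Finset.sum_mul] at h1
    have : 2 * lamR ≠ 0 := by positivity
    field_simp at h1
    linarith
  have hbD : gossipBound N lamR lamC σ = D / (N : ℝ) ^ 2 * σ ^ 2 := by
    rw [hb]
    have : ∑ k ∈ Finset.range N, p k * ((k : ℝ) / ((N : ℝ) - 1))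
        = 1 - D / ((N : ℝ) - 1) := by
      have e : 1 - D / ((N : ℝ) - 1) = ∑ k ∈ Finset.range N, p k - D / ((N : ℝ) - 1) := by
        rw [hsum]
      rw [e, hD, Finset.sum_div, ← Finset.sum_sub_distrib]
      refine Finset.sum_congr rfl fun k _ => ?_
      have : (N : ℝ) - 1 ≠ 0 := by linarith
      field_simp
      ring
    rw [this]
    have : (N : ℝ) - 1 ≠ 0 := by linarith
    field_simp
    ring
  set f : ℕ → ℝ := fun k => ∑ m ∈ Finset.Ico k (N - 1), 1 / ((m : ℝ) + 1) with hf
  have hfstep : ∀ k < N - 1, f k = 1 / ((k : ℝ) + 1) + f (k + 1) := by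
    intro k hk
    exact Finset.sum_eq_sum_Ico_succ_bot hk _
  have hgen : ∀ k ∈ Finset.range N, gossipGen N lamR lamC f k
      = -(ρ * lamR * ((N : ℝ) - 1 - k) / ((N : ℝ) - 1)) + (if k = 0 then 0 else lamR) := by
    intro k hk
    have hk' := Finset.mem_range.1 hk
    have hN1 : (N : ℝ) - 1 ≠ 0 := by linarith
    unfold gossipGen
    have hfirst : ((k : ℝ) + 1) * (N - ((k : ℝ) + 1)) / ((N : ℝ) - 1) * lamC * (f (k + 1) - f k)
        = -(ρ * lamR * ((N : ℝ) - 1 - k) / ((N : ℝ) - 1)) := by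
      by_cases h : k < N - 1
      · rw [hfstep k h, hcρ]
        have : (k : ℝ) + 1 ≠ 0 := by positivity
        field_simp
        ring
      · have h1 : N = k + 1 := by omega
        have : (N : ℝ) = (k : ℝ) + 1 := by exact_mod_cast h1
        rw [this]; simp
    rw [hfirst]
    rcases k with _ | k
    · simp
    · have := hfstep k (by omega)
      have h2 : f (k + 1 - 1) - f (k + 1) = 1 / ((k : ℝ) + 1) := by
        simp only [Nat.add_sub_cancel]; linarith
      rw [h2]
      have : (k : ℝ) + 1 ≠ 0 := by positivity
      push_cast
      simp
      field_simp
  have hmain : ρ * D / ((N : ℝ) - 1) = 2 * H + 1 - p 0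
      - 2 * ∑ k ∈ Finset.range N, p k * f k := by
    have h1 := hp f
    have hf0 : f 0 = H := by simp [hf, hH]
    have h2 : ∑ k ∈ Finset.range N, p k * (2 * lamR * f k - gossipGen N lamR lamC f k)
        = lamR * (2 * ∑ k ∈ Finset.range N, p k * f k + ρ * D / ((N : ℝ) - 1)
          - ∑ k ∈ Finset.range N, p k + p 0) := by
      have h3 : p 0 = ∑ k ∈ Finset.range N, if k = 0 then p k else 0 := by
        rw [Finset.sum_ite_eq']; simp; omega
      rw [h3, hD, Finset.mul_sum, Finset.mul_sum, Finset.sum_div, ← Finset.sum_add_distrib,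
        ← Finset.sum_sub_distrib, ← Finset.sum_add_distrib, Finset.mul_sum]
      refine Finset.sum_congr rfl fun k hk => ?_
      rw [hgen k hk]
      split_ifs <;> ring
    rw [h2, hsum, hf0] at h1
    have h4 : lamR * (2 * ∑ k ∈ Finset.range N, p k * f k + ρ * D / ((N : ℝ) - 1) - 1 + p 0)
        = lamR * (2 * H) := by rw [h1]; ring
    have := mul_left_cancel₀ hr.ne' h4
    linarith
  have hfle : ∑ k ∈ Finset.range N, p k * f k ≤ D := by
    refine Finset.sum_le_sum fun k hk => mul_le_mul_of_nonneg_left ?_ (hp0 k)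
    have hk' := Finset.mem_range.1 hk
    calc f k ≤ ∑ m ∈ Finset.Ico k (N - 1), (1 : ℝ) := by
          refine Finset.sum_le_sum fun m _ => ?_
          rw [div_le_one (by positivity)]
          linarith [(Nat.cast_nonneg m : (0 : ℝ) ≤ m)]
      _ = (N : ℝ) - 1 - k := by
          simp only [Finset.sum_const, Nat.card_Ico, nsmul_eq_mul, mul_one]
          rw [Nat.cast_sub (by omega), Nat.cast_sub (by omega)]
          simp
  have hf0 : 0 ≤ ∑ k ∈ Finset.range N, p k * f k :=
    Finset.sum_nonneg fun k _ => mul_nonneg (hp0 k) (Finset.sum_nonneg fun m _ => by positivity)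
  have hp0D : p 0 ≤ D := by
    calc p 0 ≤ p 0 * ((N : ℝ) - 1 - (0 : ℕ)) := by
          have := hp0 0
          push_cast
          nlinarith
      _ ≤ D := Finset.single_le_sum (f := fun k : ℕ => p k * ((N : ℝ) - 1 - k))
          (fun k hk => mul_nonneg (hp0 k) (by linarith [hle k hk]))
          (Finset.mem_range.2 (by omega : 0 < N))
  have hHle : H ≤ N - 1 := by
    calc H ≤ ∑ m ∈ Finset.range (N - 1), (1 : ℝ) := by
          refine Finset.sum_le_sum fun m _ => ?_
          rw [div_le_one (by positivity)]
          linarith [(Nat.cast_nonneg m : (0 : ℝ) ≤ m)]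
      _ = (N : ℝ) - 1 := by
          simp only [Finset.sum_const, Finset.card_range, nsmul_eq_mul, mul_one]
          rw [Nat.cast_sub (by omega)]
          simp
  have hN1 : 0 < (N : ℝ) - 1 := by linarith
  have hρD : D = ((N : ℝ) - 1) / ρ * (2 * H + 1 - p 0
      - 2 * ∑ k ∈ Finset.range N, p k * f k) := by
    rw [← hmain]; field_simp
  have hcoef : 0 < ((N : ℝ) - 1) / ρ := div_pos hN1 hρ0
  have hDle : D ≤ 2 * (N : ℝ) ^ 2 / ρ := by
    calc D ≤ ((N : ℝ) - 1) / ρ * (2 * N) := by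
          rw [hρD]
          exact mul_le_mul_of_nonneg_left (by linarith [hp0 0]) hcoef.le
      _ ≤ 2 * (N : ℝ) ^ 2 / ρ := by
          rw [div_mul_eq_mul_div]
          exact div_le_div_of_nonneg_right (by nlinarith) hρ0.le
  have hDge : ((N : ℝ) - 1) / ρ * (2 * H + 1) - 6 * (N : ℝ) ^ 3 / ρ ^ 2 ≤ D := by
    have h1 : ((N : ℝ) - 1) / ρ * (2 * H + 1 - 3 * D) ≤ D := by
      conv_rhs => rw [hρD]
      exact mul_le_mul_of_nonneg_left (by linarith) hcoef.le
    have h2 : ((N : ℝ) - 1) / ρ * (3 * D) ≤ 6 * (N : ℝ) ^ 3 / ρ ^ 2 := by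
      calc ((N : ℝ) - 1) / ρ * (3 * D) ≤ ((N : ℝ) / ρ) * (3 * (2 * (N : ℝ) ^ 2 / ρ)) := by
            apply mul_le_mul _ (by linarith) (by positivity) (by positivity)
            exact div_le_div_of_nonneg_right (by linarith) hρ0.le
        _ = 6 * (N : ℝ) ^ 3 / ρ ^ 2 := by field_simp; ring
    linarith [mul_sub (((N : ℝ) - 1) / ρ) (2 * H + 1) (3 * D)]
  have htarget := log_target_le hN
  rw [hbD, ← sub_mul]
  refine mul_le_mul_of_nonneg_right ?_ (sq_nonneg σ)
  calc _ ≤ ((N : ℝ) - 1) / (N : ℝ) ^ 2 * (2 * H + 1) * ρ⁻¹ - 6 * ((N : ℝ) / ρ ^ 2) := by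
        have : ((N : ℝ) - 1) / (N : ℝ) ^ 2 * (7 / 2 + Real.log (((N : ℝ) - 2) / 2)
            + ((N : ℝ) - 5) / (((N : ℝ) - 1) * ((N : ℝ) - 2))) * ρ⁻¹
            ≤ ((N : ℝ) - 1) / (N : ℝ) ^ 2 * (2 * H + 1) * ρ⁻¹ := by
          gcongr
        linarith
    _ = (((N : ℝ) - 1) / ρ * (2 * H + 1) - 6 * (N : ℝ) ^ 3 / ρ ^ 2) / (N : ℝ) ^ 2 := by
        field_simp
    _ ≤ D / (N : ℝ) ^ 2 := by gcongr

/-- The sources of events: the replacement clocks and the interaction clocks. -/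
abbrev Source (N : ℕ) : Type := Fin N ⊕ AgentPair N

/-- The rate of the clock of a source of events. -/
def sourceRate (N : ℕ) (lamR lamC : ℝ) : Source N → ℝ
  | Sum.inl _ => lamR
  | Sum.inr _ => lamC / ((N : ℝ) - 1)

/-- The set of agents that hold recent information on `j` after an event of the given source, if
the set was `S` before it. -/
def updateSet {N : ℕ} (j : Fin N) (S : Finset (Fin N)) : Source N → Finset (Fin N)
  | Sum.inl l => insert j (S.erase l)
  | Sum.inr p => if p.1.1 ∈ S ∨ p.1.2 ∈ S then insert p.1.1 (insert p.1.2 S) else S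

lemma mem_updateSet {N : ℕ} {j : Fin N} {S : Finset (Fin N)} (h : j ∈ S) (c : Source N) :
    j ∈ updateSet j S c := by
  rcases c with l | p
  · simp [updateSet]
  · simp only [updateSet]; split_ifs <;> simp [h]

/-- The total rate of all the clocks. -/
def totalRate (N : ℕ) (lamR lamC : ℝ) : ℝ := ∑ c, sourceRate N lamR lamC c

lemma sourceRate_nonneg {N : ℕ} {lamR lamC : ℝ} (hN : 2 ≤ N) (hr : 0 < lamR) (hc : 0 < lamC)
    (c : Source N) : 0 ≤ sourceRate N lamR lamC c := by
  have : (2 : ℝ) ≤ N := by exact_mod_cast hN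
  rcases c with l | p
  · exact hr.le
  · exact div_nonneg hc.le (by linarith)

/-- The number of unordered pairs with exactly one member in `S`. -/
lemma card_crossing {N : ℕ} (S : Finset (Fin N)) :
    (Finset.univ.filter (fun p : AgentPair N => ¬(p.1.1 ∈ S ↔ p.1.2 ∈ S))).card
      = S.card * (N - S.card) := by
  have h : (S ×ˢ Sᶜ).card = S.card * (N - S.card) := by
    rw [Finset.card_product, Finset.card_compl, Fintype.card_fin]
  rw [← h]
  refine Finset.card_bij (fun p _ => if p.1.1 ∈ S then (p.1.1, p.1.2) else (p.1.2, p.1.1))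
    ?_ ?_ ?_
  · intro p hp
    simp only [Finset.mem_filter] at hp
    by_cases h1 : p.1.1 ∈ S
    · have : p.1.2 ∉ S := by tauto
      simp [h1, this]
    · have : p.1.2 ∈ S := by tauto
      simp [h1, this]
  · rintro ⟨⟨a, b⟩, hab⟩ hp ⟨⟨a', b'⟩, hab'⟩ hp' heq
    simp only [Finset.mem_filter, Finset.mem_univ, true_and] at hp hp' heq hab hab'
    by_cases h1 : a ∈ S <;> by_cases h2 : a' ∈ S <;> simp only [h1, h2, if_true, if_false,
      Prod.mk.injEq] at heq
    · obtain ⟨rfl, rfl⟩ := heq; rfl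
    · obtain ⟨rfl, rfl⟩ := heq; exact absurd hab hab'.asymm
    · obtain ⟨rfl, rfl⟩ := heq; exact absurd hab hab'.asymm
    · obtain ⟨rfl, rfl⟩ := heq; rfl
  · rintro ⟨a, b⟩ hab
    simp only [Finset.mem_product, Finset.mem_compl] at hab
    have hne : a ≠ b := fun h => hab.2 (h ▸ hab.1)
    rcases lt_or_gt_of_ne hne with h | h
    · exact ⟨⟨(a, b), h⟩, by simp [hab.1, hab.2], by simp [hab.1]⟩
    · exact ⟨⟨(b, a), h⟩, by simp [hab.1, hab.2], by simp [hab.2]⟩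

lemma sum_sourceRate_mul_updateSet {N : ℕ} {lamR lamC : ℝ} (f : ℕ → ℝ) {j : Fin N}
    {S : Finset (Fin N)} (hj : j ∈ S) :
    ∑ c, sourceRate N lamR lamC c * (f ((updateSet j S c).card - 1) - f (S.card - 1))
      = gossipGen N lamR lamC f (S.card - 1) := by
  have hS : 0 < S.card := Finset.card_pos.2 ⟨j, hj⟩
  have hSN : S.card ≤ N := by simpa using Finset.card_le_univ S
  rw [Fintype.sum_sum_type]
  have h1 : ∀ l : Fin N, sourceRate N lamR lamC (Sum.inl l) *
      (f ((updateSet j S (Sum.inl l)).card - 1) - f (S.card - 1))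
      = if l ∈ S.erase j then lamR * (f (S.card - 1 - 1) - f (S.card - 1)) else 0 := by
    intro l
    simp only [sourceRate, updateSet]
    by_cases hl : l ∈ S.erase j
    · obtain ⟨hlj, hlS⟩ := Finset.mem_erase.1 hl
      rw [if_pos hl, Finset.insert_eq_self.2 (Finset.mem_erase.2 ⟨hlj.symm, hj⟩),
        Finset.card_erase_of_mem hlS]
    · rw [if_neg hl]
      have : insert j (S.erase l) = S := by
        by_cases hlS : l ∈ S
        · have : l = j := by
            by_contra h
            exact hl (Finset.mem_erase.2 ⟨h, hlS⟩)
          rw [this, Finset.insert_erase hj]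
        · rw [Finset.erase_eq_of_notMem hlS, Finset.insert_eq_self.2 hj]
      rw [this]; ring
  have h2 : ∀ p : AgentPair N, sourceRate N lamR lamC (Sum.inr p) *
      (f ((updateSet j S (Sum.inr p)).card - 1) - f (S.card - 1))
      = if ¬(p.1.1 ∈ S ↔ p.1.2 ∈ S) then
          lamC / ((N : ℝ) - 1) * (f (S.card - 1 + 1) - f (S.card - 1)) else 0 := by
    intro p
    simp only [sourceRate, updateSet]
    by_cases ha : p.1.1 ∈ S <;> by_cases hb : p.1.2 ∈ S
    · simp [ha, hb]
    · have : S.card + 1 - 1 = S.card - 1 + 1 := by omega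
      simp [ha, hb, this]
    · have : S.card + 1 - 1 = S.card - 1 + 1 := by omega
      simp [ha, hb, this]
    · simp [ha, hb]
  simp_rw [h1, h2]
  rw [Finset.sum_ite_mem, Finset.univ_inter, ← Finset.sum_filter, Finset.sum_const,
    Finset.sum_const, Finset.card_erase_of_mem hj, card_crossing]
  unfold gossipGen
  rw [nsmul_eq_mul, nsmul_eq_mul, Nat.cast_mul, Nat.cast_sub hSN, Nat.cast_sub hS]
  push_cast
  ring

lemma one_sub_exp_neg_mul_nonneg (x : ℝ) : 0 ≤ 1 - Real.exp (-x) * (1 + x) := by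
  have h1 := Real.add_one_le_exp x
  have h2 : Real.exp (-x) * Real.exp x = 1 := by rw [← Real.exp_add]; simp
  nlinarith [Real.exp_pos (-x)]

lemma one_sub_exp_neg_mul_le {x : ℝ} (hx : 0 ≤ x) : 1 - Real.exp (-x) * (1 + x) ≤ x ^ 2 := by
  have h1 := Real.add_one_le_exp (-x)
  nlinarith [Real.exp_pos (-x)]

/-- The transition operator over a time interval of length `δ` of the set process that makes one
step at an interval with one event, and jumps to the set of all agents at an interval with more
events. -/
def stepOp (N : ℕ) (lamR lamC : ℝ) (j : Fin N) (δ : ℝ) :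
    (Finset (Fin N) → ℝ) →ₗ[ℝ] (Finset (Fin N) → ℝ) where
  toFun F S := Real.exp (-(totalRate N lamR lamC * δ)) *
      (F S + δ * ∑ c, sourceRate N lamR lamC c * F (updateSet j S c))
    + (1 - Real.exp (-(totalRate N lamR lamC * δ)) * (1 + totalRate N lamR lamC * δ)) *
      F Finset.univ
  map_add' F G := by
    funext S
    simp only [Pi.add_apply, mul_add, Finset.sum_add_distrib]
    ring
  map_smul' a F := by
    funext S
    have : ∑ c, sourceRate N lamR lamC c * (a * F (updateSet j S c))
        = a * ∑ c, sourceRate N lamR lamC c * F (updateSet j S c) := by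
      rw [Finset.mul_sum]
      exact Finset.sum_congr rfl fun _ _ => by ring
    simp only [Pi.smul_apply, smul_eq_mul, RingHom.id_apply, this]
    ring

lemma stepOp_apply (N : ℕ) (lamR lamC : ℝ) (j : Fin N) (δ : ℝ) (F : Finset (Fin N) → ℝ)
    (S : Finset (Fin N)) : stepOp N lamR lamC j δ F S
      = Real.exp (-(totalRate N lamR lamC * δ)) *
      (F S + δ * ∑ c, sourceRate N lamR lamC c * F (updateSet j S c))
    + (1 - Real.exp (-(totalRate N lamR lamC * δ)) * (1 + totalRate N lamR lamC * δ)) *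
      F Finset.univ := rfl

lemma stepOp_pow_nonneg {N : ℕ} {lamR lamC : ℝ} (hN : 2 ≤ N) (hr : 0 < lamR) (hc : 0 < lamC)
    {j : Fin N} {δ : ℝ} (hδ : 0 ≤ δ) (k : ℕ) {F : Finset (Fin N) → ℝ}
    (hF : ∀ S, j ∈ S → 0 ≤ F S) : ∀ S, j ∈ S → 0 ≤ (stepOp N lamR lamC j δ ^ k) F S := by
  induction k generalizing F with
  | zero => simpa using hF
  | succ k ih =>
    intro S hS
    rw [pow_succ, Module.End.mul_apply]
    refine ih (fun S hS => ?_) S hS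
    rw [stepOp_apply]
    refine add_nonneg (mul_nonneg (Real.exp_pos _).le (add_nonneg (hF S hS)
      (mul_nonneg hδ (Finset.sum_nonneg fun c _ => ?_)))) (mul_nonneg ?_ (hF _ (by simp)))
    · exact mul_nonneg (sourceRate_nonneg hN hr hc c) (hF _ (mem_updateSet hS c))
    · exact one_sub_exp_neg_mul_nonneg _

lemma stepOp_pow_mono {N : ℕ} {lamR lamC : ℝ} (hN : 2 ≤ N) (hr : 0 < lamR) (hc : 0 < lamC)
    {j : Fin N} {δ : ℝ} (hδ : 0 ≤ δ) (k : ℕ) {F G : Finset (Fin N) → ℝ}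
    (hFG : ∀ S, j ∈ S → F S ≤ G S) {S : Finset (Fin N)} (hS : j ∈ S) :
    (stepOp N lamR lamC j δ ^ k) F S ≤ (stepOp N lamR lamC j δ ^ k) G S := by
  have := stepOp_pow_nonneg hN hr hc hδ k (F := G - F)
    (fun S hS => by simpa using hFG S hS) S hS
  rw [map_sub] at this
  simpa using this

lemma stepOp_one (N : ℕ) (lamR lamC : ℝ) (j : Fin N) (δ : ℝ) :
    stepOp N lamR lamC j δ 1 = 1 := by
  funext S
  rw [stepOp_apply]
  simp only [Pi.one_apply, mul_one]
  rw [← totalRate]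
  ring

lemma stepOp_pow_one (N : ℕ) (lamR lamC : ℝ) (j : Fin N) (δ : ℝ) (k : ℕ) :
    (stepOp N lamR lamC j δ ^ k) 1 = 1 := by
  induction k with
  | zero => rfl
  | succ k ih => rw [pow_succ, Module.End.mul_apply, stepOp_one, ih]

/-- The proportion of the other agents that are in `S`. -/
def otherShare (N : ℕ) (S : Finset (Fin N)) : ℝ := ((S.card - 1 : ℕ) : ℝ) / ((N : ℝ) - 1)

lemma otherShare_nonneg {N : ℕ} (hN : 2 ≤ N) (S : Finset (Fin N)) : 0 ≤ otherShare N S := by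
  have : (2 : ℝ) ≤ N := by exact_mod_cast hN
  exact div_nonneg (Nat.cast_nonneg _) (by linarith)

lemma otherShare_le_one {N : ℕ} (hN : 2 ≤ N) (S : Finset (Fin N)) : otherShare N S ≤ 1 := by
  have h2 : (2 : ℝ) ≤ N := by exact_mod_cast hN
  have hSN : S.card ≤ N := by simpa using Finset.card_le_univ S
  rw [otherShare, div_le_one (by linarith)]
  have h3 : ((S.card - 1 : ℕ) : ℝ) ≤ ((N - 1 : ℕ) : ℝ) :=
    Nat.cast_le.2 (Nat.sub_le_sub_right hSN 1)
  have h4 : ((N - 1 : ℕ) : ℝ) = (N : ℝ) - 1 := by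
    rw [Nat.cast_sub (by omega : 1 ≤ N), Nat.cast_one]
  linarith

set_option maxHeartbeats 800000 in
/-- The discounted time spent by the set process, bounded through the potential `g`. -/
theorem discounted_sum_le {N : ℕ} {lamR lamC : ℝ} (hN : 2 ≤ N) (hr : 0 < lamR) (hc : 0 < lamC)
    {g : ℕ → ℝ} (hg : ∀ k < N, 2 * lamR * g k - gossipGen N lamR lamC g k
      = (k : ℝ) / ((N : ℝ) - 1)) :
    ∃ C : ℝ, ∀ (j : Fin N) (δ : ℝ), 0 < δ → ∀ n : ℕ,
      δ * ∑ k ∈ Finset.range n, Real.exp (-(2 * lamR * δ)) ^ k *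
          (stepOp N lamR lamC j δ ^ k) (otherShare N) {j}
        ≤ g 0 + C * Real.exp (-(2 * lamR * δ)) ^ n + n * (C * δ ^ 2) := by
  set Λ := totalRate N lamR lamC with hΛ
  have hΛ0 : 0 ≤ Λ := Finset.sum_nonneg fun c _ => sourceRate_nonneg hN hr hc c
  set M := ∑ k ∈ Finset.range N, |g k| with hM
  have hM0 : 0 ≤ M := Finset.sum_nonneg fun _ _ => abs_nonneg _
  have hgM : ∀ k < N, |g k| ≤ M := fun k hk =>
    Finset.single_le_sum (f := fun k => |g k|) (fun _ _ => abs_nonneg _) (Finset.mem_range.2 hk)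
  set G : Finset (Fin N) → ℝ := fun S => g (S.card - 1) with hG
  have hcard : ∀ S : Finset (Fin N), S.card - 1 < N := by
    intro S
    have hSN : S.card ≤ N := by simpa using Finset.card_le_univ S
    omega
  have hGM : ∀ S, |G S| ≤ M := fun S => hgM _ (hcard S)
  set C₁ := 2 * M * Λ ^ 2 + Λ * (2 * lamR * M + 1) with hC₁
  set C₂ := C₁ + 4 * lamR ^ 2 * M + 2 * lamR with hC₂
  have hC₁0 : 0 ≤ C₁ := by positivity
  refine ⟨M + C₂, fun j δ hδ => ?_⟩
  have hstep : ∀ S, j ∈ S → stepOp N lamR lamC j δ G S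
      ≤ ((1 + 2 * lamR * δ) • G - δ • otherShare N + (C₁ * δ ^ 2) • (1 : Finset (Fin N) → ℝ)) S := by
    intro S hS
    have hsum : ∑ c, sourceRate N lamR lamC c * G (updateSet j S c)
        = Λ * G S + 2 * lamR * G S - otherShare N S := by
      have h1 := sum_sourceRate_mul_updateSet (lamR := lamR) (lamC := lamC) g hS
      have h2 := hg _ (hcard S)
      simp only [mul_sub, Finset.sum_sub_distrib] at h1
      rw [← Finset.sum_mul, ← totalRate, ← hΛ] at h1
      simp only [hG, otherShare]
      linarith
    rw [stepOp_apply, hsum, ← hΛ]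
    simp only [Pi.add_apply, Pi.sub_apply, Pi.smul_apply, smul_eq_mul, Pi.one_apply, mul_one]
    set x := Λ * δ with hx
    have hx0 : 0 ≤ x := mul_nonneg hΛ0 hδ.le
    have e1 := one_sub_exp_neg_mul_nonneg x
    have e2 := one_sub_exp_neg_mul_le hx0
    set q := 1 - Real.exp (-x) * (1 + x) with hq
    have e3 : 0 ≤ 1 - Real.exp (-x) := by
      have := Real.exp_le_one_iff.2 (neg_nonpos.2 hx0); linarith
    have e4 : 1 - Real.exp (-x) ≤ x := by linarith [Real.add_one_le_exp (-x)]
    have hGS := abs_le.1 (hGM S)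
    have hGU := abs_le.1 (hGM Finset.univ)
    have hW0 := otherShare_nonneg hN S
    have hW1 := otherShare_le_one hN S
    have hid : Real.exp (-x) * (G S + δ * (Λ * G S + 2 * lamR * G S - otherShare N S))
        + q * G Finset.univ = (1 + 2 * lamR * δ) * G S - δ * otherShare N S
          + (q * (G Finset.univ - G S)
            + (1 - Real.exp (-x)) * (δ * (otherShare N S - 2 * lamR * G S))) := by
      rw [hq, hx]; ring
    rw [hid]
    have b1 : q * (G Finset.univ - G S) ≤ x ^ 2 * (2 * M) :=
      (mul_le_mul_of_nonneg_left (by linarith) e1).trans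
        (mul_le_mul_of_nonneg_right e2 (by linarith))
    have b2 : (1 - Real.exp (-x)) * (δ * (otherShare N S - 2 * lamR * G S))
        ≤ x * (δ * (2 * lamR * M + 1)) := by
      have h5 : otherShare N S - 2 * lamR * G S ≤ 2 * lamR * M + 1 := by
        have := mul_le_mul_of_nonneg_left hGS.1 (by positivity : 0 ≤ 2 * lamR)
        linarith
      calc _ ≤ (1 - Real.exp (-x)) * (δ * (2 * lamR * M + 1)) :=
            mul_le_mul_of_nonneg_left (mul_le_mul_of_nonneg_left h5 hδ.le) e3
        _ ≤ _ := mul_le_mul_of_nonneg_right e4 (by positivity)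
    have : x ^ 2 * (2 * M) + x * (δ * (2 * lamR * M + 1)) = C₁ * δ ^ 2 := by
      rw [hx, hC₁]; ring
    linarith
  set r := Real.exp (-(2 * lamR * δ)) with hrdef
  have hr0 : 0 < r := Real.exp_pos _
  set a : ℕ → ℝ := fun k => (stepOp N lamR lamC j δ ^ k) G {j} with ha
  set h : ℕ → ℝ := fun k => (stepOp N lamR lamC j δ ^ k) (otherShare N) {j} with hh
  have hj : j ∈ ({j} : Finset (Fin N)) := Finset.mem_singleton_self j
  have hh1 : ∀ k, h k ≤ 1 := by
    intro k
    have := stepOp_pow_mono hN hr hc hδ.le k (F := otherShare N) (G := 1)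
      (fun S _ => otherShare_le_one hN S) hj
    rwa [stepOp_pow_one] at this
  have hh0 : ∀ k, 0 ≤ h k := fun k =>
    stepOp_pow_nonneg hN hr hc hδ.le k (fun S _ => otherShare_nonneg hN S) _ hj
  have haM : ∀ k, |a k| ≤ M := by
    intro k
    rw [abs_le]
    have h1 := stepOp_pow_mono hN hr hc hδ.le k (F := G) (G := M • 1)
      (fun S _ => by simpa using (abs_le.1 (hGM S)).2) hj
    have h2 := stepOp_pow_mono hN hr hc hδ.le k (F := (-M) • 1) (G := G)
      (fun S _ => by simpa using (abs_le.1 (hGM S)).1) hj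
    rw [map_smul, stepOp_pow_one] at h1 h2
    simp only [Pi.smul_apply, Pi.one_apply, smul_eq_mul, mul_one] at h1 h2
    exact ⟨h2, h1⟩
  have hrec : ∀ k, a (k + 1) ≤ (1 + 2 * lamR * δ) * a k - δ * h k + C₁ * δ ^ 2 := by
    intro k
    have h1 := stepOp_pow_mono hN hr hc hδ.le k hstep hj
    rw [map_add, map_sub, map_smul, map_smul, map_smul, stepOp_pow_one] at h1
    simp only [Pi.add_apply, Pi.sub_apply, Pi.smul_apply, smul_eq_mul, Pi.one_apply,
      mul_one] at h1
    simp only [ha, pow_succ, Module.End.mul_apply]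
    exact h1
  have hr1 : r ≤ 1 := Real.exp_le_one_iff.2 (by simp only [neg_nonpos]; positivity)
  have hrec' : ∀ k, r * a (k + 1) ≤ a k - δ * h k + C₂ * δ ^ 2 := by
    intro k
    set y := 2 * lamR * δ with hy
    have hy0 : 0 ≤ y := by positivity
    have e1 := one_sub_exp_neg_mul_nonneg y
    have e2 := one_sub_exp_neg_mul_le hy0
    have e4 : 1 - r ≤ y := by linarith [Real.add_one_le_exp (-y)]
    rw [← hrdef] at e1 e2
    have hak := abs_le.1 (haM k)
    have b1 : r * a (k + 1) ≤ r * ((1 + y) * a k - δ * h k + C₁ * δ ^ 2) :=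
      mul_le_mul_of_nonneg_left (hrec k) hr0.le
    have b2 : (1 - r * (1 + y)) * (-a k) ≤ y ^ 2 * M :=
      (mul_le_mul_of_nonneg_left (by linarith) e1).trans
        (mul_le_mul_of_nonneg_right e2 hM0)
    have b3 : (1 - r) * (δ * h k) ≤ y * (δ * 1) :=
      mul_le_mul e4 (mul_le_mul_of_nonneg_left (hh1 k) hδ.le)
        (mul_nonneg hδ.le (hh0 k)) hy0
    have b4 : r * (C₁ * δ ^ 2) ≤ C₁ * δ ^ 2 := by
      exact mul_le_of_le_one_left (by positivity) hr1
    have b5 : C₂ * δ ^ 2 = C₁ * δ ^ 2 + y ^ 2 * M + y * (δ * 1) := by rw [hC₂, hy]; ring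
    have b6 : r * ((1 + y) * a k - δ * h k + C₁ * δ ^ 2)
        = a k - δ * h k + ((1 - r * (1 + y)) * (-a k) + (1 - r) * (δ * h k)
          + r * (C₁ * δ ^ 2)) := by ring
    linarith
  have hC₂0 : 0 ≤ C₂ := by positivity
  have htel : ∀ n : ℕ, δ * ∑ k ∈ Finset.range n, r ^ k * h k
      ≤ a 0 - r ^ n * a n + n * (C₂ * δ ^ 2) := by
    intro n
    induction n with
    | zero => simp
    | succ n ih =>
      rw [Finset.sum_range_succ, mul_add, pow_succ]
      have h1 := mul_le_mul_of_nonneg_left (hrec' n) (pow_nonneg hr0.le n)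
      have h2 : r ^ n * (C₂ * δ ^ 2) ≤ C₂ * δ ^ 2 := by
        exact mul_le_of_le_one_left (by positivity) (pow_le_one₀ hr0.le hr1)
      have h3 : r ^ n * (a n - δ * h n + C₂ * δ ^ 2)
          = r ^ n * a n - δ * (r ^ n * h n) + r ^ n * (C₂ * δ ^ 2) := by ring
      have h4 : r ^ n * r * a (n + 1) = r ^ n * (r * a (n + 1)) := by ring
      rw [h3] at h1
      rw [h4]
      push_cast
      linarith
  intro n
  refine (htel n).trans ?_
  have h0 : a 0 = g 0 := by simp [ha, hG]
  have h1 : -(r ^ n * a n) ≤ (M + C₂) * r ^ n := by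
    calc -(r ^ n * a n) = -a n * r ^ n := by ring
      _ ≤ (M + C₂) * r ^ n :=
        mul_le_mul_of_nonneg_right (by linarith [(abs_le.1 (haM n)).1]) (pow_nonneg hr0.le n)
  have h2 : (n : ℝ) * (C₂ * δ ^ 2) ≤ n * ((M + C₂) * δ ^ 2) := by
    gcongr
    linarith
  rw [h0]
  linarith

namespace EventSeq

variable {N : ℕ}

/-- At time `t` agent `i` holds information about `j` that was sent out after time `u`, or `i` is
`j` itself. -/
def Reach (e : EventSeq N) (j : Fin N) (u : ℝ) (i : Fin N) (t : ℝ) : Prop :=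
  (i = j ∧ u < t) ∨ ∃ (m : Fin N) (τ : ℝ), u < τ ∧ e.Knows i t (Sum.inr (j, m, τ))

lemma Reach.mono {e : EventSeq N} {j i : Fin N} {u u' t : ℝ} (h : e.Reach j u i t) (hu : u' ≤ u) :
    e.Reach j u' i t := by
  rcases h with ⟨h1, h2⟩ | ⟨m, τ, h1, h2⟩
  · exact Or.inl ⟨h1, hu.trans_lt h2⟩
  · exact Or.inr ⟨m, τ, hu.trans_lt h1, h2⟩

lemma Knows.time_le {e : EventSeq N} {i : Fin N} {t : ℝ} {q : Info N} (h : e.Knows i t q) :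
    ∀ j m τ, q = Sum.inr (j, m, τ) → τ ≤ t := by
  induction h with
  | arrival i t h => simp
  | keep i s t q _ hst _ ih => intro j m τ hq; exact (ih j m τ hq).trans hst
  | receive j i s t q _ _ hst _ ih => intro j m τ hq; exact (ih j m τ hq).trans hst.le
  | learn => simp
  | record j i t ht =>
    rintro _ _ _ h
    simp only [Sum.inr.injEq, Prod.mk.injEq] at h
    exact h.2.2.ge

lemma Reach.lt {e : EventSeq N} {j i : Fin N} {u t : ℝ} (h : e.Reach j u i t) : u < t := by
  rcases h with ⟨_, h2⟩ | ⟨m, τ, h1, h2⟩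
  · exact h2
  · exact h1.trans_le (h2.time_le _ _ _ rfl)

lemma Reach.keep {e : EventSeq N} {j i : Fin N} {u s t : ℝ} (h : e.Reach j u i s) (hst : s ≤ t)
    (hr : ∀ r ∈ e.repl i, r ∉ Set.Ioc s t) : e.Reach j u i t := by
  rcases h with ⟨h1, h2⟩ | ⟨m, τ, h1, h2⟩
  · exact Or.inl ⟨h1, h2.trans_le hst⟩
  · exact Or.inr ⟨m, τ, h1, Knows.keep i s t _ h2 hst hr⟩

lemma Reach.record {e : EventSeq N} {j i : Fin N} {u t : ℝ} (ht : t ∈ e.exch j i) (hu : u < t) :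
    e.Reach j u i t :=
  Or.inr ⟨i, t, hu, Knows.record j i t ht⟩

lemma Reach.receive {e : EventSeq N} {j l i : Fin N} {u s t : ℝ} (h : e.Reach j u l s)
    (ht : t ∈ e.exch l i) (hst : s < t) (hr : ∀ r ∈ e.repl l, r ∉ Set.Ioo s t) :
    e.Reach j u i t := by
  rcases h with ⟨h1, h2⟩ | ⟨m, τ, h1, h2⟩
  · subst h1; exact Reach.record ht (h2.trans hst)
  · exact Or.inr ⟨m, τ, h1, Knows.receive l i s t _ ht h2 hst hr⟩

/-- `e` and `e'` differ only in the replacements and the values of `j` after time `u`. -/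
structure AgreeUntil (e e' : EventSeq N) (j : Fin N) (u : ℝ) : Prop where
  exch : ∀ a b, e.exch a b = e'.exch a b
  repl : ∀ i, i ≠ j → e.repl i = e'.repl i
  val : ∀ i, i ≠ j → e.val i = e'.val i
  repl_self : ∀ x ≤ u, x ∈ e.repl j ↔ x ∈ e'.repl j
  value_self : ∀ t ≤ u, e.value j t = e'.value j t

namespace AgreeUntil

variable {e e' : EventSeq N} {j : Fin N} {u : ℝ}

lemma symm (h : AgreeUntil e e' j u) : AgreeUntil e' e j u where
  exch a b := (h.exch a b).symm
  repl i hi := (h.repl i hi).symm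
  val i hi := (h.val i hi).symm
  repl_self x hx := (h.repl_self x hx).symm
  value_self t ht := (h.value_self t ht).symm

lemma value_eq (h : AgreeUntil e e' j u) {i : Fin N} {t : ℝ} (hi : i = j → t ≤ u) :
    e.value i t = e'.value i t := by
  by_cases hij : i = j
  · subst hij; exact h.value_self t (hi rfl)
  · simp only [EventSeq.value, h.repl i hij, h.val i hij]

lemma mem_repl_iff (h : AgreeUntil e e' j u) {i : Fin N} {t : ℝ} (hi : i = j → t ≤ u) :
    t ∈ e.repl i ↔ t ∈ e'.repl i := by
  by_cases hij : i = j
  · subst hij; exact h.repl_self t (hi rfl)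
  · rw [h.repl i hij]

lemma reach_or_knows (h : AgreeUntil e e' j u) {i : Fin N} {t : ℝ} {q : Info N}
    (hq : e.Knows i t q) : e'.Reach j u i t ∨ e'.Knows i t q := by
  induction hq with
  | arrival i t ht =>
    by_cases hi : i = j → t ≤ u
    · right
      rw [h.value_eq hi]
      exact Knows.arrival i t (ht.imp_right (h.mem_repl_iff hi).1)
    · push Not at hi
      exact Or.inl (Or.inl hi)
  | keep i s t q _ hst hr ih =>
    by_cases hi : i = j → t ≤ u
    · have hr' : ∀ r ∈ e'.repl i, r ∉ Set.Ioc s t := fun r hre hrt =>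
        hr r ((h.mem_repl_iff fun hij => hrt.2.trans (hi hij)).2 hre) hrt
      exact ih.imp (fun hR => hR.keep hst hr') fun hK => Knows.keep i s t q hK hst hr'
    · push Not at hi
      exact Or.inl (Or.inl hi)
  | receive l i s t q ht _ hst hr ih =>
    by_cases hl : l = j → t ≤ u
    · have hr' : ∀ r ∈ e'.repl l, r ∉ Set.Ioo s t := fun r hre hrt =>
        hr r ((h.mem_repl_iff fun hlj => hrt.2.le.trans (hl hlj)).2 hre) hrt
      rw [h.exch] at ht
      exact ih.imp (fun hR => hR.receive ht hst hr') fun hK => Knows.receive l i s t q ht hK hst hr'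
    · push Not at hl
      obtain ⟨rfl, hu⟩ := hl
      rw [h.exch] at ht
      exact Or.inl (Reach.record ht hu)
  | learn l i t ht =>
    rw [h.exch] at ht
    by_cases hl : l = j → t ≤ u
    · right
      rw [h.value_eq hl]
      exact Knows.learn l i t ht
    · push Not at hl
      obtain ⟨rfl, hu⟩ := hl
      exact Or.inl (Reach.record ht hu)
  | record l i t ht =>
    rw [h.exch] at ht
    exact Or.inr (Knows.record l i t ht)

lemma reach_imp (h : AgreeUntil e e' j u) {i : Fin N} {t : ℝ} (hR : e.Reach j u i t) :
    e'.Reach j u i t := by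
  rcases hR with h1 | ⟨m, τ, h1, h2⟩
  · exact Or.inl h1
  · exact (h.reach_or_knows h2).elim id fun hK => Or.inr ⟨m, τ, h1, hK⟩

lemma reach_iff (h : AgreeUntil e e' j u) (i : Fin N) (t : ℝ) :
    e.Reach j u i t ↔ e'.Reach j u i t :=
  ⟨h.reach_imp, h.symm.reach_imp⟩

/-- Without recent information about `j`, what an agent knows does not depend on the recent
replacements of `j`. -/
lemma knowledge_eq (h : AgreeUntil e e' j u) {i : Fin N} {t : ℝ} (hR : ¬ e.Reach j u i t) :
    e.knowledge i t = e'.knowledge i t := by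
  ext q
  exact ⟨fun hq => (h.reach_or_knows hq).resolve_left fun h' => hR ((h.reach_iff i t).2 h'),
    fun hq => (h.symm.reach_or_knows hq).resolve_left hR⟩

end AgreeUntil

lemma reach_iff_of_knowledge_eq {e e' : EventSeq N} {i : Fin N} {t : ℝ}
    (h : e.knowledge i t = e'.knowledge i t) (j : Fin N) (u : ℝ) :
    e.Reach j u i t ↔ e'.Reach j u i t := by
  have : ∀ q, e.Knows i t q ↔ e'.Knows i t q := fun q => Set.ext_iff.1 h q
  simp only [Reach, this]

/-- A time-dependent set of agents that is closed under the transmission of information contains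
the agents with recent information. -/
lemma Knows.mem_of_closed {e : EventSeq N} {j : Fin N} {u a b : ℝ} (S : ℝ → Finset (Fin N))
    (hkeep : ∀ i s v, a ≤ s → s ≤ v → v ≤ b → i ∈ S s → (∀ r ∈ e.repl i, r ∉ Set.Ioc s v) →
      i ∈ S v)
    (hreceive : ∀ l i s v, a ≤ s → s < v → v ≤ b → v ∈ e.exch l i → l ∈ S s → i ∈ S v)
    (hrecord : ∀ i v, a < v → v ≤ b → v ∈ e.exch j i → i ∈ S v)
    (hstart : ∀ i m τ, u < τ → e.Knows i a (Sum.inr (j, m, τ)) → i ∈ S a)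
    {i : Fin N} {v : ℝ} {q : Info N} (hq : e.Knows i v q) :
    ∀ m τ, q = Sum.inr (j, m, τ) → u < τ → a ≤ v → v ≤ b → i ∈ S v := by
  induction hq with
  | arrival => simp
  | learn => simp
  | record l i t ht =>
    intro m τ hq hu hat htb
    have hq' := hq
    simp only [Sum.inr.injEq, Prod.mk.injEq] at hq'
    obtain ⟨rfl, rfl, rfl⟩ := hq'
    rcases hat.eq_or_lt with rfl | hlt
    · exact hstart _ _ _ hu (Knows.record l i _ ht)
    · exact hrecord i t hlt htb ht
  | keep i s t q hk hst hr ih =>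
    intro m τ hq hu hat htb
    subst hq
    rcases le_total a s with has | hsa
    · exact hkeep i s t has hst htb (ih m τ rfl hu has (hst.trans htb)) hr
    · have h1 : e.Knows i a (Sum.inr (j, m, τ)) := Knows.keep i s a _ hk hsa
        fun r hre hra => hr r hre ⟨hra.1, hra.2.trans hat⟩
      exact hkeep i a t le_rfl hat htb (hstart i m τ hu h1)
        fun r hre hra => hr r hre ⟨hsa.trans_lt hra.1, hra.2⟩
  | receive l i s t q ht hk hst hr ih =>
    intro m τ hq hu hat htb
    subst hq
    rcases hat.eq_or_lt with rfl | hlt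
    · exact hstart _ _ _ hu (Knows.receive l i s _ _ ht hk hst hr)
    · rcases le_total a s with has | hsa
      · exact hreceive l i s t has hst htb ht (ih m τ rfl hu has (hst.le.trans htb))
      · have h1 : e.Knows l a (Sum.inr (j, m, τ)) := Knows.keep l s a _ hk hsa
          fun r hre hra => hr r hre ⟨hra.1, hra.2.trans_lt hlt⟩
        exact hreceive l i a t le_rfl hlt htb ht (hstart l m τ hu h1)

/-- The clock of a source of events. -/
def clock (e : EventSeq N) : Source N → Set ℝ
  | Sum.inl i => e.repl i
  | Sum.inr p => e.exch p.1.1 p.1.2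

/-- The set of the agents with information about `j` sent out after time `u`, and `j`. -/
def informed (e : EventSeq N) (j : Fin N) (u t : ℝ) : Finset (Fin N) := by
  classical
  exact Finset.univ.filter fun i => i = j ∨ e.Reach j u i t

lemma mem_informed {e : EventSeq N} {j i : Fin N} {u t : ℝ} :
    i ∈ e.informed j u t ↔ i = j ∨ e.Reach j u i t := by
  classical
  simp [informed]

end EventSeq

open Classical in
/-- The update of a set of informed agents by an interval with given numbers of events. -/
def slotUpdate {N : ℕ} (j : Fin N) (S : Finset (Fin N)) (n : Source N → ℕ) : Finset (Fin N) :=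
  if n = 0 then S
  else if h : ∃ c, n = Pi.single c 1 then updateSet j S h.choose
  else Finset.univ

lemma slotUpdate_zero {N : ℕ} (j : Fin N) (S : Finset (Fin N)) : slotUpdate j S 0 = S := by
  simp [slotUpdate]

lemma single_one_injective {N : ℕ} {c c' : Source N}
    (h : (Pi.single c 1 : Source N → ℕ) = Pi.single c' 1) : c = c' := by
  by_contra hne
  have := congrFun h c
  simp [hne] at this

lemma slotUpdate_single {N : ℕ} (j : Fin N) (S : Finset (Fin N)) (c : Source N) :
    slotUpdate j S (Pi.single c 1) = updateSet j S c := by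
  have h : ∃ c', (Pi.single c 1 : Source N → ℕ) = Pi.single c' 1 := ⟨c, rfl⟩
  have h0 : (Pi.single c 1 : Source N → ℕ) ≠ 0 := by
    intro h0
    have := congrFun h0 c
    simp at this
  rw [slotUpdate, if_neg h0, dif_pos h, ← single_one_injective h.choose_spec]

lemma slotUpdate_of_ne {N : ℕ} (j : Fin N) (S : Finset (Fin N)) {n : Source N → ℕ} (h0 : n ≠ 0)
    (h1 : ∀ c, n ≠ Pi.single c 1) : slotUpdate j S n = Finset.univ := by
  rw [slotUpdate, if_neg h0, dif_neg]
  rintro ⟨c, hc⟩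
  exact h1 c hc

lemma mem_slotUpdate {N : ℕ} {j : Fin N} {S : Finset (Fin N)} (h : j ∈ S) (n : Source N → ℕ) :
    j ∈ slotUpdate j S n := by
  unfold slotUpdate
  split_ifs
  · exact h
  · exact mem_updateSet h _
  · simp

namespace EventSeq

variable {N : ℕ}

lemma informed_subset_slotUpdate {e : EventSeq N} (hsymm : ∀ i j, e.exch i j = e.exch j i)
    (hself : ∀ i, e.exch i i = ∅) {j : Fin N} {u a b : ℝ}
    (hab : a ≤ b) (hfin : ∀ c, (e.clock c ∩ Set.Ioc a b).Finite) {S : Finset (Fin N)} (hj : j ∈ S)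
    (hS : e.informed j u a ⊆ S) :
    e.informed j u b ⊆ slotUpdate j S fun c => tickCount (e.clock c) a b := by
  set n : Source N → ℕ := fun c => tickCount (e.clock c) a b with hn
  have hstart : ∀ i m τ, u < τ → e.Knows i a (Sum.inr (j, m, τ)) → i ∈ S := fun i m τ hu hk =>
    hS (mem_informed.2 (Or.inr (Or.inr ⟨m, τ, hu, hk⟩)))
  have hempty : ∀ c, n c = 0 → ∀ x ∈ e.clock c, a < x → x ≤ b → False := by
    intro c hc x hx h1 h2
    have := (Set.ncard_eq_zero (hfin c)).1 hc
    exact (Set.mem_empty_iff_false x).1 (this ▸ ⟨hx, h1, h2⟩)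
  have hexch : ∀ l i x, x ∈ e.exch l i → ∃ p : AgentPair N, x ∈ e.clock (Sum.inr p) ∧
      ((l = p.1.1 ∧ i = p.1.2) ∨ (l = p.1.2 ∧ i = p.1.1)) := by
    intro l i x hx
    rcases lt_trichotomy l i with h | h | h
    · exact ⟨⟨(l, i), h⟩, hx, Or.inl ⟨rfl, rfl⟩⟩
    · subst h; rw [hself] at hx; exact hx.elim
    · rw [hsymm] at hx
      exact ⟨⟨(i, l), h⟩, hx, Or.inr ⟨rfl, rfl⟩⟩
  have hfinish : ∀ S' : ℝ → Finset (Fin N), j ∈ S' b →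
      (∀ i s v, a ≤ s → s ≤ v → v ≤ b → i ∈ S' s → (∀ r ∈ e.repl i, r ∉ Set.Ioc s v) → i ∈ S' v) →
      (∀ l i s v, a ≤ s → s < v → v ≤ b → v ∈ e.exch l i → l ∈ S' s → i ∈ S' v) →
      (∀ i v, a < v → v ≤ b → v ∈ e.exch j i → i ∈ S' v) →
      (∀ i m τ, u < τ → e.Knows i a (Sum.inr (j, m, τ)) → i ∈ S' a) →
      e.informed j u b ⊆ S' b := by
    intro S' h0 h1 h2 h3 h4 i hi
    rcases mem_informed.1 hi with rfl | ⟨rfl, _⟩ | ⟨m, τ, hu, hk⟩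
    · exact h0
    · exact h0
    · exact Knows.mem_of_closed S' h1 h2 h3 h4 hk m τ rfl hu hab le_rfl
  by_cases h0 : n = 0
  · rw [h0, slotUpdate_zero]
    have hno : ∀ c x, x ∈ e.clock c → a < x → x ≤ b → False := fun c =>
      hempty c (congrFun h0 c)
    refine hfinish (fun _ => S) hj (fun i s v _ _ _ h _ => h) ?_ ?_ hstart
    · intro l i s v has hsv hvb hv
      obtain ⟨p, hp, _⟩ := hexch l i v hv
      exact (hno _ v hp (has.trans_lt hsv) hvb).elim
    · intro i v hav hvb hv
      obtain ⟨p, hp, _⟩ := hexch j i v hv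
      exact (hno _ v hp hav hvb).elim
  by_cases h1 : ∃ c, n = Pi.single c 1
  · obtain ⟨c, hc⟩ := h1
    rw [hc, slotUpdate_single]
    have hone : n c = 1 := by rw [hc]; simp
    obtain ⟨x, hx⟩ := Set.ncard_eq_one.1 hone
    have hxm : x ∈ e.clock c ∩ Set.Ioc a b := by rw [hx]; rfl
    have honly : ∀ c' y, y ∈ e.clock c' → a < y → y ≤ b → c' = c ∧ y = x := by
      intro c' y hy h2 h3
      have hcc : c' = c := by
        by_contra hne
        exact hempty c' (by rw [hc]; simp [hne]) y hy h2 h3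
      subst hcc
      have : y ∈ e.clock c' ∩ Set.Ioc a b := ⟨hy, h2, h3⟩
      rw [hx] at this
      exact ⟨rfl, this⟩
    have hax := hxm.2.1
    have hxb := hxm.2.2
    have hend : (if b < x then S else updateSet j S c) = updateSet j S c :=
      if_neg (not_lt.2 hxb)
    rw [← hend]
    refine hfinish (fun v => if v < x then S else updateSet j S c) ?_ ?_ ?_ ?_ ?_
    · rw [hend]; exact mem_updateSet hj c
    · intro i s v has hsv hvb hi hr
      by_cases hvx : v < x
      · simpa [hvx, hsv.trans_lt hvx] using hi
      · by_cases hsx : s < x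
        · simp only [hvx, hsx, if_true, if_false] at hi ⊢
          rcases c with l | p
          · have hne : i ≠ l := by
              rintro rfl
              exact hr x hxm.1 ⟨hsx, not_lt.1 hvx⟩
            simp [updateSet, hne, hi]
          · simp only [updateSet]; split_ifs <;> simp [hi]
        · simpa [hvx, hsx] using hi
    · intro l i s v has hsv hvb hv hl
      obtain ⟨p, hp, hli⟩ := hexch l i v hv
      obtain ⟨rfl, rfl⟩ := honly _ v hp (has.trans_lt hsv) hvb
      simp only [hsv, if_true, lt_irrefl, if_false, updateSet] at hl ⊢
      rcases hli with ⟨rfl, rfl⟩ | ⟨rfl, rfl⟩ <;> simp [hl]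
    · intro i v hav hvb hv
      obtain ⟨p, hp, hli⟩ := hexch j i v hv
      obtain ⟨rfl, rfl⟩ := honly _ v hp hav hvb
      simp only [lt_irrefl, if_false, updateSet]
      rcases hli with ⟨rfl, rfl⟩ | ⟨rfl, rfl⟩ <;> simp [hj]
    · intro i m τ hu hk
      simpa [hax] using hstart i m τ hu hk
  · rw [slotUpdate_of_ne j S h0 (by push Not at h1; exact h1)]
    exact Finset.subset_univ _

/-- What agent `l` knows at time `s` is carried to agent `i` at time `t` by a chain of `h`
exchanges. -/
def Carry (e : EventSeq N) (i : Fin N) (t : ℝ) : ℕ → Fin N → ℝ → Prop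
  | 0, l, s => l = i ∧ s ≤ t ∧ ∀ r ∈ e.repl l, r ∉ Set.Ioc s t
  | h + 1, l, s => ∃ m, ∃ τ ∈ e.exch l m, s < τ ∧ (∀ r ∈ e.repl l, r ∉ Set.Ioo s τ) ∧
      e.Carry i t h m τ

lemma Carry.keep {e : EventSeq N} {i : Fin N} {s t : ℝ} (hst : s ≤ t)
    (hr : ∀ r ∈ e.repl i, r ∉ Set.Ioc s t) :
    ∀ {h : ℕ} {l : Fin N} {s₀ : ℝ}, e.Carry i s h l s₀ → e.Carry i t h l s₀
  | 0, l, s₀, ⟨hl, h1, h2⟩ => by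
    refine ⟨hl, h1.trans hst, fun r hre hrt => ?_⟩
    rcases le_or_gt r s with h | h
    · exact h2 r hre ⟨hrt.1, h⟩
    · exact hr r (hl ▸ hre) ⟨h, hrt.2⟩
  | h + 1, l, s₀, ⟨m, τ, h1, h2, h3, h4⟩ => ⟨m, τ, h1, h2, h3, Carry.keep hst hr h4⟩

lemma Carry.receive {e : EventSeq N} {j i : Fin N} {s t : ℝ} (ht : t ∈ e.exch j i) (hst : s < t)
    (hr : ∀ r ∈ e.repl j, r ∉ Set.Ioo s t) :
    ∀ {h : ℕ} {l : Fin N} {s₀ : ℝ}, e.Carry j s h l s₀ → e.Carry i t (h + 1) l s₀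
  | 0, l, s₀, ⟨hl, h1, h2⟩ => by
    subst hl
    refine ⟨i, t, ht, h1.trans_lt hst, fun r hre hrt => ?_, rfl, le_rfl, fun r _ hrt =>
      absurd hrt.1 (not_lt.2 hrt.2)⟩
    rcases le_or_gt r s with h | h
    · exact h2 r hre ⟨hrt.1, h⟩
    · exact hr r hre ⟨h, hrt.2⟩
  | h + 1, l, s₀, ⟨m, τ, h1, h2, h3, h4⟩ => ⟨m, τ, h1, h2, h3, Carry.receive ht hst hr h4⟩

lemma Knows.of_carry {e : EventSeq N} {i : Fin N} {t : ℝ} {q : Info N} :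
    ∀ {h : ℕ} {l : Fin N} {s : ℝ}, e.Knows l s q → e.Carry i t h l s → e.Knows i t q
  | 0, l, s, hk, ⟨hl, h1, h2⟩ => by subst hl; exact Knows.keep l s t q hk h1 h2
  | _ + 1, l, s, hk, ⟨m, τ, h1, h2, h3, h4⟩ =>
    Knows.of_carry (Knows.receive l m s τ q h1 hk h2 h3) h4

/-- The piece of information `q` comes into the knowledge set of agent `l` at time `s` by an
arrival or as the record of an exchange. -/
def Created (e : EventSeq N) (l : Fin N) (s : ℝ) (q : Info N) : Prop :=
  ((s = 0 ∨ s ∈ e.repl l) ∧ q = Sum.inl (e.value l s, l, s)) ∨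
  ∃ j, s ∈ e.exch j l ∧ (q = Sum.inl (e.value j s, j, s) ∨ q = Sum.inr (j, l, s))

lemma knows_iff {e : EventSeq N} {i : Fin N} {t : ℝ} {q : Info N} :
    e.Knows i t q ↔ ∃ l s, e.Created l s q ∧ ∃ h, e.Carry i t h l s := by
  constructor
  · intro hq
    have hrefl : ∀ i t, e.Carry i t 0 i t := fun i t =>
      ⟨rfl, le_rfl, fun r _ hrt => absurd hrt.1 (not_lt.2 hrt.2)⟩
    induction hq with
    | arrival i t h => exact ⟨i, t, Or.inl ⟨h, rfl⟩, 0, hrefl i t⟩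
    | keep i s t q _ hst hr ih =>
      obtain ⟨l, s₀, h1, h, h2⟩ := ih
      exact ⟨l, s₀, h1, h, h2.keep hst hr⟩
    | receive j i s t q ht _ hst hr ih =>
      obtain ⟨l, s₀, h1, h, h2⟩ := ih
      exact ⟨l, s₀, h1, h + 1, h2.receive ht hst hr⟩
    | learn j i t ht => exact ⟨i, t, Or.inr ⟨j, ht, Or.inl rfl⟩, 0, hrefl i t⟩
    | record j i t ht => exact ⟨i, t, Or.inr ⟨j, ht, Or.inr rfl⟩, 0, hrefl i t⟩
  · rintro ⟨l, s, hc, h, hC⟩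
    refine Knows.of_carry ?_ hC
    rcases hc with ⟨h1, rfl⟩ | ⟨j, h1, rfl | rfl⟩
    · exact Knows.arrival l s h1
    · exact Knows.learn j l s h1
    · exact Knows.record j l s h1

lemma reach_iff_carry {e : EventSeq N} {j i : Fin N} {u t : ℝ} :
    e.Reach j u i t ↔ (i = j ∧ u < t) ∨ ∃ l, ∃ τ ∈ e.exch j l, u < τ ∧ ∃ h, e.Carry i t h l τ := by
  refine or_congr Iff.rfl ⟨?_, ?_⟩
  · rintro ⟨m, τ, hu, hk⟩
    obtain ⟨l, s, hc, hC⟩ := knows_iff.1 hk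
    rcases hc with ⟨_, h2⟩ | ⟨j', h1, h2 | h2⟩
    · simp at h2
    · simp at h2
    · simp only [Sum.inr.injEq, Prod.mk.injEq] at h2
      obtain ⟨rfl, rfl, rfl⟩ := h2
      exact ⟨m, τ, h1, hu, hC⟩
  · rintro ⟨l, τ, h1, hu, hC⟩
    exact ⟨l, τ, hu, knows_iff.2 ⟨l, τ, Or.inr ⟨j, h1, Or.inr rfl⟩, hC⟩⟩

end EventSeq

/-- A random locally finite set of positive times with measurable counts. -/
structure IsMeasurableClock {Ω : Type*} [MeasurableSpace Ω] (T : Ω → Set ℝ) : Prop where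
  pos : ∀ ω, T ω ⊆ Set.Ioi 0
  finite : ∀ ω b, (T ω ∩ Set.Iic b).Finite
  measurable_count : ∀ a b, Measurable (fun ω => tickCount (T ω) a b)

lemma finite_inter_Ioc {T : Set ℝ} (hfin : ∀ b, (T ∩ Set.Iic b).Finite) (a b : ℝ) :
    (T ∩ Set.Ioc a b).Finite :=
  (hfin b).subset fun _ hx => ⟨hx.1, hx.2.2⟩

lemma tickCount_mono {T : Set ℝ} (hfin : ∀ b, (T ∩ Set.Iic b).Finite) {x y : ℝ} (h : x ≤ y)
    (a : ℝ) : tickCount T a x ≤ tickCount T a y :=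
  Set.ncard_le_ncard (fun _ hz => ⟨hz.1, hz.2.1, hz.2.2.trans h⟩) (finite_inter_Ioc hfin a y)

lemma tickCount_add {T : Set ℝ} (hfin : ∀ b, (T ∩ Set.Iic b).Finite) {a b c : ℝ} (hab : a ≤ b)
    (hbc : b ≤ c) : tickCount T a b + tickCount T b c = tickCount T a c := by
  unfold tickCount
  rw [← Set.ncard_union_eq _ (finite_inter_Ioc hfin a b) (finite_inter_Ioc hfin b c),
    ← Set.inter_union_distrib_left, Set.Ioc_union_Ioc_eq_Ioc hab hbc]
  rw [Set.disjoint_left]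
  exact fun x hx hx' => not_lt.2 hx.2.2 hx'.2.1

lemma exists_le_lt_tickCount {T : Set ℝ} (hfin : ∀ b, (T ∩ Set.Iic b).Finite) {n : ℕ} {y : ℝ}
    (h : n < tickCount T 0 y) : ∃ z ∈ T, 0 < z ∧ z ≤ y ∧ n < tickCount T 0 z := by
  have hne : (T ∩ Set.Ioc 0 y).Nonempty := by
    by_contra hne
    rw [Set.not_nonempty_iff_eq_empty] at hne
    simp [tickCount, hne] at h
  obtain ⟨z, hz, hmax⟩ := (finite_inter_Ioc hfin 0 y).exists_maximal hne
  refine ⟨z, hz.1, hz.2.1, hz.2.2, h.trans_le ?_⟩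
  refine Set.ncard_le_ncard (fun x hx => ⟨hx.1, hx.2.1, ?_⟩) (finite_inter_Ioc hfin 0 z)
  rcases le_total x z with h1 | h1
  · exact h1
  · exact hmax hx h1

/-- The `n`-th point of a locally finite set of times. -/
lemma exists_tick {T : Set ℝ} (hfin : ∀ b, (T ∩ Set.Iic b).Finite) {n : ℕ} {b : ℝ}
    (h : n < tickCount T 0 b) : ∃ x ∈ T, ∀ y, n < tickCount T 0 y ↔ x ≤ y := by
  obtain ⟨z, hz, hz0, hzb, hzn⟩ := exists_le_lt_tickCount hfin h
  obtain ⟨x, hx, hmin⟩ := ((finite_inter_Ioc hfin 0 b).subset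
    (fun y (hy : y ∈ {y ∈ T ∩ Set.Ioc 0 b | n < tickCount T 0 y}) => hy.1)).exists_minimal
    ⟨z, ⟨hz, hz0, hzb⟩, hzn⟩
  refine ⟨x, hx.1.1, fun y => ⟨fun hy => ?_, fun hy => hx.2.trans_le (tickCount_mono hfin hy 0)⟩⟩
  obtain ⟨w, hw, hw0, hwy, hwn⟩ := exists_le_lt_tickCount hfin hy
  rcases le_or_gt w b with hwb | hwb
  · rcases le_total x w with h1 | h1
    · exact h1.trans hwy
    · exact (hmin ⟨⟨hw, hw0, hwb⟩, hwn⟩ h1).trans hwy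
  · exact hx.1.2.2.trans (hwb.le.trans hwy)

lemma tickCount_lt_of_mem {T : Set ℝ} (hfin : ∀ b, (T ∩ Set.Iic b).Finite) {x y : ℝ} (hx : x ∈ T)
    (h0 : 0 < x) (h : y < x) : tickCount T 0 y < tickCount T 0 x := by
  refine Set.ncard_lt_ncard ?_ (finite_inter_Ioc hfin 0 x)
  have hsub : T ∩ Set.Ioc 0 y ⊆ T ∩ Set.Ioc 0 x := fun z hz => ⟨hz.1, hz.2.1, hz.2.2.trans h.le⟩
  rw [Set.ssubset_iff_of_subset hsub]
  exact ⟨x, ⟨hx, h0, le_rfl⟩, fun hx' => not_lt.2 hx'.2.2 h⟩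

namespace IsMeasurableClock

variable {Ω : Type*} [MeasurableSpace Ω] {T : Ω → Set ℝ}

lemma exists_enumeration (hT : IsMeasurableClock T) :
    ∃ (τ : ℕ → Ω → ℝ) (V : ℕ → Set Ω), (∀ n, Measurable (τ n)) ∧ (∀ n, MeasurableSet (V n)) ∧
      (∀ ω x, x ∈ T ω ↔ ∃ n, ω ∈ V n ∧ τ n ω = x) ∧
      ∀ ω n x, n < tickCount (T ω) 0 x ↔ ω ∈ V n ∧ τ n ω ≤ x := by
  classical
  set V : ℕ → Set Ω := fun n => {ω | ∃ b : ℕ, n < tickCount (T ω) 0 b} with hV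
  have hVm : ∀ n, MeasurableSet (V n) := by
    intro n
    have : V n = ⋃ b : ℕ, (fun ω => tickCount (T ω) 0 b) ⁻¹' Set.Ioi n := by
      ext ω; simp [hV]
    rw [this]
    exact MeasurableSet.iUnion fun b => hT.measurable_count 0 b measurableSet_Ioi
  have hex : ∀ n ω, ω ∈ V n → ∃ x ∈ T ω, ∀ y, n < tickCount (T ω) 0 y ↔ x ≤ y := by
    rintro n ω ⟨b, hb⟩
    exact exists_tick (hT.finite ω) hb
  set τ : ℕ → Ω → ℝ := fun n ω => if h : ω ∈ V n then (hex n ω h).choose else 0 with hτ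
  have hτm : ∀ n ω, ω ∈ V n → τ n ω ∈ T ω := by
    intro n ω h
    simp only [hτ, h, dif_pos]
    exact (hex n ω h).choose_spec.1
  have hiff : ∀ ω n x, n < tickCount (T ω) 0 x ↔ ω ∈ V n ∧ τ n ω ≤ x := by
    intro ω n x
    by_cases h : ω ∈ V n
    · have := (hex n ω h).choose_spec.2 x
      simp only [hτ, h, dif_pos, true_and]
      exact this
    · simp only [h, false_and, iff_false]
      intro hx
      obtain ⟨b, hb⟩ := exists_nat_ge x
      exact h ⟨b, hx.trans_le (tickCount_mono (hT.finite ω) hb 0)⟩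
  refine ⟨τ, V, fun n => ?_, hVm, fun ω x => ⟨fun hx => ?_, ?_⟩, hiff⟩
  · refine measurable_of_Iic fun x => ?_
    have : τ n ⁻¹' Set.Iic x = ((fun ω => tickCount (T ω) 0 x) ⁻¹' Set.Ioi n)
        ∪ ((V n)ᶜ ∩ {_ω | (0 : ℝ) ≤ x}) := by
      ext ω
      simp only [Set.mem_preimage, Set.mem_Iic, Set.mem_union, Set.mem_Ioi, hiff, Set.mem_inter_iff,
        Set.mem_compl_iff, Set.mem_ofPred_eq]
      by_cases h : ω ∈ V n
      · simp [h]
      · simp [h, hτ]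
    rw [this]
    exact (hT.measurable_count 0 x measurableSet_Ioi).union
      ((hVm n).compl.inter (MeasurableSet.const _))
  · have h0 : 0 < x := hT.pos ω hx
    have hpos : 0 < tickCount (T ω) 0 x := by
      have := tickCount_lt_of_mem (hT.finite ω) hx h0 h0
      omega
    have h1 : tickCount (T ω) 0 x - 1 < tickCount (T ω) 0 x := by omega
    obtain ⟨h2, h3⟩ := (hiff ω _ x).1 h1
    refine ⟨_, h2, le_antisymm h3 ?_⟩
    by_contra hlt
    have h4 := tickCount_lt_of_mem (hT.finite ω) hx h0 (not_le.1 hlt)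
    have h5 := (hiff ω _ _).2 ⟨h2, le_rfl⟩
    omega
  · rintro ⟨n, h1, rfl⟩
    exact hτm n ω h1

lemma measurableSet_exists (hT : IsMeasurableClock T) {C : Set (Ω × ℝ)} (hC : MeasurableSet C) :
    MeasurableSet {ω | ∃ x ∈ T ω, (ω, x) ∈ C} := by
  obtain ⟨τ, V, h1, h2, h3, -⟩ := hT.exists_enumeration
  have : {ω | ∃ x ∈ T ω, (ω, x) ∈ C} = ⋃ n, V n ∩ (fun ω => (ω, τ n ω)) ⁻¹' C := by
    ext ω
    simp only [Set.mem_ofPred_eq, h3, Set.mem_iUnion, Set.mem_inter_iff, Set.mem_preimage]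
    constructor
    · rintro ⟨x, ⟨n, hn, rfl⟩, hx⟩; exact ⟨n, hn, hx⟩
    · rintro ⟨n, hn, hx⟩; exact ⟨_, ⟨n, hn, rfl⟩, hx⟩
  rw [this]
  exact MeasurableSet.iUnion fun n => (h2 n).inter ((measurable_id.prodMk (h1 n)) hC)

lemma measurable_tickCount_prod (hT : IsMeasurableClock T) :
    Measurable fun p : Ω × ℝ => tickCount (T p.1) 0 p.2 := by
  obtain ⟨τ, V, h1, h2, -, h4⟩ := hT.exists_enumeration
  refine measurable_of_Ioi fun n => ?_
  have : (fun p : Ω × ℝ => tickCount (T p.1) 0 p.2) ⁻¹' Set.Ioi n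
      = (Prod.fst ⁻¹' V n) ∩ {p | τ n p.1 ≤ p.2} := by
    ext p; simp [h4]
  rw [this]
  exact (measurable_fst (h2 n)).inter
    (measurableSet_le ((h1 n).comp measurable_fst) measurable_snd)

lemma comp {Ω' : Type*} [MeasurableSpace Ω'] (hT : IsMeasurableClock T) {f : Ω' → Ω}
    (hf : Measurable f) : IsMeasurableClock fun ω => T (f ω) where
  pos ω := hT.pos (f ω)
  finite ω := hT.finite (f ω)
  measurable_count a b := (hT.measurable_count a b).comp hf

end IsMeasurableClock

/-- The replacement and exchange times of `E` are measurable. -/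
structure MeasurableClocks {N : ℕ} {Ω : Type*} [MeasurableSpace Ω] (E : Ω → EventSeq N) :
    Prop where
  repl : ∀ i, IsMeasurableClock fun ω => (E ω).repl i
  exch : ∀ i j, IsMeasurableClock fun ω => (E ω).exch i j

namespace MeasurableClocks

variable {N : ℕ} {Ω : Type*} [MeasurableSpace Ω] {E : Ω → EventSeq N}

lemma measurableSet_carry (hE : MeasurableClocks E) (i : Fin N) (t : ℝ) (h : ℕ) (l : Fin N) :
    MeasurableSet {p : Ω × ℝ | (E p.1).Carry i t h l p.2} := by
  induction h generalizing l with
  | zero =>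
    have : {p : Ω × ℝ | (E p.1).Carry i t 0 l p.2} = {_p | l = i} ∩ {p | p.2 ≤ t} ∩
        {p : Ω × ℝ | ∃ r ∈ (E p.1).repl l, (p, r) ∈ {z : (Ω × ℝ) × ℝ | z.1.2 < z.2 ∧ z.2 ≤ t}}ᶜ := by
      ext p
      simp only [EventSeq.Carry, Set.mem_Ioc, Set.mem_ofPred_eq, Set.mem_inter_iff,
        Set.mem_compl_iff, not_exists, and_assoc]
      simp
    rw [this]
    refine ((MeasurableSet.const _).inter (measurableSet_le measurable_snd measurable_const)).inter
      (((hE.repl l).comp measurable_fst).measurableSet_exists ?_).compl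
    exact (measurableSet_lt (measurable_snd.comp measurable_fst) measurable_snd).inter
      (measurableSet_le measurable_snd measurable_const)
  | succ h ih =>
    have : {p : Ω × ℝ | (E p.1).Carry i t (h + 1) l p.2} = ⋃ m : Fin N,
        {p : Ω × ℝ | ∃ τ ∈ (E p.1).exch l m, (p, τ) ∈ {z : (Ω × ℝ) × ℝ | z.1.2 < z.2} ∩
          {z : (Ω × ℝ) × ℝ | ∃ r ∈ (E z.1.1).repl l, (z, r) ∈
            {w : ((Ω × ℝ) × ℝ) × ℝ | w.1.1.2 < w.2 ∧ w.2 < w.1.2}}ᶜ ∩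
          (fun z : (Ω × ℝ) × ℝ => (z.1.1, z.2)) ⁻¹'
            {p : Ω × ℝ | (E p.1).Carry i t h m p.2}} := by
      ext p
      simp only [EventSeq.Carry, Set.mem_Ioo, Set.mem_ofPred_eq, Set.mem_inter_iff, Set.mem_iUnion,
        Set.mem_compl_iff, not_exists, and_assoc, Set.mem_preimage, not_and]
    rw [this]
    refine MeasurableSet.iUnion fun m => ((hE.exch l m).comp measurable_fst).measurableSet_exists ?_
    refine (MeasurableSet.inter ?_ ?_).inter ?_
    · exact measurableSet_lt (measurable_snd.comp measurable_fst) measurable_snd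
    · refine (((hE.repl l).comp (measurable_fst.comp measurable_fst)).measurableSet_exists ?_).compl
      exact (measurableSet_lt (measurable_snd.comp (measurable_fst.comp measurable_fst))
        measurable_snd).inter (measurableSet_lt measurable_snd (measurable_snd.comp measurable_fst))
    · exact (by fun_prop : Measurable fun z : (Ω × ℝ) × ℝ => (z.1.1, z.2)) (ih m)

lemma measurableSet_exists_carry (hE : MeasurableClocks E) (i : Fin N) (t : ℝ) (l : Fin N) :
    MeasurableSet {p : Ω × ℝ | ∃ h, (E p.1).Carry i t h l p.2} := by
  have : {p : Ω × ℝ | ∃ h, (E p.1).Carry i t h l p.2}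
      = ⋃ h, {p : Ω × ℝ | (E p.1).Carry i t h l p.2} := by
    ext p; simp
  rw [this]
  exact MeasurableSet.iUnion fun h => hE.measurableSet_carry i t h l

lemma measurableSet_reach (hE : MeasurableClocks E) (j : Fin N) (u : ℝ) (i : Fin N) (t : ℝ) :
    MeasurableSet {ω | (E ω).Reach j u i t} := by
  have : {ω | (E ω).Reach j u i t} = {_ω | i = j ∧ u < t} ∪ ⋃ l : Fin N,
      {ω | ∃ τ ∈ (E ω).exch j l, (ω, τ) ∈ {p : Ω × ℝ | u < p.2} ∩
        {p : Ω × ℝ | ∃ h, (E p.1).Carry i t h l p.2}} := by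
    ext ω
    simp only [Set.mem_ofPred_eq, EventSeq.reach_iff_carry, Set.mem_union, Set.mem_iUnion,
      Set.mem_inter_iff]
  rw [this]
  refine (MeasurableSet.const _).union (MeasurableSet.iUnion fun l =>
    (hE.exch j l).measurableSet_exists ?_)
  exact (measurableSet_lt measurable_const measurable_snd).inter
    (hE.measurableSet_exists_carry i t l)

lemma measurable_value_prod (hE : MeasurableClocks E)
    (hval : ∀ i n, Measurable fun ω => (E ω).val i n) (i : Fin N) :
    Measurable fun p : Ω × ℝ => (E p.1).value i p.2 := by
  have h1 : Measurable fun q : Ω × ℕ => (E q.1).val i q.2 :=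
    measurable_from_prod_countable_left fun n => hval i n
  exact h1.comp (measurable_fst.prodMk (hE.repl i).measurable_tickCount_prod)

lemma measurable_knowledge (hE : MeasurableClocks E)
    (hval : ∀ i n, Measurable fun ω => (E ω).val i n) (i : Fin N) (t : ℝ) :
    Measurable[_, knowledgeSigma N] fun ω => (E ω).knowledge i t := by
  refine measurable_generateFrom ?_
  rintro _ ⟨B, hB, rfl⟩
  have hinl : ∀ l j : Fin N, MeasurableSet
      {p : Ω × ℝ | (Sum.inl ((E p.1).value j p.2, j, p.2) : Info N) ∈ B} := fun l j =>
    measurable_inl.comp ((hE.measurable_value_prod hval j).prodMk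
      (measurable_const.prodMk measurable_snd)) hB
  have hinr : ∀ l j : Fin N, MeasurableSet {p : Ω × ℝ | (Sum.inr (j, l, p.2) : Info N) ∈ B} :=
    fun l j => measurable_inr.comp (measurable_const.prodMk
      (measurable_const.prodMk measurable_snd)) hB
  have : (fun ω => (E ω).knowledge i t) ⁻¹' {S | (S ∩ B).Nonempty} =
      (⋃ l : Fin N, (fun ω => (ω, (0 : ℝ))) ⁻¹'
        ({p : Ω × ℝ | ∃ h, (E p.1).Carry i t h l p.2} ∩
          {p : Ω × ℝ | (Sum.inl ((E p.1).value l p.2, l, p.2) : Info N) ∈ B})) ∪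
      (⋃ l : Fin N, {ω | ∃ s ∈ (E ω).repl l, (ω, s) ∈
        {p : Ω × ℝ | ∃ h, (E p.1).Carry i t h l p.2} ∩
          {p : Ω × ℝ | (Sum.inl ((E p.1).value l p.2, l, p.2) : Info N) ∈ B}}) ∪
      ⋃ l : Fin N, ⋃ j : Fin N, {ω | ∃ s ∈ (E ω).exch j l, (ω, s) ∈
        {p : Ω × ℝ | ∃ h, (E p.1).Carry i t h l p.2} ∩
          ({p : Ω × ℝ | (Sum.inl ((E p.1).value j p.2, j, p.2) : Info N) ∈ B} ∪
            {p : Ω × ℝ | (Sum.inr (j, l, p.2) : Info N) ∈ B})} := by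
    ext ω
    simp only [Set.mem_preimage, Set.mem_ofPred_eq, Set.mem_union, Set.mem_iUnion, Set.mem_inter_iff,
      Set.Nonempty, EventSeq.knowledge, EventSeq.knows_iff, EventSeq.Created]
    constructor
    · rintro ⟨q, ⟨l, s, hc, hC⟩, hq⟩
      rcases hc with ⟨rfl | hs, rfl⟩ | ⟨j, hs, rfl | rfl⟩
      · exact Or.inl (Or.inl ⟨l, hC, hq⟩)
      · exact Or.inl (Or.inr ⟨l, s, hs, hC, hq⟩)
      · exact Or.inr ⟨l, j, s, hs, hC, Or.inl hq⟩
      · exact Or.inr ⟨l, j, s, hs, hC, Or.inr hq⟩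
    · rintro ((⟨l, hC, hq⟩ | ⟨l, s, hs, hC, hq⟩) | ⟨l, j, s, hs, hC, hq | hq⟩)
      · exact ⟨_, ⟨l, 0, Or.inl ⟨Or.inl rfl, rfl⟩, hC⟩, hq⟩
      · exact ⟨_, ⟨l, s, Or.inl ⟨Or.inr hs, rfl⟩, hC⟩, hq⟩
      · exact ⟨_, ⟨l, s, Or.inr ⟨j, hs, Or.inl rfl⟩, hC⟩, hq⟩
      · exact ⟨_, ⟨l, s, Or.inr ⟨j, hs, Or.inr rfl⟩, hC⟩, hq⟩
  rw [this]
  refine ((MeasurableSet.iUnion fun l => ?_).union (MeasurableSet.iUnion fun l => ?_)).union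
    (MeasurableSet.iUnion fun l => MeasurableSet.iUnion fun j => ?_)
  · exact (measurable_id.prodMk measurable_const)
      ((hE.measurableSet_exists_carry i t l).inter (hinl l l))
  · exact (hE.repl l).measurableSet_exists ((hE.measurableSet_exists_carry i t l).inter (hinl l l))
  · exact (hE.exch j l).measurableSet_exists
      ((hE.measurableSet_exists_carry i t l).inter ((hinl l j).union (hinr l j)))

end MeasurableClocks

section Independence

variable {Ω : Type*} {m : MeasurableSpace Ω} [mΩ : MeasurableSpace Ω] {μ : Measure Ω}
  [IsProbabilityMeasure μ]

lemma indep_sup_of_indep_indep {A A₁ A₂ B : MeasurableSpace Ω} (hA : A ≤ mΩ) (hB : B ≤ mΩ)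
    (h₁ : A₁ ≤ A) (h₂ : A₂ ≤ A) (hAB : Indep A B μ) (h : Indep A₁ A₂ μ) :
    Indep (A₁ ⊔ B) A₂ μ := by
  set p : Set (Set Ω) := {s | ∃ a b, MeasurableSet[A₁] a ∧ MeasurableSet[B] b ∧ s = a ∩ b} with hp
  have hgen : A₁ ⊔ B = MeasurableSpace.generateFrom p := by
    apply le_antisymm
    · refine sup_le (fun s hs => ?_) (fun s hs => ?_)
      · exact MeasurableSpace.measurableSet_generateFrom
          ⟨s, Set.univ, hs, MeasurableSet.univ, (Set.inter_univ s).symm⟩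
      · exact MeasurableSpace.measurableSet_generateFrom
          ⟨Set.univ, s, MeasurableSet.univ, hs, (Set.univ_inter s).symm⟩
    · refine MeasurableSpace.generateFrom_le ?_
      rintro _ ⟨a, b, ha, hb, rfl⟩
      exact MeasurableSet.inter ((le_sup_left : A₁ ≤ A₁ ⊔ B) _ ha)
        ((le_sup_right : B ≤ A₁ ⊔ B) _ hb)
  refine IndepSets.indep (p1 := p) (p2 := {s | MeasurableSet[A₂] s})
    (sup_le (h₁.trans hA) hB) (h₂.trans hA) ?_
    (@MeasurableSpace.isPiSystem_measurableSet Ω A₂) hgen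
    (@MeasurableSpace.generateFrom_measurableSet Ω A₂).symm ?_
  · rintro _ ⟨a, b, ha, hb, rfl⟩ _ ⟨a', b', ha', hb', rfl⟩ _
    exact ⟨a ∩ a', b ∩ b', MeasurableSet.inter ha ha', MeasurableSet.inter hb hb',
      Set.inter_inter_inter_comm _ _ _ _⟩
  · rw [IndepSets_iff]
    rintro _ c ⟨a, b, ha, hb, rfl⟩ hc
    rw [Indep_iff] at hAB h
    have e : a ∩ b ∩ c = a ∩ c ∩ b := by
      rw [Set.inter_assoc, Set.inter_comm b c, Set.inter_assoc]
    rw [e, hAB _ _ (MeasurableSet.inter (h₁ _ ha) (h₂ _ hc)) hb, h _ _ ha hc,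
      hAB _ _ (h₁ _ ha) hb]
    ring

/-- A family of identically distributed random variables that are independent of `m`, taken at a
random `m`-measurable index. -/
lemma indep_random_index {α β : Type*} [Countable α] [mα : MeasurableSpace α]
    [MeasurableSingletonClass α] [mβ : MeasurableSpace β] (hm : m ≤ mΩ)
    {V : α → Ω → β} (hV : ∀ a, Measurable (V a)) {ν : Measure β} (hlaw : ∀ a, μ.map (V a) = ν)
    (hind : ∀ a, Indep (mβ.comap (V a)) m μ) {c : Ω → α} (hc : Measurable[m] c) :
    Measurable (fun ω => V (c ω) ω) ∧ μ.map (fun ω => V (c ω) ω) = ν ∧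
      Indep (mβ.comap fun ω => V (c ω) ω) m μ := by
  have hmeas : Measurable (fun ω => V (c ω) ω) := by
    have h1 : Measurable fun q : Ω × α => V q.2 q.1 := measurable_from_prod_countable_left hV
    exact h1.comp (measurable_id.prodMk (hc.mono hm le_rfl))
  have key : ∀ B, MeasurableSet B → ∀ C, MeasurableSet[m] C →
      μ ((fun ω => V (c ω) ω) ⁻¹' B ∩ C) = ν B * μ C := by
    intro B hB C hC
    have hca : ∀ a, MeasurableSet[m] (C ∩ c ⁻¹' {a}) := fun a =>
      MeasurableSet.inter hC (hc (measurableSet_singleton a))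
    have h1 : (fun ω => V (c ω) ω) ⁻¹' B ∩ C = ⋃ a, V a ⁻¹' B ∩ (C ∩ c ⁻¹' {a}) := by
      ext ω
      simp only [Set.mem_inter_iff, Set.mem_preimage, Set.mem_iUnion, Set.mem_singleton_iff]
      constructor
      · rintro ⟨h1, h2⟩; exact ⟨c ω, h1, h2, rfl⟩
      · rintro ⟨a, h1, h2, rfl⟩; exact ⟨h1, h2⟩
    have h2 : C = ⋃ a, (C ∩ c ⁻¹' {a}) := by
      ext ω; simp
    have hd : Pairwise (Function.onFun Disjoint fun a => C ∩ c ⁻¹' {a}) := by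
      intro a b hab
      rw [Function.onFun, Set.disjoint_left]
      rintro ω ⟨_, h1⟩ ⟨_, h2⟩
      exact hab (h1.symm.trans h2)
    conv_rhs => rw [h2]
    rw [h1, measure_iUnion (fun a b hab => (hd hab).mono Set.inter_subset_right
      Set.inter_subset_right) fun a => ((hV a) hB).inter (hm _ (hca a)),
      measure_iUnion hd fun a => hm _ (hca a), ← ENNReal.tsum_mul_left]
    refine tsum_congr fun a => ?_
    rw [(Indep_iff _ _ μ).1 (hind a) _ _ ⟨B, hB, rfl⟩ (hca a), ← hlaw a,
      Measure.map_apply (hV a) hB]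
  refine ⟨hmeas, ?_, ?_⟩
  · ext B hB
    rw [Measure.map_apply hmeas hB]
    have := key B hB Set.univ MeasurableSet.univ
    simpa using this
  · rw [Indep_iff]
    rintro _ C ⟨B, hB, rfl⟩ hC
    have := key B hB Set.univ MeasurableSet.univ
    rw [Set.inter_univ, measure_univ, mul_one] at this
    rw [key B hB C hC, this]

end Independence

lemma measurable_tickCount_clockSigma {Ω : Type*} (T : Ω → Set ℝ) (a b : ℝ) :
    Measurable[clockSigma T] fun ω => tickCount (T ω) a b :=
  Measurable.mono (comap_measurable _)
    (le_iSup (fun p : ℝ × ℝ => MeasurableSpace.comap (fun ω => tickCount (T ω) p.1 p.2) ⊤) (a, b))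
    le_rfl

lemma tickCount_inter_Iic (S : Set ℝ) (u a b : ℝ) :
    tickCount (S ∩ Set.Iic u) a b = tickCount S a (min b u) := by
  unfold tickCount
  congr 1
  ext x
  simp only [Set.mem_inter_iff, Set.mem_Iic, Set.mem_Ioc, le_min_iff]
  tauto

lemma clockSigma_inter_Iic_le {Ω : Type*} (T : Ω → Set ℝ) (u : ℝ) :
    clockSigma (fun ω => T ω ∩ Set.Iic u) ≤ clockSigma T := by
  refine iSup_le fun p => Measurable.comap_le ?_
  simp_rw [tickCount_inter_Iic]
  exact measurable_tickCount_clockSigma T _ _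

section PoissonClock

variable {Ω : Type*} {m : MeasurableSpace Ω} [mΩ : MeasurableSpace Ω] {μ : Measure Ω}
  {r : ℝ}
  {T : Ω → Set ℝ}

lemma IsPoissonClock.isMeasurableClock (hT : IsPoissonClock μ r T)
    (hm : clockSigma T ≤ m) : @IsMeasurableClock Ω m T :=
  @IsMeasurableClock.mk Ω m T hT.pos hT.finite fun a b =>
    (measurable_tickCount_clockSigma T a b).mono hm le_rfl

lemma IsPoissonClock.clockSigma_le (hT : IsPoissonClock μ r T) : clockSigma T ≤ mΩ :=
  iSup_le fun p => (hT.measurable_count p.1 p.2).comap_le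

lemma tickCount_eq_sub {S : Set ℝ} (hpos : S ⊆ Set.Ioi 0) (hfin : ∀ b, (S ∩ Set.Iic b).Finite)
    (a b : ℝ) : tickCount S a b
      = tickCount S 0 (max b 0) - tickCount S 0 (min (max a 0) (max b 0)) := by
  have h1 := tickCount_add hfin (a := 0) (b := min (max a 0) (max b 0)) (c := max b 0)
    (le_min (le_max_right _ _) (le_max_right _ _)) (min_le_right _ _)
  have h2 : tickCount S a b = tickCount S (min (max a 0) (max b 0)) (max b 0) := by
    unfold tickCount
    congr 1
    ext x
    simp only [Set.mem_inter_iff, Set.mem_Ioc, min_lt_iff, max_lt_iff, le_max_iff]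
    constructor
    · rintro ⟨h3, h4, h5⟩
      exact ⟨h3, Or.inl ⟨h4, hpos h3⟩, Or.inl h5⟩
    · rintro ⟨h3, h4, h5⟩
      have h0 : 0 < x := hpos h3
      have h5' : x ≤ b := h5.resolve_right (not_le.2 h0)
      exact ⟨h3, (h4.resolve_right fun h => not_lt.2 h5' h.1).1, h5'⟩
  omega

lemma tickCount_sum {S : Set ℝ} (hfin : ∀ b, (S ∩ Set.Iic b).Finite) {t : ℕ → ℝ} (ht : Monotone t)
    (k : ℕ) : tickCount S (t 0) (t k) = ∑ i ∈ Finset.range k, tickCount S (t i) (t (i + 1)) := by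
  induction k with
  | zero => simp [tickCount]
  | succ k ih =>
    rw [Finset.sum_range_succ, ← ih, tickCount_add hfin (ht (Nat.zero_le k)) (ht (Nat.le_succ k))]

/-- An increasing enumeration of a finite set of times, followed by a later time. -/
lemma exists_monotone_enumeration (F : Finset ℝ) (b : ℝ) (hb : ∀ x ∈ F, x ≤ b) :
    ∃ t : ℕ → ℝ, Monotone t ∧ (∀ x, x ∈ F ↔ ∃ k < F.card, t k = x) ∧ ∀ k, F.card ≤ k → t k = b := by
  refine ⟨fun k => if h : k < F.card then F.orderEmbOfFin rfl ⟨k, h⟩ else b, ?_, ?_, ?_⟩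
  · intro k l hkl
    dsimp only
    by_cases hl : l < F.card
    · rw [dif_pos hl, dif_pos (hkl.trans_lt hl)]
      exact (F.orderEmbOfFin rfl).monotone hkl
    · rw [dif_neg hl]
      split_ifs with hk
      · exact hb _ (F.orderEmbOfFin_mem rfl _)
      · exact le_rfl
  · intro x
    constructor
    · intro hx
      have : x ∈ Set.range (F.orderEmbOfFin rfl) := by
        rw [Finset.range_orderEmbOfFin]; exact hx
      obtain ⟨⟨k, hk⟩, rfl⟩ := this
      exact ⟨k, hk, dif_pos hk⟩
    · rintro ⟨k, hk, rfl⟩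
      simp only [hk, dif_pos]
      exact F.orderEmbOfFin_mem rfl _
  · intro k hk
    exact dif_neg (not_lt.2 hk)

/-- The past of a Poisson clock is independent of its later increments. -/
lemma IsPoissonClock.indep_past [IsProbabilityMeasure μ] (hT : IsPoissonClock μ r T) {u b : ℝ} (hu : 0 ≤ u) (hub : u ≤ b) :
    Indep (clockSigma fun ω => T ω ∩ Set.Iic u)
      (MeasurableSpace.comap (fun ω => tickCount (T ω) u b) ⊤) μ := by
  set n : Set.Icc 0 u → MeasurableSpace Ω := fun s =>
    MeasurableSpace.comap (fun ω => tickCount (T ω) 0 s) ⊤ with hn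
  have hn_le : ∀ s, n s ≤ mΩ := fun s => (hT.measurable_count 0 s).comap_le
  have hM_le : MeasurableSpace.comap (fun ω => tickCount (T ω) u b) ⊤ ≤ mΩ :=
    (hT.measurable_count u b).comap_le
  have hle : (clockSigma fun ω => T ω ∩ Set.Iic u) ≤ ⨆ s, n s := by
    refine iSup_le fun p => Measurable.comap_le ?_
    have h1 : ∀ x, 0 ≤ x → x ≤ u → Measurable[⨆ s, n s] fun ω => tickCount (T ω) 0 x := by
      intro x h0 hx
      exact (comap_measurable _).mono (le_iSup n ⟨x, h0, hx⟩) le_rfl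
    have h2 : (fun ω => tickCount (T ω ∩ Set.Iic u) p.1 p.2) = fun ω =>
        tickCount (T ω) 0 (max (min p.2 u) 0)
          - tickCount (T ω) 0 (min (max p.1 0) (max (min p.2 u) 0)) := by
      funext ω
      rw [tickCount_inter_Iic, tickCount_eq_sub (hT.pos ω) (hT.finite ω)]
    rw [h2]
    have h3 : max (min p.2 u) 0 ≤ u := max_le (min_le_right _ _) hu
    exact (h1 _ (le_max_right _ _) h3).sub
      (h1 _ (le_min (le_max_right _ _) (le_max_right _ _)) ((min_le_right _ _).trans h3))
  refine indep_of_indep_of_le_left ?_ hle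
  rw [iSup_eq_iSup_finset]
  refine indep_iSup_of_directed_le (fun F => ?_) (fun F => iSup₂_le fun s _ => hn_le s) hM_le
    (directed_of_isDirected_le fun F F' h => biSup_mono fun s hs => Finset.mem_of_subset h hs)
  classical
  set G : Finset ℝ := insert 0 (insert u (F.image Subtype.val)) with hG
  have hGu : ∀ x ∈ G, 0 ≤ x ∧ x ≤ u := by
    intro x hx
    simp only [hG, Finset.mem_insert, Finset.mem_image] at hx
    rcases hx with rfl | rfl | ⟨s, _, rfl⟩
    · exact ⟨le_rfl, hu⟩
    · exact ⟨hu, le_rfl⟩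
    · exact s.2
  obtain ⟨t, htm, htG, htb⟩ := exists_monotone_enumeration G b fun x hx => (hGu x hx).2.trans hub
  have hcard : 0 < G.card := Finset.card_pos.2 ⟨0, by simp [hG]⟩
  have ht0 : t 0 = 0 := by
    obtain ⟨k, _, hk⟩ := (htG 0).1 (by simp [hG])
    have h1 := htm (Nat.zero_le k)
    have h2 := hGu (t 0) ((htG _).2 ⟨0, hcard, rfl⟩)
    exact le_antisymm (h1.trans hk.le) h2.1
  have htl : t (G.card - 1) = u := by
    obtain ⟨k, hk', hk⟩ := (htG u).1 (by simp [hG])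
    have h1 := htm (by omega : k ≤ G.card - 1)
    have h2 := hGu (t (G.card - 1)) ((htG _).2 ⟨_, by omega, rfl⟩)
    exact le_antisymm h2.2 (hk.ge.trans h1)
  have hind := hT.indep_increments t ht0.ge htm
  set X : ℕ → Ω → ℕ := fun k ω => tickCount (T ω) (t k) (t (k + 1)) with hX
  have hXM : X (G.card - 1) = fun ω => tickCount (T ω) u b := by
    funext ω
    simp only [hX]
    rw [htl, htb _ (by omega)]
  have hXi : iIndep (fun k => MeasurableSpace.comap (X k) ⊤) μ := (iIndepFun_iff_iIndep _ _ μ).1 hind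
  have hd := indep_iSup_of_disjoint (S := Set.Iio (G.card - 1)) (T := {G.card - 1})
    (fun k => (hT.measurable_count _ _).comap_le) hXi (by simp)
  rw [iSup_singleton] at hd
  change Indep (⨆ i ∈ Set.Iio (G.card - 1), MeasurableSpace.comap (X i) ⊤)
    (MeasurableSpace.comap (X (G.card - 1)) ⊤) μ at hd
  rw [hXM] at hd
  refine indep_of_indep_of_le_left hd (iSup₂_le fun s hs => Measurable.comap_le ?_)
  obtain ⟨k, hk, hks⟩ := (htG s).1 (by
    simp only [hG, Finset.mem_insert, Finset.mem_image]
    exact Or.inr (Or.inr ⟨s, hs, rfl⟩))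
  have hsum : (fun ω => tickCount (T ω) 0 s) = fun ω => ∑ i ∈ Finset.range k, X i ω := by
    funext ω
    rw [← hks, ← ht0, tickCount_sum (hT.finite ω) htm]
  rw [hsum]
  refine Finset.measurable_fun_sum _ fun i hi => ?_
  have hi' : i ∈ Set.Iio (G.card - 1) := by
    have := Finset.mem_range.1 hi
    simp only [Set.mem_Iio]; omega
  exact (comap_measurable (X i)).mono
    (le_iSup₂ (f := fun i (_ : i ∈ Set.Iio (G.card - 1)) => MeasurableSpace.comap (X i) ⊤) i hi')
    le_rfl

lemma IsPoissonClock.measureReal_tickCount_eq (hT : IsPoissonClock μ r T) (hr : 0 ≤ r) {a b : ℝ}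
    (ha : 0 ≤ a) (hab : a ≤ b) (n : ℕ) :
    μ.real {ω | tickCount (T ω) a b = n}
      = Real.exp (-(r * (b - a))) * (r * (b - a)) ^ n / n.factorial := by
  have h1 : μ.real {ω | tickCount (T ω) a b = n}
      = (μ.map fun ω => tickCount (T ω) a b).real {n} := by
    rw [map_measureReal_apply (hT.measurable_count a b) (measurableSet_singleton n)]
    rfl
  rw [h1, hT.law_count a b ha hab, poissonMeasure_real_singleton,
    Real.coe_toNNReal _ (mul_nonneg hr (by linarith))]

end PoissonClock

instance instMeasurableSpaceFinsetFin (N : ℕ) : MeasurableSpace (Finset (Fin N)) := ⊤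

instance instDiscreteFinsetFin (N : ℕ) : DiscreteMeasurableSpace (Finset (Fin N)) :=
  ⟨fun _ => MeasurableSpace.measurableSet_top⟩

/-- The upper bound of the set of informed agents computed from the numbers of events in the
successive time intervals. -/
def slotChain {N : ℕ} (j : Fin N) (n : ℕ → Source N → ℕ) : ℕ → Finset (Fin N)
  | 0 => {j}
  | m + 1 => slotUpdate j (slotChain j n m) (n m)

lemma mem_slotChain {N : ℕ} (j : Fin N) (n : ℕ → Source N → ℕ) (m : ℕ) :
    j ∈ slotChain j n m := by
  cases m with
  | zero => exact Finset.mem_singleton_self j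
  | succ m => exact mem_slotUpdate (mem_slotChain j n m) _

lemma EventSeq.informed_subset_slotChain {N : ℕ} {e : EventSeq N}
    (hsymm : ∀ i j, e.exch i j = e.exch j i) (hself : ∀ i, e.exch i i = ∅)
    (hfin : ∀ c b, (e.clock c ∩ Set.Iic b).Finite) (j : Fin N) {t : ℕ → ℝ} (ht : Monotone t)
    (m : ℕ) : e.informed j (t 0) (t m)
      ⊆ slotChain j (fun m c => tickCount (e.clock c) (t m) (t (m + 1))) m := by
  induction m with
  | zero =>
    intro i hi
    rcases EventSeq.mem_informed.1 hi with rfl | h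
    · exact Finset.mem_singleton_self i
    · exact absurd h.lt (lt_irrefl _)
  | succ m ih =>
    exact EventSeq.informed_subset_slotUpdate hsymm hself (ht (Nat.le_succ m))
      (fun c => finite_inter_Ioc (hfin c) _ _) (mem_slotChain j _ m) ih

lemma integrable_finset_comp {N : ℕ} {Ω : Type*} [MeasurableSpace Ω] {μ : Measure Ω}
    [IsProbabilityMeasure μ] {U : Ω → Finset (Fin N)} (hU : Measurable U)
    (F : Finset (Fin N) → ℝ) : Integrable (fun ω => F (U ω)) μ := by
  refine Integrable.of_bound ((Measurable.of_discrete (f := F)).comp hU).aestronglyMeasurable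
    (∑ S, |F S|) (Filter.Eventually.of_forall fun ω => ?_)
  exact Finset.single_le_sum (f := fun S => |F S|) (fun _ _ => abs_nonneg _) (Finset.mem_univ (U ω))

lemma measurable_finset_comp₂ {N : ℕ} {Ω α : Type*} [MeasurableSpace Ω] [MeasurableSpace α]
    [DiscreteMeasurableSpace α] (f : Finset (Fin N) → α → Finset (Fin N))
    {U : Ω → Finset (Fin N)} {X : Ω → α} (hU : Measurable U) (hX : Measurable X) :
    Measurable fun ω => f (U ω) (X ω) := by
  have h3 : Measurable fun q : Finset (Fin N) × α => f q.1 q.2 :=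
    measurable_from_prod_countable_right fun S => Measurable.of_discrete
  exact h3.comp (hU.prodMk hX)

/-- One step of the slot process. -/
lemma integral_slotUpdate {N : ℕ} {lamR lamC : ℝ} {Ω : Type*} [MeasurableSpace Ω] {μ : Measure Ω}
    [IsProbabilityMeasure μ] (j : Fin N) {δ : ℝ} {U : Ω → Finset (Fin N)}
    {X : Ω → Source N → ℕ} (hU : Measurable U) (hX : Measurable X) (hUX : IndepFun X U μ)
    (h0 : μ.real {ω | X ω = 0} = Real.exp (-(totalRate N lamR lamC * δ)))
    (h1 : ∀ c, μ.real {ω | X ω = Pi.single c 1}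
      = sourceRate N lamR lamC c * δ * Real.exp (-(totalRate N lamR lamC * δ)))
    (F : Finset (Fin N) → ℝ) :
    ∫ ω, F (slotUpdate j (U ω) (X ω)) ∂μ = ∫ ω, stepOp N lamR lamC j δ F (U ω) ∂μ := by
  classical
  have hind : ∀ v : Source N → ℕ, Measurable fun x : Source N → ℕ => if x = v then (1 : ℝ) else 0 :=
    fun v => Measurable.of_discrete
  have hprod : ∀ (v : Source N → ℕ) (G : Finset (Fin N) → ℝ),
      ∫ ω, (if X ω = v then (1 : ℝ) else 0) * G (U ω) ∂μ
        = μ.real {ω | X ω = v} * ∫ ω, G (U ω) ∂μ := by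
    intro v G
    have h := (hUX.comp (hind v) (Measurable.of_discrete (f := G))).integral_fun_mul_eq_mul_integral
      ((hind v).comp hX).aestronglyMeasurable
      ((Measurable.of_discrete (f := G)).comp hU).aestronglyMeasurable
    simp only [Function.comp_def] at h
    rw [h]
    congr 1
    have hs : MeasurableSet {ω | X ω = v} := hX (measurableSet_singleton v)
    rw [← integral_indicator_one hs]
    refine integral_congr_ae (Filter.Eventually.of_forall fun ω => ?_)
    by_cases hω : X ω = v <;> simp [hω, Set.indicator]
  have hint : ∀ (v : Source N → ℕ) (G : Finset (Fin N) → ℝ),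
      Integrable (fun ω => (if X ω = v then (1 : ℝ) else 0) * G (U ω)) μ := by
    intro v G
    refine (integrable_finset_comp (μ := μ) hU G).bdd_mul (c := 1)
      ((hind v).comp hX).aestronglyMeasurable (Filter.Eventually.of_forall fun ω => ?_)
    by_cases hω : X ω = v <;> simp [hω]
  set K := F Finset.univ with hK
  have hdec : ∀ ω, F (slotUpdate j (U ω) (X ω)) = K
      + (if X ω = 0 then (1 : ℝ) else 0) * (F (U ω) - K)
      + ∑ c, (if X ω = Pi.single c 1 then (1 : ℝ) else 0) * (F (updateSet j (U ω) c) - K) := by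
    intro ω
    by_cases h : X ω = 0
    · have h' : ∀ c : Source N, (0 : Source N → ℕ) ≠ Pi.single c 1 := by
        intro c hc
        have := congrFun hc c
        simp at this
      simp [h, slotUpdate_zero, h']
    · by_cases h' : ∃ c, X ω = Pi.single c 1
      · obtain ⟨c, hc⟩ := h'
        rw [if_neg h, hc, slotUpdate_single, Finset.sum_eq_single c]
        · simp
        · intro c' _ hne
          rw [if_neg fun he => hne (single_one_injective he).symm, zero_mul]
        · simp
      · push Not at h'
        rw [slotUpdate_of_ne j _ h h']
        simp [h, h', hK]
  simp_rw [hdec]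
  have hi1 := hint 0 (fun S => F S - K)
  have hi2 : ∀ c, Integrable (fun ω => (if X ω = Pi.single c 1 then (1 : ℝ) else 0)
      * (F (updateSet j (U ω) c) - K)) μ := fun c =>
    hint (Pi.single c 1) (fun S => F (updateSet j S c) - K)
  have hi12 : Integrable (fun ω => K + (if X ω = 0 then (1 : ℝ) else 0) * (F (U ω) - K)) μ :=
    (integrable_const K).add hi1
  rw [integral_add hi12 (integrable_finsetSum _ fun c _ => hi2 c),
    integral_add (integrable_const K) hi1, integral_finsetSum _ fun c _ => hi2 c, hprod 0 (fun S => F S - K), h0]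
  have e2 : ∀ c, ∫ ω, (if X ω = Pi.single c 1 then (1 : ℝ) else 0)
      * (F (updateSet j (U ω) c) - K) ∂μ = sourceRate N lamR lamC c * δ *
        Real.exp (-(totalRate N lamR lamC * δ)) * (∫ ω, F (updateSet j (U ω) c) ∂μ - K) := by
    intro c
    rw [hprod (Pi.single c 1) (fun S => F (updateSet j S c) - K), h1,
      integral_sub (integrable_finset_comp hU fun S => F (updateSet j S c)) (integrable_const K)]
    simp
  simp_rw [e2]
  rw [integral_sub (integrable_finset_comp hU F) (integrable_const K)]
  have e3 : ∀ ω, stepOp N lamR lamC j δ F (U ω) = Real.exp (-(totalRate N lamR lamC * δ)) * F (U ω)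
      + ∑ c, Real.exp (-(totalRate N lamR lamC * δ)) * δ * sourceRate N lamR lamC c *
        F (updateSet j (U ω) c)
      + (1 - Real.exp (-(totalRate N lamR lamC * δ)) * (1 + totalRate N lamR lamC * δ)) * K := by
    intro ω
    rw [stepOp_apply, mul_add, ← mul_assoc, Finset.mul_sum]
    simp only [mul_assoc]
    rfl
  simp_rw [e3]
  have hi3 : ∀ c, Integrable (fun ω => Real.exp (-(totalRate N lamR lamC * δ)) * δ *
      sourceRate N lamR lamC c * F (updateSet j (U ω) c)) μ := fun c =>
    (integrable_finset_comp hU fun S => F (updateSet j S c)).const_mul _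
  have hi4 : Integrable (fun ω => Real.exp (-(totalRate N lamR lamC * δ)) * F (U ω)
      + ∑ c, Real.exp (-(totalRate N lamR lamC * δ)) * δ * sourceRate N lamR lamC c *
        F (updateSet j (U ω) c)) μ :=
    ((integrable_finset_comp hU F).const_mul _).add (integrable_finsetSum _ fun c _ => hi3 c)
  rw [integral_add hi4 (integrable_const _),
    integral_add ((integrable_finset_comp hU F).const_mul _)
    (integrable_finsetSum _ fun c _ => hi3 c), integral_finsetSum _ fun c _ => hi3 c]
  simp only [integral_const_mul, integral_const, probReal_univ, one_smul]
  simp only [mul_sub, Finset.sum_sub_distrib]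
  have e4 : ∑ c, sourceRate N lamR lamC c * δ * Real.exp (-(totalRate N lamR lamC * δ)) * K
      = totalRate N lamR lamC * δ * Real.exp (-(totalRate N lamR lamC * δ)) * K := by
    rw [totalRate, Finset.sum_mul, Finset.sum_mul, Finset.sum_mul]
  rw [e4]
  have e5 : ∀ c, sourceRate N lamR lamC c * δ * Real.exp (-(totalRate N lamR lamC * δ)) *
      ∫ ω, F (updateSet j (U ω) c) ∂μ = Real.exp (-(totalRate N lamR lamC * δ)) * δ *
      sourceRate N lamR lamC c * ∫ ω, F (updateSet j (U ω) c) ∂μ := fun c => by ring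
  simp_rw [e5]
  ring

lemma sourceSigma_inl {N : ℕ} {Ω : Type*} (E : Ω → EventSeq N) (c : Source N) :
    sourceSigma E (Sum.inl c) = clockSigma fun ω => (E ω).clock c := by
  rcases c with l | p <;> rfl

section Model

variable {N : ℕ} {lamR lamC : ℝ} {Ω : Type*} [mΩ : MeasurableSpace Ω] {μ : Measure Ω}
  {ν : Measure ℝ} {E : Ω → EventSeq N}

lemma IsGossipModel.poissonClock (h : IsGossipModel μ lamR lamC ν E) (c : Source N) :
    IsPoissonClock μ (sourceRate N lamR lamC c) fun ω => (E ω).clock c := by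
  rcases c with l | p
  · exact h.repl_clock l
  · exact h.exch_clock p.1.1 p.1.2 p.2

lemma IsGossipModel.sourceSigma_le (h : IsGossipModel μ lamR lamC ν E)
    (s : (Fin N ⊕ AgentPair N) ⊕ (Fin N × ℕ)) : sourceSigma E s ≤ mΩ := by
  rcases s with c | v
  · rw [sourceSigma_inl]; exact (h.poissonClock c).clockSigma_le
  · rw [sourceSigma, ← BorelSpace.measurable_eq]
    exact (h.measurable_val v.1 v.2).comap_le

lemma IsGossipModel.iIndepFun_tickCount (h : IsGossipModel μ lamR lamC ν E) {t : ℕ → ℝ}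
    (h0 : 0 ≤ t 0) (ht : Monotone t) :
    iIndepFun (fun (p : Source N × ℕ) ω => tickCount ((E ω).clock p.1) (t p.2) (t (p.2 + 1))) μ := by
  refine iIndepFun_uncurry' (X := fun (c : Source N) (m : ℕ) ω =>
    tickCount ((E ω).clock c) (t m) (t (m + 1)))
    (fun c m => (h.poissonClock c).measurable_count _ _) ?_
    fun c => (h.poissonClock c).indep_increments t h0 ht
  rw [iIndepFun_iff_iIndep]
  refine iIndep_of_iIndep_of_le (h.indep.precomp Sum.inl_injective) fun c => ?_
  rw [Function.comp_apply, sourceSigma_inl]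
  refine Measurable.comap_le ?_
  refine @measurable_pi_lambda _ _ _ (clockSigma fun ω => (E ω).clock c) _ _ fun m => ?_
  exact measurable_tickCount_clockSigma _ _ _

lemma IsGossipModel.integral_slotChain [IsProbabilityMeasure μ]
    (h : IsGossipModel μ lamR lamC ν E) (hN : 2 ≤ N) (hr : 0 < lamR) (hc : 0 < lamC)
    (j : Fin N) {t : ℕ → ℝ} {δ : ℝ} (hδ : 0 ≤ δ) (h0 : 0 ≤ t 0) (ht : ∀ m, t (m + 1) - t m = δ)
    (m : ℕ) (F : Finset (Fin N) → ℝ) :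
    ∫ ω, F (slotChain j (fun m c => tickCount ((E ω).clock c) (t m) (t (m + 1))) m) ∂μ
      = (stepOp N lamR lamC j δ ^ m) F {j} := by
  have htm : Monotone t := monotone_nat_of_le_succ fun m => by linarith [ht m]
  have ht0 : ∀ m, 0 ≤ t m := fun m => h0.trans (htm (Nat.zero_le m))
  set X : ℕ → Ω → Source N → ℕ := fun m ω c => tickCount ((E ω).clock c) (t m) (t (m + 1)) with hX
  have hXm : ∀ m c, Measurable fun ω => X m ω c := fun m c => (h.poissonClock c).measurable_count _ _
  have hXm' : ∀ m, Measurable (X m) := fun m => measurable_pi_lambda _ (hXm m)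
  have hind := h.iIndepFun_tickCount h0 htm
  set σ' : Source N × ℕ → MeasurableSpace Ω := fun p =>
    MeasurableSpace.comap (fun ω => X p.2 ω p.1) ⊤ with hσ'
  have hindσ : iIndep σ' μ := (iIndepFun_iff_iIndep _ _ μ).1 hind
  have hσ'le : ∀ p, σ' p ≤ mΩ := fun p => (hXm p.2 p.1).comap_le
  set U : ℕ → Ω → Finset (Fin N) := fun m ω => slotChain j (fun m => X m ω) m with hU
  have hXσ : ∀ (m : ℕ) (S : Set (Source N × ℕ)), (∀ c, (c, m) ∈ S) →
      Measurable[⨆ p ∈ S, σ' p] (X m) := by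
    intro m S hS
    refine @measurable_pi_lambda _ _ _ (⨆ p ∈ S, σ' p) _ _ fun c => ?_
    exact (comap_measurable _).mono (le_iSup₂ (f := fun p (_ : p ∈ S) => σ' p) (c, m) (hS c)) le_rfl
  have hUσ : ∀ m, Measurable[⨆ p ∈ {p : Source N × ℕ | p.2 < m}, σ' p] (U m) := by
    intro m
    induction m with
    | zero => exact @measurable_const _ _ _ _ _
    | succ m ih =>
      have h1 : Measurable[⨆ p ∈ {p : Source N × ℕ | p.2 < m + 1}, σ' p] (U m) :=
        ih.mono (biSup_mono fun p hp => Nat.lt_succ_of_lt hp) le_rfl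
      have h2 := hXσ m {p : Source N × ℕ | p.2 < m + 1} fun c => Nat.lt_succ_self m
      exact @measurable_finset_comp₂ _ _ _ (⨆ p ∈ {p : Source N × ℕ | p.2 < m + 1}, σ' p) _ _
        (slotUpdate j) _ _ h1 h2
  have hUm : ∀ m, Measurable (U m) := fun m =>
    (hUσ m).mono (iSup₂_le fun p _ => hσ'le p) le_rfl
  have hUX : ∀ m, IndepFun (X m) (U m) μ := by
    intro m
    rw [IndepFun_iff_Indep]
    have hd := indep_iSup_of_disjoint (S := {p : Source N × ℕ | p.2 = m})
      (T := {p : Source N × ℕ | p.2 < m}) hσ'le hindσ (by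
        rw [Set.disjoint_left]
        intro p hp hp'
        exact absurd hp (ne_of_lt hp'))
    have h1 : Measurable[⨆ p ∈ {p : Source N × ℕ | p.2 = m}, σ' p] (X m) :=
      hXσ m {p | p.2 = m} fun c => rfl
    have h2 := hUσ m
    have h3 := h1.comap_le
    have h4 := h2.comap_le
    exact indep_of_indep_of_le hd h3 h4
  have hlaw : ∀ m (v : Source N → ℕ), μ.real {ω | X m ω = v} = ∏ c,
      (Real.exp (-(sourceRate N lamR lamC c * δ)) * ((sourceRate N lamR lamC c * δ) ^ v c /
        (v c).factorial)) := by
    intro m v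
    have h1 : iIndepFun (fun c ω => X m ω c) μ :=
      hind.precomp (g := fun c : Source N => (c, m)) fun c c' hcc => (Prod.mk.inj hcc).1
    have h2 : {ω | X m ω = v} = ⋂ c, {ω | X m ω c = v c} := by
      ext ω
      simp [funext_iff]
    have h3 := h1.meas_iInter (s := fun c => {ω | X m ω c = v c})
      fun c => ⟨{v c}, measurableSet_singleton _, rfl⟩
    rw [measureReal_def, h2, h3, ENNReal.toReal_prod]
    refine Finset.prod_congr rfl fun c _ => ?_
    have := (h.poissonClock c).measureReal_tickCount_eq (sourceRate_nonneg hN hr hc c) (ht0 m)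
      (htm (Nat.le_succ m)) (v c)
    rw [ht m, mul_div_assoc] at this
    exact this
  have hexp : ∏ c, Real.exp (-(sourceRate N lamR lamC c * δ))
      = Real.exp (-(totalRate N lamR lamC * δ)) := by
    rw [← Real.exp_sum, totalRate, Finset.sum_mul, Finset.sum_neg_distrib]
  have hstep : ∀ m (F : Finset (Fin N) → ℝ), ∫ ω, F (U (m + 1) ω) ∂μ
      = ∫ ω, stepOp N lamR lamC j δ F (U m ω) ∂μ := by
    intro m F
    refine integral_slotUpdate j (hUm m) (hXm' m) (hUX m) ?_ ?_ F
    · rw [hlaw, Finset.prod_mul_distrib, hexp]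
      simp
    · intro c
      rw [hlaw, Finset.prod_mul_distrib, hexp, Finset.prod_eq_single c]
      · simp; ring
      · intro c' _ hne
        simp [hne]
      · simp
  change ∫ ω, F (U m ω) ∂μ = _
  induction m generalizing F with
  | zero => simp [hU, slotChain]
  | succ m ih => rw [hstep, ih, pow_succ, Module.End.mul_apply]

end Model

lemma hasSum_setIntegral_fiber {Ω α : Type*} [MeasurableSpace Ω] {μ : Measure Ω} [Countable α]
    [MeasurableSpace α] [MeasurableSingletonClass α] {c : Ω → α} (hc : Measurable c) {f : Ω → ℝ}
    (hf : Integrable f μ) : HasSum (fun a => ∫ ω in c ⁻¹' {a}, f ω ∂μ) (∫ ω, f ω ∂μ) := by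
  have h1 := hasSum_integral_iUnion (μ := μ) (f := f) (s := fun a => c ⁻¹' {a})
    (fun a => hc (measurableSet_singleton a))
    (fun a b hab => by
      rw [Function.onFun, Set.disjoint_left]
      rintro ω h1 h2
      exact hab (h1.symm.trans h2)) hf.integrableOn
  have h2 : (⋃ a, c ⁻¹' {a}) = Set.univ := by
    ext ω; simp
  rwa [h2, setIntegral_univ] at h1

lemma indepFun_of_measurable {Ω β γ : Type*} {m₁ m₂ : MeasurableSpace Ω} [MeasurableSpace Ω]
    {μ : Measure Ω} [MeasurableSpace β] [MeasurableSpace γ] (h : Indep m₁ m₂ μ) {X : Ω → β}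
    {Y : Ω → γ} (hX : Measurable[m₁] X) (hY : Measurable[m₂] Y) : IndepFun X Y μ := by
  rw [IndepFun_iff_Indep]
  exact indep_of_indep_of_le h hX.comap_le hY.comap_le

lemma measurableClocks_of_clock {N : ℕ} {Ω : Type*} [MeasurableSpace Ω] {E : Ω → EventSeq N}
    (hsymm : ∀ ω i j, (E ω).exch i j = (E ω).exch j i) (hself : ∀ ω i, (E ω).exch i i = ∅)
    (h : ∀ c, IsMeasurableClock fun ω => (E ω).clock c) : MeasurableClocks E where
  repl i := h (Sum.inl i)
  exch i j := by
    rcases lt_trichotomy i j with hij | hij | hij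
    · exact h (Sum.inr ⟨(i, j), hij⟩)
    · subst hij
      simp_rw [hself]
      exact ⟨fun _ => Set.empty_subset _, fun _ _ => by simp, fun a b => by simp [tickCount]⟩
    · simp_rw [fun ω => hsymm ω i j]
      exact h (Sum.inr ⟨(j, i), hij⟩)

namespace EventSeq

variable {N : ℕ}

open Classical in
/-- The event sequence without the replacements of `j` after time `u`, and without the values of
`j` after the first `a` replacements. -/
def truncate (e : EventSeq N) (j : Fin N) (u : ℝ) (a : ℕ) : EventSeq N where
  repl i := if i = j then e.repl i ∩ Set.Iic u else e.repl i
  exch := e.exch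
  val i n := if i = j ∧ a < n then 0 else e.val i n

lemma agreeUntil_truncate {e : EventSeq N} {j : Fin N} {u : ℝ} {a : ℕ}
    (hfin : ∀ b, (e.repl j ∩ Set.Iic b).Finite) (h : tickCount (e.repl j) 0 u = a) :
    AgreeUntil e (e.truncate j u a) j u where
  exch _ _ := rfl
  repl i hi := by simp [truncate, hi]
  val i hi := by funext n; simp [truncate, hi]
  repl_self x hx := by simp [truncate, hx]
  value_self t ht := by
    have h1 : (e.repl j ∩ Set.Iic u ∩ Set.Ioc 0 t).ncard = (e.repl j ∩ Set.Ioc 0 t).ncard := by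
      have := tickCount_inter_Iic (e.repl j) u 0 t
      rwa [min_eq_left ht] at this
    have h2 : ¬ a < (e.repl j ∩ Set.Ioc 0 t).ncard := by
      rw [← h]
      exact not_lt.2 (tickCount_mono hfin ht 0)
    simp only [value, truncate, true_and, if_true, h1, h2, if_false]

open Classical in
/-- A function of the knowledge set of `i` at time `t`, cut off to the event that `i` has no
information about `j` sent out after time `u`, but some sent out after time `u'` (unless `P`
holds). -/
def window (φ : Set (Info N) → ℝ) (j i : Fin N) (u u' t : ℝ) (P : Prop) (e : EventSeq N) : ℝ :=
  if ¬ e.Reach j u i t ∧ (P ∨ e.Reach j u' i t) then φ (e.knowledge i t) else 0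

lemma AgreeUntil.window_eq {e e' : EventSeq N} {j : Fin N} {u : ℝ} (h : AgreeUntil e e' j u)
    (φ : Set (Info N) → ℝ) (i : Fin N) (u' t : ℝ) (P : Prop) :
    e.window φ j i u u' t P = e'.window φ j i u u' t P := by
  by_cases hR : e.Reach j u i t
  · have hR' := (h.reach_iff i t).1 hR
    simp [window, hR, hR']
  · have hK := h.knowledge_eq hR
    have hu' := reach_iff_of_knowledge_eq hK j u'
    have hR' := (not_congr (h.reach_iff i t)).1 hR
    by_cases hP : P ∨ e.Reach j u' i t
    · have hP' : P ∨ e'.Reach j u' i t := hP.imp_right hu'.1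
      simp [window, hR, hR', hP, hP', hK]
    · have hP' : ¬ (P ∨ e'.Reach j u' i t) := fun hp => hP (hp.imp_right hu'.2)
      simp [window, hP, hP']

end EventSeq

lemma MeasurableClocks.measurable_window {N : ℕ} {Ω : Type*} [MeasurableSpace Ω]
    {E : Ω → EventSeq N} (hE : MeasurableClocks E)
    (hval : ∀ i n, Measurable fun ω => (E ω).val i n) {φ : Set (Info N) → ℝ}
    (hφ : Measurable[knowledgeSigma N] φ) (j i : Fin N) (u u' t : ℝ) (P : Prop) :
    Measurable fun ω => (E ω).window φ j i u u' t P := by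
  classical
  unfold EventSeq.window
  refine Measurable.ite ?_ (hφ.comp (hE.measurable_knowledge hval i t)) measurable_const
  exact (hE.measurableSet_reach j u i t).compl.inter
    ((MeasurableSet.const P).union (hE.measurableSet_reach j u' i t))

lemma measurable_val_truncate {N : ℕ} {Ω : Type*} {m : MeasurableSpace Ω}
    {E : Ω → EventSeq N} {j : Fin N} {u : ℝ} (a : ℕ)
    (hv : ∀ v : Fin N × ℕ, (v.1 = j → v.2 ≤ a) → sourceSigma E (Sum.inr v) ≤ m)
    (i : Fin N) (n : ℕ) : Measurable[m] fun ω => ((E ω).truncate j u a).val i n := by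
  by_cases hi : i = j ∧ a < n
  · simp only [EventSeq.truncate, hi, and_self, if_true]
    exact @measurable_const _ _ _ m _
  · simp only [EventSeq.truncate, hi, if_false]
    have h1 := hv (i, n) fun hij => not_lt.1 fun hn => hi ⟨hij, hn⟩
    rw [sourceSigma, ← BorelSpace.measurable_eq] at h1
    exact (comap_measurable _).mono h1 le_rfl

/-- The σ-algebra of the sources of randomness in `P`. -/
@[reducible]
def sourcesSigma {N : ℕ} {Ω : Type*} (E : Ω → EventSeq N)
    (P : Set ((Fin N ⊕ AgentPair N) ⊕ (Fin N × ℕ))) : MeasurableSpace Ω :=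
  ⨆ s ∈ P, sourceSigma E s

/-- The σ-algebra of everything but the replacements of `j` after time `u`. -/
@[reducible]
def beforeSigma {N : ℕ} {Ω : Type*} (E : Ω → EventSeq N) (j : Fin N) (u : ℝ) : MeasurableSpace Ω :=
  (clockSigma fun ω => (E ω).repl j ∩ Set.Iic u) ⊔ sourcesSigma E {s | s ≠ Sum.inl (Sum.inl j)}

lemma sourceSigma_le_sourcesSigma {N : ℕ} {Ω : Type*} (E : Ω → EventSeq N)
    {P : Set ((Fin N ⊕ AgentPair N) ⊕ (Fin N × ℕ))} {s} (hs : s ∈ P) :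
    sourceSigma E s ≤ sourcesSigma E P :=
  le_iSup₂ (f := fun s (_ : s ∈ P) => sourceSigma E s) s hs

lemma measurable_val_sourceSigma {N : ℕ} {Ω : Type*} (E : Ω → EventSeq N) (i : Fin N) (n : ℕ) :
    Measurable[sourceSigma E (Sum.inr (i, n))] fun ω => (E ω).val i n := by
  rw [sourceSigma, ← BorelSpace.measurable_eq]
  exact comap_measurable _

section Model

variable {N : ℕ} {lamR lamC : ℝ} {Ω : Type*} {m : MeasurableSpace Ω} [mΩ : MeasurableSpace Ω]
  {μ : Measure Ω} {ν : Measure ℝ} {E : Ω → EventSeq N}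

lemma IsGossipModel.measurableClocks_truncate (h : IsGossipModel μ lamR lamC ν E) {j : Fin N}
    {u : ℝ} (a : ℕ) (hj : (clockSigma fun ω => (E ω).repl j ∩ Set.Iic u) ≤ m)
    (hc : ∀ c, c ≠ Sum.inl j → sourceSigma E (Sum.inl c) ≤ m) :
    @MeasurableClocks N Ω m fun ω => (E ω).truncate j u a := by
  refine @measurableClocks_of_clock N Ω m _ (fun ω i j => h.exch_symm ω i j)
    (fun ω i => h.exch_self ω i) fun c => ?_
  have hother : c ≠ Sum.inl j → @IsMeasurableClock Ω m fun ω => (E ω).clock c := fun hne =>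
    (h.poissonClock c).isMeasurableClock (by rw [← sourceSigma_inl]; exact hc c hne)
  rcases c with l | p
  · by_cases hl : l = j
    · subst hl
      have h1 : (fun ω => ((E ω).truncate l u a).clock (Sum.inl l))
          = fun ω => (E ω).repl l ∩ Set.Iic u := by
        funext ω; simp [EventSeq.truncate, EventSeq.clock]
      rw [h1]
      have hT := h.repl_clock l
      exact @IsMeasurableClock.mk Ω m _ (fun ω => Set.inter_subset_left.trans (hT.pos ω))
        (fun ω b => (hT.finite ω b).subset fun _ hx => ⟨hx.1.1, hx.2⟩)
        fun a b => (measurable_tickCount_clockSigma _ a b).mono hj le_rfl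
    · have h1 : (fun ω => ((E ω).truncate j u a).clock (Sum.inl l))
          = fun ω => (E ω).clock (Sum.inl l) := by
        funext ω; simp [EventSeq.truncate, EventSeq.clock, hl]
      rw [h1]
      exact hother (by simpa using hl)
  · exact hother (by simp)

lemma IsGossipModel.sourcesSigma_le (h : IsGossipModel μ lamR lamC ν E)
    (P : Set ((Fin N ⊕ AgentPair N) ⊕ (Fin N × ℕ))) : sourcesSigma E P ≤ mΩ :=
  iSup₂_le fun s _ => h.sourceSigma_le s

lemma IsGossipModel.indep_source (h : IsGossipModel μ lamR lamC ν E)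
    (s : (Fin N ⊕ AgentPair N) ⊕ (Fin N × ℕ)) {P : Set ((Fin N ⊕ AgentPair N) ⊕ (Fin N × ℕ))}
    (hs : s ∉ P) : Indep (sourceSigma E s) (sourcesSigma E P) μ := by
  have := indep_iSup_of_disjoint (S := {s}) (T := P) h.sourceSigma_le h.indep
    (Set.disjoint_singleton_left.2 hs)
  rwa [iSup_singleton] at this

lemma IsGossipModel.integral_val (h : IsGossipModel μ lamR lamC ν E) (i : Fin N) (n : ℕ) :
    ∫ ω, (E ω).val i n ∂μ = ∫ x, x ∂ν := by
  rw [← h.law_val i n]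
  exact (integral_map (h.measurable_val i n).aemeasurable
    measurable_id.aestronglyMeasurable).symm

lemma IsGossipModel.measurable_window_truncate (h : IsGossipModel μ lamR lamC ν E) {j i : Fin N}
    {u u' t : ℝ} (a : ℕ) {φ : Set (Info N) → ℝ} (hφ : Measurable[knowledgeSigma N] φ) (P : Prop)
    (hj : (clockSigma fun ω => (E ω).repl j ∩ Set.Iic u) ≤ m)
    (hc : ∀ c, c ≠ Sum.inl j → sourceSigma E (Sum.inl c) ≤ m)
    (hv : ∀ v : Fin N × ℕ, (v.1 = j → v.2 ≤ a) → sourceSigma E (Sum.inr v) ≤ m) :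
    Measurable[m] fun ω => ((E ω).truncate j u a).window φ j i u u' t P :=
  @MeasurableClocks.measurable_window N Ω m _ (h.measurableClocks_truncate a hj hc)
    (measurable_val_truncate a hv) φ hφ j i u u' t P

lemma value_eq_val_add {e : EventSeq N} {j : Fin N} (hfin : ∀ b, (e.repl j ∩ Set.Iic b).Finite)
    {u t : ℝ} (hu : 0 ≤ u) (hut : u ≤ t) :
    e.value j t = e.val j (tickCount (e.repl j) 0 u + tickCount (e.repl j) u t) := by
  rw [tickCount_add hfin hu hut]
  rfl

/-- Without information about `j` sent out after time `u`, the best guess of the value of `j`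
contracts its value at time `u` by the probability that `j` is still there. -/
theorem IsGossipModel.integral_value_mul_window [IsProbabilityMeasure μ]
    (h : IsGossipModel μ lamR lamC ν E) (hr : 0 < lamR) (hν : ∫ x, x ∂ν = 0) {j i : Fin N}
    {u u' t : ℝ} (hu : 0 ≤ u) (hut : u ≤ t) {φ : Set (Info N) → ℝ}
    (hφ : Measurable[knowledgeSigma N] φ) (P : Prop)
    (hi1 : Integrable (fun ω => (E ω).value j t * (E ω).window φ j i u u' t P) μ)
    (hi2 : Integrable (fun ω => (E ω).value j u * (E ω).window φ j i u u' t P) μ) :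
    ∫ ω, (E ω).value j t * (E ω).window φ j i u u' t P ∂μ
      = Real.exp (-(lamR * (t - u))) *
        ∫ ω, (E ω).value j u * (E ω).window φ j i u u' t P ∂μ := by
  classical
  have hT := h.repl_clock j
  set n₀ : Ω → ℕ := fun ω => tickCount ((E ω).repl j) 0 u with hn₀
  set M : Ω → ℕ := fun ω => tickCount ((E ω).repl j) u t with hM
  have hn₀m : Measurable n₀ := hT.measurable_count 0 u
  have hMm : Measurable M := hT.measurable_count u t
  set Z : ℕ → Ω → ℝ := fun a ω => ((E ω).truncate j u a).window φ j i u u' t P with hZ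
  have hZeq : ∀ a ω, n₀ ω = a → (E ω).window φ j i u u' t P = Z a ω := fun a ω ha =>
    (EventSeq.agreeUntil_truncate (hT.finite ω) ha).window_eq φ i u' t P
  have hsum1 := hasSum_setIntegral_fiber (hn₀m.prodMk hMm) hi1
  have hsum2 := hasSum_setIntegral_fiber hn₀m hi2
  have hpast := clockSigma_inter_Iic_le (fun ω => (E ω).repl j) u
  have hzero : ∀ a k : ℕ, ∫ ω in (fun ω => (n₀ ω, M ω)) ⁻¹' {(a, k + 1)},
      (E ω).value j t * (E ω).window φ j i u u' t P ∂μ = 0 := by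
    intro a k
    have hle : ∀ s, s ≠ Sum.inr (j, a + (k + 1)) → sourceSigma E s ≤ sourcesSigma E {s | s ≠ Sum.inr (j, a + (k + 1))} := fun s hs =>
      sourceSigma_le_sourcesSigma E hs
    have hclock : (clockSigma fun ω => (E ω).repl j) ≤ sourcesSigma E {s | s ≠ Sum.inr (j, a + (k + 1))} := hle (Sum.inl (Sum.inl j)) (by simp)
    have hZσ : Measurable[sourcesSigma E {s | s ≠ Sum.inr (j, a + (k + 1))}] (Z a) := h.measurable_window_truncate a hφ P (hpast.trans hclock) (fun c _ => hle _ (by simp))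
      fun v hv => hle _ (by
        intro he
        have h1 := Sum.inr_injective he
        have h2 := hv (by rw [h1])
        rw [h1] at h2
        simp at h2)
    have hnσ : Measurable[sourcesSigma E {s | s ≠ Sum.inr (j, a + (k + 1))}] n₀ := (measurable_tickCount_clockSigma _ 0 u).mono hclock le_rfl
    have hMσ : Measurable[sourcesSigma E {s | s ≠ Sum.inr (j, a + (k + 1))}] M := (measurable_tickCount_clockSigma _ u t).mono hclock le_rfl
    set Q : Ω → ℝ := fun ω => if n₀ ω = a ∧ M ω = k + 1 then Z a ω else 0 with hQ
    have hQσ : Measurable[sourcesSigma E {s | s ≠ Sum.inr (j, a + (k + 1))}] Q := by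
      refine Measurable.ite ?_ hZσ (@measurable_const _ _ _ (sourcesSigma E {s | s ≠ Sum.inr (j, a + (k + 1))}) _)
      exact MeasurableSet.inter (hnσ (measurableSet_singleton a))
        (hMσ (measurableSet_singleton (k + 1)))
    have hind : IndepFun (fun ω => (E ω).val j (a + (k + 1))) Q μ :=
      indepFun_of_measurable (h.indep_source (Sum.inr (j, a + (k + 1))) (by simp))
        (measurable_val_sourceSigma E j _) hQσ
    have hprod := hind.integral_fun_mul_eq_mul_integral
      (h.measurable_val j _).aestronglyMeasurable
      (hQσ.mono (h.sourcesSigma_le _) le_rfl).aestronglyMeasurable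
    rw [h.integral_val, hν, zero_mul] at hprod
    rw [← integral_indicator ((hn₀m.prodMk hMm) (measurableSet_singleton _)), ← hprod]
    refine integral_congr_ae (Filter.Eventually.of_forall fun ω => ?_)
    by_cases hω : n₀ ω = a ∧ M ω = k + 1
    · have hω' : ω ∈ (fun ω => (n₀ ω, M ω)) ⁻¹' {(a, k + 1)} := by simp [hω.1, hω.2]
      simp only [Set.indicator_of_mem hω', hQ, if_pos hω]
      rw [value_eq_val_add (hT.finite ω) hu hut, hZeq a ω hω.1, ← hω.1, ← hω.2]
    · have hω' : ω ∉ (fun ω => (n₀ ω, M ω)) ⁻¹' {(a, k + 1)} := by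
        simpa using hω
      simp only [Set.indicator_of_notMem hω', hQ, if_neg hω, mul_zero]
  have hfirst : ∀ a : ℕ, ∫ ω in (fun ω => (n₀ ω, M ω)) ⁻¹' {(a, 0)},
      (E ω).value j t * (E ω).window φ j i u u' t P ∂μ = Real.exp (-(lamR * (t - u))) *
        ∫ ω in n₀ ⁻¹' {a}, (E ω).value j u * (E ω).window φ j i u u' t P ∂μ := by
    intro a
    have hσle : beforeSigma E j u ≤ mΩ := sup_le (hpast.trans hT.clockSigma_le) (h.sourcesSigma_le _)
    have hle : ∀ s, s ≠ Sum.inl (Sum.inl j) → sourceSigma E s ≤ beforeSigma E j u := fun s hs =>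
      (sourceSigma_le_sourcesSigma E hs).trans le_sup_right
    have hZσ : Measurable[beforeSigma E j u] (Z a) := h.measurable_window_truncate a hφ P le_sup_left
      (fun c hc => hle _ (fun he => hc (Sum.inl_injective he))) fun v _ => hle _ (by simp)
    have hnσ : Measurable[beforeSigma E j u] n₀ := by
      have h1 : n₀ = fun ω => tickCount ((E ω).repl j ∩ Set.Iic u) 0 u := by
        funext ω
        rw [tickCount_inter_Iic, min_self]
      rw [h1]
      exact (measurable_tickCount_clockSigma (fun ω => (E ω).repl j ∩ Set.Iic u) 0 u).mono
        le_sup_left le_rfl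
    have hind : Indep (beforeSigma E j u) (MeasurableSpace.comap M ⊤) μ :=
      indep_sup_of_indep_indep hT.clockSigma_le (h.sourcesSigma_le _) hpast
        ((measurable_tickCount_clockSigma _ u t).comap_le)
        (h.indep_source (Sum.inl (Sum.inl j)) (by simp)) (hT.indep_past hu hut)
    set W : Ω → ℝ := fun ω => if n₀ ω = a then (E ω).val j a * Z a ω else 0 with hW
    have hWσ : Measurable[beforeSigma E j u] W := by
      refine Measurable.ite (hnσ (measurableSet_singleton a)) ?_ (@measurable_const _ _ _ (beforeSigma E j u) _)
      exact ((measurable_val_sourceSigma E j a).mono (hle _ (by simp)) le_rfl).mul hZσ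
    have hI : Measurable[MeasurableSpace.comap M ⊤] fun ω => if M ω = 0 then (1 : ℝ) else 0 :=
      (Measurable.of_discrete (f := fun k : ℕ => if k = 0 then (1 : ℝ) else 0)).comp
        (comap_measurable M)
    have hprod := (indepFun_of_measurable hind.symm hI hWσ).integral_fun_mul_eq_mul_integral
      (hI.mono hMm.comap_le le_rfl).aestronglyMeasurable
      (hWσ.mono hσle le_rfl).aestronglyMeasurable
    have hP : ∫ ω, (if M ω = 0 then (1 : ℝ) else 0) ∂μ = Real.exp (-(lamR * (t - u))) := by
      have h1 := hT.measureReal_tickCount_eq hr.le hu hut 0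
      simp only [pow_zero, Nat.factorial_zero, Nat.cast_one, mul_one, div_one] at h1
      have hs : MeasurableSet {ω | M ω = 0} := hMm (measurableSet_singleton 0)
      rw [← h1, ← integral_indicator_one hs]
      refine integral_congr_ae (Filter.Eventually.of_forall fun ω => ?_)
      by_cases hω : M ω = 0 <;> simp [hω, Set.indicator]
    rw [hP] at hprod
    rw [← integral_indicator (hn₀m (measurableSet_singleton _)),
      ← integral_indicator ((hn₀m.prodMk hMm) (measurableSet_singleton _))]
    have e2 : ∫ ω, (n₀ ⁻¹' {a}).indicator
        (fun ω => (E ω).value j u * (E ω).window φ j i u u' t P) ω ∂μ = ∫ ω, W ω ∂μ := by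
      refine integral_congr_ae (Filter.Eventually.of_forall fun ω => ?_)
      by_cases hω : n₀ ω = a
      · have hω' : ω ∈ n₀ ⁻¹' {a} := hω
        simp only [Set.indicator_of_mem hω', hW, if_pos hω]
        rw [hZeq a ω hω, ← hω]
        rfl
      · have hω' : ω ∉ n₀ ⁻¹' {a} := hω
        simp only [Set.indicator_of_notMem hω', hW, if_neg hω]
    rw [e2, ← hprod]
    refine integral_congr_ae (Filter.Eventually.of_forall fun ω => ?_)
    by_cases hω : n₀ ω = a ∧ M ω = 0
    · have hω' : ω ∈ (fun ω => (n₀ ω, M ω)) ⁻¹' {(a, 0)} := by simp [hω.1, hω.2]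
      simp only [Set.indicator_of_mem hω', hW, if_pos hω.1, if_pos hω.2, one_mul]
      rw [value_eq_val_add (hT.finite ω) hu hut, hZeq a ω hω.1]
      congr 2
      change n₀ ω + M ω = a
      rw [hω.1, hω.2, add_zero]
    · have hω' : ω ∉ (fun ω => (n₀ ω, M ω)) ⁻¹' {(a, 0)} := by
        simpa using hω
      simp only [Set.indicator_of_notMem hω', hW]
      by_cases h1 : n₀ ω = a
      · have h2 : M ω ≠ 0 := fun h2 => hω ⟨h1, h2⟩
        simp [h2]
      · simp [h1]
  have hinj : Function.Injective fun a : ℕ => (a, 0) := fun a b hab => (Prod.mk.inj hab).1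
  have hsum3 := (hinj.hasSum_iff (f := fun p : ℕ × ℕ => ∫ ω in (fun ω => (n₀ ω, M ω)) ⁻¹' {p},
    (E ω).value j t * (E ω).window φ j i u u' t P ∂μ) (by
      rintro ⟨a, k⟩ hk
      rcases k with _ | k
      · exact absurd ⟨a, rfl⟩ hk
      · exact hzero a k)).2 hsum1
  have hsum4 := hsum2.mul_left (Real.exp (-(lamR * (t - u))))
  refine hsum3.unique ?_
  simp only [Function.comp_def, hfirst]
  exact hsum4

end Model

/-- The σ-algebra of all the clocks. -/
@[reducible]
def clocksSigma {N : ℕ} {Ω : Type*} (E : Ω → EventSeq N) : MeasurableSpace Ω :=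
  sourcesSigma E (Set.range Sum.inl)

/-- The σ-algebra of everything but the values of `j`. -/
@[reducible]
def otherSigma {N : ℕ} {Ω : Type*} (E : Ω → EventSeq N) (j : Fin N) : MeasurableSpace Ω :=
  sourcesSigma E {s | ∀ n, s ≠ Sum.inr (j, n)}

lemma clocksSigma_le_otherSigma {N : ℕ} {Ω : Type*} (E : Ω → EventSeq N) (j : Fin N) :
    clocksSigma E ≤ otherSigma E j :=
  biSup_mono fun s hs n => by
    obtain ⟨c, rfl⟩ := hs
    simp

lemma measurable_eval_index {Ω : Type*} [MeasurableSpace Ω] {V : ℕ → Ω → ℝ}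
    (hV : ∀ n, Measurable (V n)) {c : Ω → ℕ} (hc : Measurable c) :
    Measurable fun ω => V (c ω) ω := by
  have h1 : Measurable fun q : Ω × ℕ => V q.2 q.1 :=
    measurable_from_prod_countable_left fun n => hV n
  exact h1.comp (measurable_id.prodMk hc)

lemma measurable_val_otherSigma {N : ℕ} {Ω : Type*} {E : Ω → EventSeq N} {j j' : Fin N}
    (hj : j' ≠ j) {c : Ω → ℕ} (hc : Measurable[clocksSigma E] c) :
    Measurable[otherSigma E j] fun ω => (E ω).val j' (c ω) := by
  have h1 : ∀ n, Measurable[otherSigma E j] fun ω => (E ω).val j' n := fun n =>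
    (measurable_val_sourceSigma E j' n).mono (sourceSigma_le_sourcesSigma E (by
      intro k hk
      exact hj (Prod.mk.inj (Sum.inr_injective hk)).1)) le_rfl
  exact @measurable_eval_index Ω (otherSigma E j) _ h1 _
    (hc.mono (clocksSigma_le_otherSigma E j) le_rfl)

section Model

variable {N : ℕ} {lamR lamC : ℝ} {Ω : Type*} {m : MeasurableSpace Ω} [mΩ : MeasurableSpace Ω]
  {μ : Measure Ω} {ν : Measure ℝ} {E : Ω → EventSeq N}

lemma IsGossipModel.measurableClocks (h : IsGossipModel μ lamR lamC ν E)
    (hm : clocksSigma E ≤ m) : @MeasurableClocks N Ω m E := by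
  refine @measurableClocks_of_clock N Ω m _ h.exch_symm h.exch_self fun c => ?_
  refine (h.poissonClock c).isMeasurableClock ?_
  rw [← sourceSigma_inl]
  exact (sourceSigma_le_sourcesSigma E (P := Set.range Sum.inl) (Set.mem_range_self c)).trans hm

/-- The value of `j` at a random index determined by the clocks. -/
lemma IsGossipModel.val_random_index [IsProbabilityMeasure μ] (h : IsGossipModel μ lamR lamC ν E)
    (j : Fin N) {c : Ω → ℕ} (hc : Measurable[clocksSigma E] c) :
    Measurable (fun ω => (E ω).val j (c ω)) ∧ μ.map (fun ω => (E ω).val j (c ω)) = ν ∧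
      Indep (MeasurableSpace.comap (fun ω => (E ω).val j (c ω)) inferInstance)
        (otherSigma E j) μ := by
  refine indep_random_index (V := fun n ω => (E ω).val j n) (h.sourcesSigma_le _)
    (h.measurable_val j) (h.law_val j) (fun n => ?_) (hc.mono (clocksSigma_le_otherSigma E j) le_rfl)
  refine indep_of_indep_of_le_left (h.indep_source (Sum.inr (j, n)) ?_)
    (measurable_val_sourceSigma E j n).comap_le
  exact fun hs => hs n rfl

lemma memLp_two_of_abs_le {f g : Ω → ℝ} (hf : Measurable f) (hg : MemLp g 2 μ)
    (h : ∀ ω, |f ω| ≤ |g ω|) : MemLp f 2 μ :=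
  hg.mono hf.aestronglyMeasurable (Filter.Eventually.of_forall h)

lemma IsGossipModel.memLp_val [IsProbabilityMeasure μ] (h : IsGossipModel μ lamR lamC ν E)
    (hν : MemLp (fun x : ℝ => x) 2 ν) (j : Fin N) {c : Ω → ℕ} (hc : Measurable[clocksSigma E] c) :
    MemLp (fun ω => (E ω).val j (c ω)) 2 μ := by
  obtain ⟨h1, h2, -⟩ := h.val_random_index j hc
  rw [← h2] at hν
  exact (memLp_map_measure_iff measurable_id.aestronglyMeasurable h1.aemeasurable).1 hν

/-- Linear combinations of values with coefficients and indices that are determined by the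
clocks. -/
theorem IsGossipModel.integral_sq_sum [IsProbabilityMeasure μ] (h : IsGossipModel μ lamR lamC ν E)
    {σ : ℝ} (hν : MemLp (fun x : ℝ => x) 2 ν) (hν1 : ∫ x, x ∂ν = 0) (hν2 : ∫ x, x ^ 2 ∂ν = σ ^ 2)
    {ψ : Fin N → Ω → ℝ} {c : Fin N → Ω → ℕ} (hψ : ∀ j, Measurable[clocksSigma E] (ψ j))
    (hψ1 : ∀ j ω, |ψ j ω| ≤ 1) (hc : ∀ j, Measurable[clocksSigma E] (c j)) :
    ∫ ω, (∑ j, ψ j ω * (E ω).val j (c j ω)) ^ 2 ∂μ = σ ^ 2 * ∑ j, ∫ ω, ψ j ω ^ 2 ∂μ := by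
  have hcl := h.sourcesSigma_le (Set.range Sum.inl)
  have hψm : ∀ j, Measurable (ψ j) := fun j => (hψ j).mono hcl le_rfl
  have hV := fun j => h.val_random_index j (hc j)
  have hL : ∀ j, MemLp (fun ω => ψ j ω * (E ω).val j (c j ω)) 2 μ := fun j =>
    memLp_two_of_abs_le ((hψm j).mul (hV j).1) (h.memLp_val hν j (hc j)) fun ω => by
      rw [abs_mul]
      exact mul_le_of_le_one_left (abs_nonneg _) (hψ1 j ω)
  have hint : ∀ j j', Integrable (fun ω => (ψ j ω * (E ω).val j (c j ω)) *
      (ψ j' ω * (E ω).val j' (c j' ω))) μ := fun j j' => (hL j).integrable_mul (hL j')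
  have hexp : ∀ ω, (∑ j, ψ j ω * (E ω).val j (c j ω)) ^ 2 = ∑ j, ∑ j',
      (ψ j ω * (E ω).val j (c j ω)) * (ψ j' ω * (E ω).val j' (c j' ω)) := by
    intro ω
    rw [sq, Finset.sum_mul_sum]
  simp_rw [hexp]
  rw [integral_finsetSum _ fun j _ => integrable_finsetSum _ fun j' _ => hint j j', Finset.mul_sum]
  refine Finset.sum_congr rfl fun j _ => ?_
  rw [integral_finsetSum _ fun j' _ => hint j j', Finset.sum_eq_single j]
  · have hψσ : Measurable[otherSigma E j] fun ω => ψ j ω ^ 2 :=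
      ((hψ j).mono (clocksSigma_le_otherSigma E j) le_rfl).pow_const 2
    have hind : IndepFun (fun ω => (E ω).val j (c j ω) ^ 2) (fun ω => ψ j ω ^ 2) μ :=
      indepFun_of_measurable (hV j).2.2
        (Measurable.pow_const (comap_measurable fun ω => (E ω).val j (c j ω)) 2) hψσ
    have hprod := hind.integral_fun_mul_eq_mul_integral
      ((hV j).1.pow_const 2).aestronglyMeasurable ((hψm j).pow_const 2).aestronglyMeasurable
    have hsq : ∫ ω, (E ω).val j (c j ω) ^ 2 ∂μ = σ ^ 2 := by
      rw [← hν2]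
      conv_rhs => rw [← (hV j).2.1]
      exact (integral_map (hV j).1.aemeasurable
        (measurable_id.pow_const 2).aestronglyMeasurable).symm
    rw [hsq] at hprod
    rw [← hprod]
    refine integral_congr_ae (Filter.Eventually.of_forall fun ω => ?_)
    ring
  · intro j' _ hj
    have hQ : Measurable[otherSigma E j] fun ω =>
        ψ j ω * (ψ j' ω * (E ω).val j' (c j' ω)) :=
      ((hψ j).mono (clocksSigma_le_otherSigma E j) le_rfl).mul
        (((hψ j').mono (clocksSigma_le_otherSigma E j) le_rfl).mul
          (measurable_val_otherSigma hj (hc j')))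
    have hind : IndepFun (fun ω => (E ω).val j (c j ω))
        (fun ω => ψ j ω * (ψ j' ω * (E ω).val j' (c j' ω))) μ :=
      indepFun_of_measurable (hV j).2.2 (comap_measurable _) hQ
    have hprod := hind.integral_fun_mul_eq_mul_integral (hV j).1.aestronglyMeasurable
      (hQ.mono (h.sourcesSigma_le _) le_rfl).aestronglyMeasurable
    have hmean : ∫ ω, (E ω).val j (c j ω) ∂μ = 0 := by
      rw [← hν1]
      conv_rhs => rw [← (hV j).2.1]
      exact (integral_map (hV j).1.aemeasurable measurable_id.aestronglyMeasurable).symm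
    rw [hmean, zero_mul] at hprod
    rw [← hprod]
    refine integral_congr_ae (Filter.Eventually.of_forall fun ω => ?_)
    ring
  · simp

end Model

namespace EventSeq

variable {N : ℕ}

open Classical in
/-- The number of time intervals of length `δ`, counted back from time `t` and at most `n`, in
which `j` has sent out no information that `i` holds at time `t`. -/
def stage (e : EventSeq N) (j i : Fin N) (δ t : ℝ) (n : ℕ) : ℕ :=
  Nat.find (⟨n, Or.inl rfl⟩ : ∃ k : ℕ, k = n ∨ e.Reach j (t - ((k : ℝ) + 1) * δ) i t)

lemma stage_le (e : EventSeq N) (j i : Fin N) (δ t : ℝ) (n : ℕ) : e.stage j i δ t n ≤ n := by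
  classical
  exact Nat.find_min' _ (Or.inl rfl)

lemma stage_le_iff (e : EventSeq N) (j i : Fin N) {δ : ℝ} (hδ : 0 ≤ δ) (t : ℝ) {n k : ℕ}
    (hk : k < n) : e.stage j i δ t n ≤ k ↔ e.Reach j (t - ((k : ℝ) + 1) * δ) i t := by
  classical
  constructor
  · intro h
    have h1 := Nat.find_spec
      (⟨n, Or.inl rfl⟩ : ∃ k : ℕ, k = n ∨ e.Reach j (t - ((k : ℝ) + 1) * δ) i t)
    change e.stage j i δ t n = n ∨ e.Reach j (t - ((e.stage j i δ t n : ℝ) + 1) * δ) i t at h1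
    rcases h1 with h1 | h1
    · omega
    · refine h1.mono ?_
      have : ((e.stage j i δ t n : ℝ)) ≤ k := by exact_mod_cast h
      nlinarith
  · intro h
    exact Nat.find_min' _ (Or.inr h)

lemma stage_eq_iff (e : EventSeq N) (j i : Fin N) {δ : ℝ} (hδ : 0 ≤ δ) (t : ℝ) {n k : ℕ}
    (hk : k ≤ n) : e.stage j i δ t n = k ↔
      ¬ e.Reach j (t - k * δ) i t ∧ (k = n ∨ e.Reach j (t - ((k : ℝ) + 1) * δ) i t) := by
  have h1 : (¬ e.Reach j (t - k * δ) i t) ↔ k ≤ e.stage j i δ t n := by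
    rcases k with _ | k
    · simp only [Nat.cast_zero, zero_mul, sub_zero, Nat.zero_le, iff_true]
      exact fun h => absurd h.lt (lt_irrefl _)
    · have := e.stage_le_iff j i hδ t (show k < n by omega)
      push_cast
      rw [← this]
      omega
  have h2 : (k = n ∨ e.Reach j (t - ((k : ℝ) + 1) * δ) i t) ↔ e.stage j i δ t n ≤ k := by
    rcases hk.eq_or_lt with rfl | hlt
    · simp [e.stage_le j i δ t k]
    · rw [← e.stage_le_iff j i hδ t hlt]
      exact or_iff_right hlt.ne
  rw [h1, h2]
  omega

lemma pow_stage_eq (e : EventSeq N) (j i : Fin N) {δ : ℝ} (hδ : 0 ≤ δ) (t : ℝ) (n : ℕ) (r : ℝ) :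
    r ^ e.stage j i δ t n = r ^ n + ∑ k ∈ Finset.range n, (r ^ k - r ^ (k + 1)) *
      ({x : EventSeq N | x.Reach j (t - ((k : ℝ) + 1) * δ) i t}.indicator 1 e) := by
  set s := e.stage j i δ t n with hs
  have hsn : s ≤ n := e.stage_le j i δ t n
  have h1 : ∀ k ∈ Finset.range n, (r ^ k - r ^ (k + 1)) *
      ({x : EventSeq N | x.Reach j (t - ((k : ℝ) + 1) * δ) i t}.indicator 1 e)
      = if s ≤ k then r ^ k - r ^ (k + 1) else 0 := by
    intro k hk
    have h2 := e.stage_le_iff j i hδ t (Finset.mem_range.1 hk)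
    by_cases h3 : e.Reach j (t - ((k : ℝ) + 1) * δ) i t
    · rw [if_pos (h2.2 h3), Set.indicator_of_mem (by exact h3)]; simp
    · rw [if_neg fun h4 => h3 (h2.1 h4), Set.indicator_of_notMem (by exact h3)]; simp
  rw [Finset.sum_congr rfl h1, ← Finset.sum_filter]
  have h2 : (Finset.range n).filter (fun k => s ≤ k) = Finset.Ico s n := by
    ext k; simp; tauto
  rw [h2, Finset.sum_Ico_eq_sub _ hsn, Finset.sum_range_sub', Finset.sum_range_sub']
  ring

end EventSeq

section Model

variable {N : ℕ} {lamR lamC : ℝ} {Ω : Type*} [mΩ : MeasurableSpace Ω]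
  {μ : Measure Ω} {ν : Measure ℝ} {E : Ω → EventSeq N}

lemma MeasurableClocks.measurable_stage (hE : MeasurableClocks E) (j i : Fin N) {δ : ℝ}
    (hδ : 0 ≤ δ) (t : ℝ) (n : ℕ) : Measurable fun ω => (E ω).stage j i δ t n := by
  refine measurable_to_countable' fun k => ?_
  by_cases hk : k ≤ n
  · have : (fun ω => (E ω).stage j i δ t n) ⁻¹' {k} = {ω | (E ω).Reach j (t - k * δ) i t}ᶜ ∩
        ({_ω | k = n} ∪ {ω | (E ω).Reach j (t - ((k : ℝ) + 1) * δ) i t}) := by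
      ext ω
      exact (E ω).stage_eq_iff j i hδ t hk
    rw [this]
    exact (hE.measurableSet_reach _ _ _ _).compl.inter
      ((MeasurableSet.const _).union (hE.measurableSet_reach _ _ _ _))
  · have : (fun ω => (E ω).stage j i δ t n) ⁻¹' {k} = ∅ := by
      ext ω
      simp only [Set.mem_preimage, Set.mem_singleton_iff, Set.mem_empty_iff_false, iff_false]
      exact fun h => hk (h ▸ (E ω).stage_le j i δ t n)
    rw [this]
    exact MeasurableSet.empty

lemma MeasurableClocks.measurable_tickCount_stage (hE : MeasurableClocks E) (j i : Fin N) {δ : ℝ}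
    (hδ : 0 ≤ δ) (t : ℝ) (n : ℕ) :
    Measurable fun ω => tickCount ((E ω).repl j) 0 (t - (E ω).stage j i δ t n * δ) := by
  have h1 : Measurable fun ω => t - ((E ω).stage j i δ t n : ℝ) * δ :=
    measurable_const.sub ((Measurable.of_discrete (f := fun k : ℕ => (k : ℝ))).comp
      (hE.measurable_stage j i hδ t n) |>.mul_const δ)
  exact (hE.repl j).measurable_tickCount_prod.comp (measurable_id.prodMk h1)

end Model

lemma measurable_tickCount_clocksSigma {N : ℕ} {Ω : Type*} (E : Ω → EventSeq N) (j : Fin N) (t : ℝ) :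
    Measurable[clocksSigma E] fun ω => tickCount ((E ω).repl j) 0 t :=
  (measurable_tickCount_clockSigma (fun ω => (E ω).repl j) 0 t).mono
    (sourceSigma_le_sourcesSigma E (P := Set.range Sum.inl) (s := Sum.inl (Sum.inl j))
      (Set.mem_range_self _)) le_rfl

section Model

variable {N : ℕ} {lamR lamC : ℝ} {Ω : Type*} [MeasurableSpace Ω] {μ : Measure Ω}
  {ν : Measure ℝ} {E : Ω → EventSeq N}

lemma IsGossipModel.memLp_value [IsProbabilityMeasure μ] (h : IsGossipModel μ lamR lamC ν E)
    (hν : MemLp (fun x : ℝ => x) 2 ν) (j : Fin N) (t : ℝ) :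
    MemLp (fun ω => (E ω).value j t) 2 μ :=
  h.memLp_val hν j (measurable_tickCount_clocksSigma E j t)

lemma EventSeq.window_stage (e : EventSeq N) (φ : Set (Info N) → ℝ) (j i : Fin N) {δ : ℝ}
    (hδ : 0 ≤ δ) (t : ℝ) {n k : ℕ} (hk : k ≤ n) :
    e.window φ j i (t - k * δ) (t - ((k : ℝ) + 1) * δ) t (k = n)
      = if e.stage j i δ t n = k then φ (e.knowledge i t) else 0 := by
  have hs := e.stage_eq_iff j i hδ t hk
  unfold EventSeq.window
  by_cases h : e.stage j i δ t n = k
  · rw [if_pos (hs.1 h), if_pos h]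
  · rw [if_neg (mt hs.2 h), if_neg h]

/-- The value of `j` has the same correlation with every estimate computed by `i` as the value of
`j` at the last time of the grid about which `i` may have information, suitably discounted. -/
theorem IsGossipModel.integral_value_mul [IsProbabilityMeasure μ]
    (h : IsGossipModel μ lamR lamC ν E) (hr : 0 < lamR) (hν : MemLp (fun x : ℝ => x) 2 ν)
    (hν1 : ∫ x, x ∂ν = 0) (j i : Fin N) {δ : ℝ} (hδ : 0 ≤ δ) (n : ℕ) {t : ℝ} (ht : t = n * δ)
    {φ : Set (Info N) → ℝ} (hφ : Measurable[knowledgeSigma N] φ)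
    (hY : MemLp (fun ω => φ ((E ω).knowledge i t)) 2 μ) :
    ∫ ω, (E ω).value j t * φ ((E ω).knowledge i t) ∂μ
      = ∫ ω, (Real.exp (-(lamR * δ)) ^ (E ω).stage j i δ t n *
          (E ω).value j (t - (E ω).stage j i δ t n * δ)) * φ ((E ω).knowledge i t) ∂μ := by
  have hE := h.measurableClocks (h.sourcesSigma_le _)
  set W : ℕ → Ω → ℝ := fun k ω =>
    (E ω).window φ j i (t - k * δ) (t - ((k : ℝ) + 1) * δ) t (k = n) with hW
  have hWeq : ∀ k ≤ n, ∀ ω, W k ω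
      = if (E ω).stage j i δ t n = k then φ ((E ω).knowledge i t) else 0 := fun k hk ω =>
    (E ω).window_stage φ j i hδ t hk
  have hWL : ∀ k ≤ n, MemLp (W k) 2 μ := fun k hk =>
    memLp_two_of_abs_le (hE.measurable_window h.measurable_val hφ j i _ _ t _) hY fun ω => by
      rw [hWeq k hk]
      split_ifs
      · exact le_rfl
      · simp
  have hint : ∀ k ≤ n, ∀ v, Integrable (fun ω => (E ω).value j v * W k ω) μ := fun k hk v =>
    (h.memLp_value hν j v).integrable_mul (hWL k hk)
  have hsum : ∀ (G : ℕ → Ω → ℝ) ω, G ((E ω).stage j i δ t n) ω * φ ((E ω).knowledge i t)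
      = ∑ k ∈ Finset.range (n + 1), G k ω * W k ω := by
    intro G ω
    rw [Finset.sum_eq_single ((E ω).stage j i δ t n)]
    · rw [hWeq _ ((E ω).stage_le j i δ t n), if_pos rfl]
    · intro k hk hne
      rw [hWeq k (Nat.lt_succ_iff.1 (Finset.mem_range.1 hk)), if_neg (Ne.symm hne), mul_zero]
    · intro hk
      exact absurd (Finset.mem_range.2 (Nat.lt_succ_of_le ((E ω).stage_le j i δ t n))) hk
  simp_rw [hsum fun _ ω => (E ω).value j t,
    hsum fun k ω => Real.exp (-(lamR * δ)) ^ k * (E ω).value j (t - k * δ), mul_assoc]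
  rw [integral_finsetSum _ fun k hk => hint k (Nat.lt_succ_iff.1 (Finset.mem_range.1 hk)) _,
    integral_finsetSum _ fun k hk =>
      (hint k (Nat.lt_succ_iff.1 (Finset.mem_range.1 hk)) _).const_mul _]
  refine Finset.sum_congr rfl fun k hk => ?_
  have hk' : k ≤ n := Nat.lt_succ_iff.1 (Finset.mem_range.1 hk)
  have hkn : (k : ℝ) ≤ n := by exact_mod_cast hk'
  rw [integral_const_mul, h.integral_value_mul_window hr hν1 (by nlinarith)
    (by nlinarith [(Nat.cast_nonneg k : (0 : ℝ) ≤ k)]) hφ _ (hint k hk' _) (hint k hk' _),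
    ← Real.exp_nat_mul]
  congr 2
  ring

lemma integral_sq_sub_le {X Y m : Ω → ℝ} (hX : MemLp X 2 μ) (hY : MemLp Y 2 μ) (hm : MemLp m 2 μ)
    (h : ∫ ω, X ω * Y ω ∂μ = ∫ ω, m ω * Y ω ∂μ) :
    ∫ ω, X ω ^ 2 ∂μ - ∫ ω, m ω ^ 2 ∂μ ≤ ∫ ω, (X ω - Y ω) ^ 2 ∂μ := by
  have hexp : ∀ Z : Ω → ℝ, MemLp Z 2 μ → ∫ ω, (Z ω - Y ω) ^ 2 ∂μ
      = ∫ ω, Z ω ^ 2 ∂μ - 2 * ∫ ω, Z ω * Y ω ∂μ + ∫ ω, Y ω ^ 2 ∂μ := by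
    intro Z hZ
    have hZY : Integrable (fun ω => 2 * (Z ω * Y ω)) μ := (hZ.integrable_mul hY).const_mul 2
    have hd : Integrable (fun ω => Z ω ^ 2 - 2 * (Z ω * Y ω)) μ := hZ.integrable_sq.sub hZY
    rw [← integral_const_mul, ← integral_sub hZ.integrable_sq hZY,
      ← integral_add hd hY.integrable_sq]
    exact integral_congr_ae (Filter.Eventually.of_forall fun ω => by simp only; ring)
  have h1 := hexp X hX
  have h2 := hexp m hm
  have h3 : 0 ≤ ∫ ω, (m ω - Y ω) ^ 2 ∂μ := integral_nonneg fun ω => sq_nonneg _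
  linarith

/-- The mean squared error of an estimate that agent `i` computes from its knowledge set. -/
theorem IsGossipModel.le_lintegral_sq_error [IsProbabilityMeasure μ]
    (h : IsGossipModel μ lamR lamC ν E) (hr : 0 < lamR) {σ : ℝ}
    (hν : MemLp (fun x : ℝ => x) 2 ν) (hν1 : ∫ x, x ∂ν = 0) (hν2 : ∫ x, x ^ 2 ∂ν = σ ^ 2)
    (i : Fin N) {δ : ℝ} (hδ : 0 ≤ δ) (n : ℕ) {t : ℝ} (ht : t = n * δ)
    {φ : Set (Info N) → ℝ} (hφ : Measurable[knowledgeSigma N] φ) :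
    ENNReal.ofReal (σ ^ 2 / (N : ℝ) ^ 2 *
        ∑ j, (1 - ∫ ω, Real.exp (-(2 * lamR * δ)) ^ (E ω).stage j i δ t n ∂μ))
      ≤ ∫⁻ ω, ENNReal.ofReal (((E ω).average t - φ ((E ω).knowledge i t)) ^ 2) ∂μ := by
  have hE := h.measurableClocks (h.sourcesSigma_le _)
  have hEc : @MeasurableClocks N Ω (clocksSigma E) E := h.measurableClocks le_rfl
  have hXL : MemLp (fun ω => (E ω).average t) 2 μ :=
    (memLp_finsetSum _ fun j _ => h.memLp_value hν j t).const_mul (1 / (N : ℝ))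
  have hYm : Measurable fun ω => φ ((E ω).knowledge i t) :=
    hφ.comp (hE.measurable_knowledge h.measurable_val i t)
  by_cases hfin : ∫⁻ ω, ENNReal.ofReal (((E ω).average t - φ ((E ω).knowledge i t)) ^ 2) ∂μ = ⊤
  · rw [hfin]
    exact le_top
  have hZm : AEStronglyMeasurable (fun ω => (E ω).average t - φ ((E ω).knowledge i t)) μ :=
    hXL.1.sub hYm.aestronglyMeasurable
  have hZi : Integrable (fun ω => ((E ω).average t - φ ((E ω).knowledge i t)) ^ 2) μ :=
    ⟨hZm.pow 2, (hasFiniteIntegral_iff_ofReal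
      (Filter.Eventually.of_forall fun ω => sq_nonneg _)).2 (lt_top_iff_ne_top.2 hfin)⟩
  have hZL : MemLp (fun ω => (E ω).average t - φ ((E ω).knowledge i t)) 2 μ :=
    (memLp_two_iff_integrable_sq hZm).2 hZi
  have hY : MemLp (fun ω => φ ((E ω).knowledge i t)) 2 μ := by
    have := hXL.sub hZL
    simpa [Pi.sub_def] using this
  rw [← ofReal_integral_eq_lintegral_ofReal hZi (Filter.Eventually.of_forall fun ω => sq_nonneg _)]
  refine ENNReal.ofReal_le_ofReal ?_
  set ρ := Real.exp (-(lamR * δ)) with hρ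
  have hρ1 : ρ ≤ 1 := Real.exp_le_one_iff.2 (by nlinarith)
  have hρ0 : 0 ≤ ρ := (Real.exp_pos _).le
  have hψ : ∀ j, Measurable[clocksSigma E] fun ω => ρ ^ (E ω).stage j i δ t n := fun j =>
    (Measurable.of_discrete (f := fun k : ℕ => ρ ^ k)).comp
      (@MeasurableClocks.measurable_stage N Ω (clocksSigma E) E hEc j i δ hδ t n)
  have hψ1 : ∀ j ω, |ρ ^ (E ω).stage j i δ t n| ≤ 1 := fun j ω => by
    rw [abs_of_nonneg (pow_nonneg hρ0 _)]
    exact pow_le_one₀ hρ0 hρ1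
  have hc : ∀ j, Measurable[clocksSigma E] fun ω =>
      tickCount ((E ω).repl j) 0 (t - (E ω).stage j i δ t n * δ) := fun j =>
    @MeasurableClocks.measurable_tickCount_stage N Ω (clocksSigma E) E hEc j i δ hδ t n
  have hmL : ∀ j, MemLp (fun ω => ρ ^ (E ω).stage j i δ t n *
      (E ω).value j (t - (E ω).stage j i δ t n * δ)) 2 μ := fun j =>
    memLp_two_of_abs_le (((hψ j).mono (h.sourcesSigma_le _) le_rfl).mul
      (h.val_random_index j (hc j)).1) (h.memLp_val hν j (hc j)) fun ω => by
      rw [abs_mul]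
      exact mul_le_of_le_one_left (abs_nonneg _) (hψ1 j ω)
  have hXY : ∀ j, Integrable (fun ω => (E ω).value j t * φ ((E ω).knowledge i t)) μ := fun j =>
    (h.memLp_value hν j t).integrable_mul hY
  have hmY : ∀ j, Integrable (fun ω => (ρ ^ (E ω).stage j i δ t n *
      (E ω).value j (t - (E ω).stage j i δ t n * δ)) * φ ((E ω).knowledge i t)) μ := fun j =>
    (hmL j).integrable_mul hY
  have hmain := integral_sq_sub_le hXL hY
    ((memLp_finsetSum Finset.univ fun j _ => hmL j).const_mul (1 / (N : ℝ))) (by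
      simp only [EventSeq.average, mul_assoc (1 / (N : ℝ)), integral_const_mul, Finset.sum_mul]
      rw [integral_finsetSum _ fun j _ => hXY j, integral_finsetSum _ fun j _ => hmY j]
      congr 1
      exact Finset.sum_congr rfl fun j _ => h.integral_value_mul hr hν hν1 j i hδ n ht hφ hY)
  refine le_trans (le_of_eq ?_) hmain
  have hX2 : ∫ ω, (E ω).average t ^ 2 ∂μ = σ ^ 2 / (N : ℝ) ^ 2 * N := by
    have := h.integral_sq_sum hν hν1 hν2 (ψ := fun _ _ => 1) (fun j => measurable_const)
      (fun j ω => by simp)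
      fun j => measurable_tickCount_clocksSigma E j t
    simp only [EventSeq.average, mul_pow, integral_const_mul]
    simp only [one_mul, one_pow, integral_const, probReal_univ, smul_eq_mul, mul_one,
      Finset.sum_const, Finset.card_univ, Fintype.card_fin, nsmul_eq_mul] at this
    rw [show ∫ ω, (∑ j, (E ω).value j t) ^ 2 ∂μ = σ ^ 2 * N from this]
    ring
  have hm2 := h.integral_sq_sum hν hν1 hν2 hψ hψ1 hc
  have hm2' : ∫ ω, (1 / (N : ℝ) * ∑ j, ρ ^ (E ω).stage j i δ t n *
      (E ω).value j (t - (E ω).stage j i δ t n * δ)) ^ 2 ∂μ = σ ^ 2 / (N : ℝ) ^ 2 *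
        ∑ j, ∫ ω, Real.exp (-(2 * lamR * δ)) ^ (E ω).stage j i δ t n ∂μ := by
    simp only [mul_pow, integral_const_mul]
    rw [show ∫ ω, (∑ j, ρ ^ (E ω).stage j i δ t n *
      (E ω).value j (t - (E ω).stage j i δ t n * δ)) ^ 2 ∂μ = _ from hm2]
    have hρr : ρ ^ 2 = Real.exp (-(2 * lamR * δ)) := by
      rw [hρ, ← Real.exp_nat_mul]; congr 1; push_cast; ring
    simp only [← hρr, ← pow_mul, mul_comm 2]
    ring
  rw [hX2, hm2', Finset.sum_sub_distrib]
  simp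
  ring

end Model

lemma measurable_slotChain {N : ℕ} {Ω : Type*} [MeasurableSpace Ω] (j : Fin N)
    {X : ℕ → Ω → Source N → ℕ} (hX : ∀ m, Measurable (X m)) (m : ℕ) :
    Measurable fun ω => slotChain j (fun m => X m ω) m := by
  induction m with
  | zero => exact measurable_const
  | succ m ih => exact measurable_finset_comp₂ (slotUpdate j) ih (hX m)

lemma tendsto_expm1_div (a : ℝ) :
    Filter.Tendsto (fun δ : ℝ => δ⁻¹ * (Real.exp (a * δ) - 1)) (nhdsWithin 0 {0}ᶜ) (nhds a) := by
  have h1 : HasDerivAt (fun δ : ℝ => Real.exp (a * δ)) (Real.exp (a * 0) * (a * 1)) 0 :=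
    ((hasDerivAt_id (0 : ℝ)).const_mul a).exp
  have h2 := h1.tendsto_slope_zero
  simpa using h2

section Model

variable {N : ℕ} {lamR lamC : ℝ} {Ω : Type*} [MeasurableSpace Ω] {μ : Measure Ω}
  {ν : Measure ℝ} {E : Ω → EventSeq N}

/-- The expected number of agents that hold information about `j` of age less than
`(k + 1) * δ`. -/
theorem IsGossipModel.sum_measureReal_reach_le [IsProbabilityMeasure μ]
    (h : IsGossipModel μ lamR lamC ν E) (hN : 2 ≤ N) (hr : 0 < lamR) (hc : 0 < lamC) (j : Fin N)
    {δ : ℝ} (hδ : 0 ≤ δ) {t : ℝ} (k : ℕ) (hk : ((k : ℝ) + 1) * δ ≤ t) :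
    ∑ i, μ.real {ω | (E ω).Reach j (t - ((k : ℝ) + 1) * δ) i t}
      ≤ 1 + ((N : ℝ) - 1) * (stepOp N lamR lamC j δ ^ (k + 1)) (otherShare N) {j} := by
  classical
  have hE := h.measurableClocks (h.sourcesSigma_le _)
  have hN' : (2 : ℝ) ≤ N := by exact_mod_cast hN
  set s : ℕ → ℝ := fun m => t - ((k : ℝ) + 1) * δ + m * δ with hs
  have hs0 : s 0 = t - ((k : ℝ) + 1) * δ := by simp [hs]
  have hsk : s (k + 1) = t := by simp only [hs]; push_cast; ring
  have hsδ : ∀ m, s (m + 1) - s m = δ := fun m => by simp only [hs]; push_cast; ring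
  have hsm : Monotone s := monotone_nat_of_le_succ fun m => by linarith [hsδ m]
  set U : Ω → Finset (Fin N) := fun ω =>
    slotChain j (fun m c => tickCount ((E ω).clock c) (s m) (s (m + 1))) (k + 1) with hU
  have hUm : Measurable U := measurable_slotChain j (X := fun m ω c =>
    tickCount ((E ω).clock c) (s m) (s (m + 1)))
    (fun m => measurable_pi_lambda _ fun c => (h.poissonClock c).measurable_count _ _) (k + 1)
  have hcard : ∀ S : Finset (Fin N), j ∈ S → (S.card : ℝ) = 1 + ((N : ℝ) - 1) * otherShare N S := by
    intro S hS
    have h1 : 1 ≤ S.card := Finset.card_pos.2 ⟨j, hS⟩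
    rw [otherShare, Nat.cast_sub h1, mul_div_cancel₀ _ (by linarith)]
    push_cast; ring
  have hmeas : ∀ i, MeasurableSet {ω | (E ω).Reach j (s 0) i (s (k + 1))} := fun i =>
    hE.measurableSet_reach j _ i _
  have hle : ∀ ω, ∑ i, ({ω | (E ω).Reach j (s 0) i (s (k + 1))} : Set Ω).indicator
      (1 : Ω → ℝ) ω ≤ (U ω).card := by
    intro ω
    have h1 := EventSeq.informed_subset_slotChain (e := E ω) (h.exch_symm ω) (h.exch_self ω)
      (fun c b => (h.poissonClock c).finite ω b) j hsm (k + 1)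
    have h2 : ∑ i, ({ω | (E ω).Reach j (s 0) i (s (k + 1))} : Set Ω).indicator (1 : Ω → ℝ) ω
        ≤ ∑ i, if i ∈ U ω then (1 : ℝ) else 0 := by
      refine Finset.sum_le_sum fun i _ => ?_
      by_cases hi : (E ω).Reach j (s 0) i (s (k + 1))
      · have h3 : i ∈ U ω := h1 (EventSeq.mem_informed.2 (Or.inr hi))
        simp [Set.indicator, hi, h3]
      · simp only [Set.indicator, Set.mem_ofPred_eq, hi, if_false]
        split_ifs <;> norm_num
    refine h2.trans (le_of_eq ?_)
    simp
  have hint : ∀ i, Integrable (({ω | (E ω).Reach j (s 0) i (s (k + 1))} : Set Ω).indicator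
      (1 : Ω → ℝ)) μ := fun i => (integrable_const 1).indicator (hmeas i)
  calc ∑ i, μ.real {ω | (E ω).Reach j (t - ((k : ℝ) + 1) * δ) i t}
      = ∑ i, ∫ ω, ({ω | (E ω).Reach j (s 0) i (s (k + 1))} : Set Ω).indicator
        (1 : Ω → ℝ) ω ∂μ := by
        refine Finset.sum_congr rfl fun i _ => ?_
        rw [integral_indicator_one (hmeas i), hs0, hsk]
    _ = ∫ ω, ∑ i, ({ω | (E ω).Reach j (s 0) i (s (k + 1))} : Set Ω).indicator
        (1 : Ω → ℝ) ω ∂μ := (integral_finsetSum _ fun i _ => hint i).symm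
    _ ≤ ∫ ω, 1 + ((N : ℝ) - 1) * otherShare N (U ω) ∂μ := by
        refine integral_mono (integrable_finsetSum _ fun i _ => hint i)
          (integrable_finset_comp hUm fun S => 1 + ((N : ℝ) - 1) * otherShare N S) fun ω => ?_
        exact (hle ω).trans (hcard _ (mem_slotChain j _ _)).le
    _ = 1 + ((N : ℝ) - 1) * (stepOp N lamR lamC j δ ^ (k + 1)) (otherShare N) {j} := by
        rw [integral_add (integrable_const 1)
          ((integrable_finset_comp hUm (otherShare N)).const_mul _), integral_const_mul,
          h.integral_slotChain hN hr hc j hδ (by rw [hs0]; linarith) hsδ (k + 1) (otherShare N)]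
        simp

/-- Summed over the agents, the discounted freshness of the information about `j`. -/
theorem IsGossipModel.sum_integral_pow_stage_le [IsProbabilityMeasure μ]
    (h : IsGossipModel μ lamR lamC ν E) (hN : 2 ≤ N) (hr : 0 < lamR) (hc : 0 < lamC) (j : Fin N)
    {δ : ℝ} (hδ : 0 ≤ δ) (n : ℕ) {t : ℝ} (ht : t = n * δ) {r : ℝ} (hr0 : 0 ≤ r) (hr1 : r ≤ 1) :
    ∑ i, ∫ ω, r ^ (E ω).stage j i δ t n ∂μ ≤ N * r ^ n + 1 + ((N : ℝ) - 1) * ((1 - r) *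
      ∑ k ∈ Finset.range n, r ^ k * (stepOp N lamR lamC j δ ^ (k + 1)) (otherShare N) {j}) := by
  have hE := h.measurableClocks (h.sourcesSigma_le _)
  have hmeas : ∀ i (k : ℕ), MeasurableSet {ω | (E ω).Reach j (t - ((k : ℝ) + 1) * δ) i t} :=
    fun i k => hE.measurableSet_reach j _ i _
  have hd : ∀ k : ℕ, 0 ≤ r ^ k - r ^ (k + 1) := fun k =>
    sub_nonneg.2 (pow_le_pow_of_le_one hr0 hr1 (Nat.le_succ k))
  have h1 : ∀ i, ∫ ω, r ^ (E ω).stage j i δ t n ∂μ = r ^ n + ∑ k ∈ Finset.range n,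
      (r ^ k - r ^ (k + 1)) * μ.real {ω | (E ω).Reach j (t - ((k : ℝ) + 1) * δ) i t} := by
    intro i
    have hI : ∀ k : ℕ, Integrable (fun ω => (r ^ k - r ^ (k + 1)) *
        ({ω | (E ω).Reach j (t - ((k : ℝ) + 1) * δ) i t} : Set Ω).indicator (1 : Ω → ℝ) ω) μ :=
      fun k => ((integrable_const 1).indicator (hmeas i k)).const_mul _
    have h2 : ∀ ω, r ^ (E ω).stage j i δ t n = r ^ n + ∑ k ∈ Finset.range n,
        (r ^ k - r ^ (k + 1)) *
        ({ω | (E ω).Reach j (t - ((k : ℝ) + 1) * δ) i t} : Set Ω).indicator (1 : Ω → ℝ) ω :=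
      fun ω => (E ω).pow_stage_eq j i hδ t n r
    simp_rw [h2]
    rw [integral_add (integrable_const _) (integrable_finsetSum _ fun k _ => hI k),
      integral_finsetSum _ fun k _ => hI k]
    simp only [integral_const, probReal_univ, one_smul, integral_const_mul]
    simp_rw [integral_indicator_one (hmeas i _)]
  simp_rw [h1]
  rw [Finset.sum_add_distrib, Finset.sum_comm]
  simp only [Finset.sum_const, Finset.card_univ, Fintype.card_fin, nsmul_eq_mul,
    ← Finset.mul_sum]
  have h3 : ∑ k ∈ Finset.range n, (r ^ k - r ^ (k + 1)) *
      ∑ i, μ.real {ω | (E ω).Reach j (t - ((k : ℝ) + 1) * δ) i t}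
      ≤ ∑ k ∈ Finset.range n, ((r ^ k - r ^ (k + 1)) + ((N : ℝ) - 1) * ((1 - r) *
        (r ^ k * (stepOp N lamR lamC j δ ^ (k + 1)) (otherShare N) {j}))) := by
    refine Finset.sum_le_sum fun k hk => ?_
    have hkn : ((k : ℝ) + 1) ≤ n := by exact_mod_cast Finset.mem_range.1 hk
    have h4 := h.sum_measureReal_reach_le hN hr hc j hδ (t := t) k (by rw [ht]; gcongr)
    refine (mul_le_mul_of_nonneg_left h4 (hd k)).trans (le_of_eq ?_)
    ring
  have h5 : ∑ k ∈ Finset.range n, (r ^ k - r ^ (k + 1)) = 1 - r ^ n := by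
    rw [Finset.sum_range_sub']; simp
  rw [Finset.sum_add_distrib, h5, ← Finset.mul_sum, ← Finset.mul_sum] at h3
  have h6 : 0 ≤ r ^ n := pow_nonneg hr0 n
  linarith

lemma IsGossipModel.le_lintegral_squaredError [IsProbabilityMeasure μ]
    (h : IsGossipModel μ lamR lamC ν E) (hN : 2 ≤ N) (hr : 0 < lamR) {σ : ℝ}
    (hν : MemLp (fun x : ℝ => x) 2 ν) (hν1 : ∫ x, x ∂ν = 0) (hν2 : ∫ x, x ^ 2 ∂ν = σ ^ 2)
    {y : Fin N → ℝ → Set (Info N) → ℝ} (hy : ∀ i t, Measurable[knowledgeSigma N] (y i t))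
    {δ : ℝ} (hδ : 0 ≤ δ) (n : ℕ) {t : ℝ} (ht : t = n * δ) {R : ℝ}
    (hR : ∀ j, ∑ i, ∫ ω, Real.exp (-(2 * lamR * δ)) ^ (E ω).stage j i δ t n ∂μ ≤ R) :
    ENNReal.ofReal (σ ^ 2 / (N : ℝ) ^ 2 * (N - R))
      ≤ ∫⁻ ω, ENNReal.ofReal (squaredError y (E ω) t) ∂μ := by
  have hE := h.measurableClocks (h.sourcesSigma_le _)
  have hN' : (0 : ℝ) < N := by exact_mod_cast (by omega : 0 < N)
  have hm : ∀ i, AEMeasurable (fun ω => ENNReal.ofReal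
      (((E ω).average t - y i t ((E ω).knowledge i t)) ^ 2)) μ := fun i =>
    ((((memLp_finsetSum Finset.univ fun j _ => h.memLp_value hν j t).const_mul
      (1 / (N : ℝ))).1.aemeasurable.sub ((hy i t).comp
        (hE.measurable_knowledge h.measurable_val i t)).aemeasurable).pow_const 2).ennreal_ofReal
  have h1 : ∫⁻ ω, ENNReal.ofReal (squaredError y (E ω) t) ∂μ = ENNReal.ofReal (1 / (N : ℝ)) *
      ∑ i, ∫⁻ ω, ENNReal.ofReal (((E ω).average t - y i t ((E ω).knowledge i t)) ^ 2) ∂μ := by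
    rw [← lintegral_finsetSum' _ fun i _ => hm i, ← lintegral_const_mul' _ _ ENNReal.ofReal_ne_top]
    refine lintegral_congr fun ω => ?_
    rw [squaredError, ENNReal.ofReal_mul (by positivity),
      ENNReal.ofReal_sum_of_nonneg fun i _ => sq_nonneg _]
  have h2 := Finset.sum_le_sum fun i (_ : i ∈ Finset.univ) =>
    h.le_lintegral_sq_error hr hν hν1 hν2 i hδ n ht (hy i t)
  have h3 := (Finset.le_sum_of_subadditive ENNReal.ofReal ENNReal.ofReal_zero.le
    (fun x y => ENNReal.ofReal_add_le) Finset.univ _).trans h2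
  rw [h1]
  refine le_trans ?_ (mul_le_mul_right h3 _)
  rw [← ENNReal.ofReal_mul (by positivity)]
  refine ENNReal.ofReal_le_ofReal ?_
  rw [← Finset.mul_sum, Finset.sum_comm]
  have h4 : (N : ℝ) * (N - R) ≤ ∑ j, ∑ i,
      (1 - ∫ ω, Real.exp (-(2 * lamR * δ)) ^ (E ω).stage j i δ t n ∂μ) := by
    have h5 : ∀ j ∈ (Finset.univ : Finset (Fin N)), (N : ℝ) - R ≤ ∑ i,
      (1 - ∫ ω, Real.exp (-(2 * lamR * δ)) ^ (E ω).stage j i δ t n ∂μ) := by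
      intro j _
      rw [Finset.sum_sub_distrib]
      have := hR j
      simp only [Finset.sum_const, Finset.card_univ, Fintype.card_fin, nsmul_eq_mul, mul_one]
      linarith
    simpa using Finset.card_nsmul_le_sum Finset.univ _ _ h5
  calc σ ^ 2 / (N : ℝ) ^ 2 * (N - R)
      = 1 / (N : ℝ) * (σ ^ 2 / (N : ℝ) ^ 2 * ((N : ℝ) * (N - R))) := by field_simp
    _ ≤ _ := by gcongr

/-- No algorithm computed on the knowledge sets beats the bound in the limit. -/
theorem IsGossipModel.gossipBound_le_liminf [IsProbabilityMeasure μ]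
    (h : IsGossipModel μ lamR lamC ν E) (hN : 2 ≤ N) (hr : 0 < lamR) (hc : 0 < lamC) {σ : ℝ}
    (hν : MemLp (fun x : ℝ => x) 2 ν) (hν1 : ∫ x, x ∂ν = 0) (hν2 : ∫ x, x ^ 2 ∂ν = σ ^ 2)
    {y : Fin N → ℝ → Set (Info N) → ℝ} (hy : ∀ i t, Measurable[knowledgeSigma N] (y i t)) :
    ENNReal.ofReal (gossipBound N lamR lamC σ) ≤
      Filter.liminf (fun t : ℝ => ∫⁻ ω, ENNReal.ofReal (squaredError y (E ω) t) ∂μ)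
        Filter.atTop := by
  obtain ⟨g, hg, hbound⟩ := exists_gossip_potential hN hr hc
  obtain ⟨C, hC⟩ := discounted_sum_le hN hr hc hg
  have hN' : (2 : ℝ) ≤ N := by exact_mod_cast hN
  set d : ℝ → ℝ := fun t => t / ⌈t ^ 3⌉₊ with hd
  set L : ℝ → ℝ := fun t => σ ^ 2 / (N : ℝ) ^ 2 * (N - (N * Real.exp (-(2 * lamR * t)) + 1
    + ((N : ℝ) - 1) * (((d t)⁻¹ * (Real.exp (2 * lamR * d t) - 1)) * (g 0 +
      C * (Real.exp (-(2 * lamR * t)) * Real.exp (-(2 * lamR * d t))) +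
      C * (t * d t + d t ^ 2))))) with hL
  have hlow : ∀ t > 0, ENNReal.ofReal (L t)
      ≤ ∫⁻ ω, ENNReal.ofReal (squaredError y (E ω) t) ∂μ := by
    intro t ht
    have hn : 0 < ⌈t ^ 3⌉₊ := Nat.ceil_pos.2 (by positivity)
    have hn' : (0 : ℝ) < ⌈t ^ 3⌉₊ := by exact_mod_cast hn
    have hδ : 0 < d t := div_pos ht hn'
    have htn : t = ⌈t ^ 3⌉₊ * d t := by simp only [hd]; field_simp
    refine h.le_lintegral_squaredError hN hr hν hν1 hν2 hy hδ.le _ htn fun j => ?_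
    set n := ⌈t ^ 3⌉₊
    set δ := d t
    set r := Real.exp (-(2 * lamR * δ)) with hrdef
    have hr0 : 0 < r := Real.exp_pos _
    have hr1 : r ≤ 1 := Real.exp_le_one_iff.2 (by nlinarith [mul_pos hr hδ])
    refine (h.sum_integral_pow_stage_le hN hr hc j hδ.le n htn hr0.le hr1).trans ?_
    have hrn : r ^ n = Real.exp (-(2 * lamR * t)) := by
      rw [hrdef, ← Real.exp_nat_mul]; congr 1; rw [htn]; ring
    have hrinv : Real.exp (2 * lamR * δ) = r⁻¹ := by rw [hrdef, Real.exp_neg, inv_inv]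
    have h1 := hC j δ hδ (n + 1)
    rw [Finset.sum_range_succ'] at h1
    have h2 : ∑ k ∈ Finset.range n, r ^ (k + 1) *
        (stepOp N lamR lamC j δ ^ (k + 1)) (otherShare N) {j} = r * ∑ k ∈ Finset.range n, r ^ k *
        (stepOp N lamR lamC j δ ^ (k + 1)) (otherShare N) {j} := by
      rw [Finset.mul_sum]
      exact Finset.sum_congr rfl fun k _ => by ring
    have h3 : (stepOp N lamR lamC j δ ^ 0) (otherShare N) {j} = 0 := by simp [otherShare]
    rw [h2, h3, mul_zero, add_zero, pow_succ, hrn] at h1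
    set S := ∑ k ∈ Finset.range n, r ^ k * (stepOp N lamR lamC j δ ^ (k + 1)) (otherShare N) {j}
    have h4 : (1 - r) * S = (δ⁻¹ * (r⁻¹ - 1)) * (δ * (r * S)) := by
      field_simp
    have h5 : ((n + 1 : ℕ) : ℝ) * (C * δ ^ 2) = C * (t * δ + δ ^ 2) := by
      rw [htn]; push_cast; ring
    rw [h5] at h1
    rw [h4, hrn, hrinv]
    have h6 : 0 ≤ δ⁻¹ * (r⁻¹ - 1) :=
      mul_nonneg (inv_nonneg.2 hδ.le) (sub_nonneg.2 ((one_le_inv₀ hr0).2 hr1))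
    have h7 : (0 : ℝ) ≤ (N : ℝ) - 1 := by linarith
    gcongr
  have hdle : ∀ t > 0, d t ≤ (t ^ 2)⁻¹ := fun t ht => by
    have h1 : t ^ 3 ≤ ⌈t ^ 3⌉₊ := Nat.le_ceil _
    have h2 : 0 < t ^ 3 := by positivity
    calc d t ≤ t / t ^ 3 := div_le_div_of_nonneg_left ht.le h2 h1
      _ = (t ^ 2)⁻¹ := by field_simp
  have hd0 : ∀ t > 0, 0 < d t := fun t ht =>
    div_pos ht (by exact_mod_cast Nat.ceil_pos.2 (by positivity : 0 < t ^ 3))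
  have hpos : ∀ᶠ t : ℝ in Filter.atTop, 0 < t := Filter.eventually_gt_atTop 0
  have hdlim : Filter.Tendsto d Filter.atTop (nhds 0) :=
    tendsto_of_tendsto_of_tendsto_of_le_of_le' tendsto_const_nhds
      (tendsto_inv_atTop_zero.comp (Filter.tendsto_pow_atTop two_ne_zero))
      (hpos.mono fun t ht => (hd0 t ht).le) (hpos.mono hdle)
  have htd : Filter.Tendsto (fun t => t * d t) Filter.atTop (nhds 0) :=
    tendsto_of_tendsto_of_tendsto_of_le_of_le' tendsto_const_nhds tendsto_inv_atTop_zero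
      (hpos.mono fun t ht => (mul_pos ht (hd0 t ht)).le) (hpos.mono fun t ht => by
        calc t * d t ≤ t * (t ^ 2)⁻¹ := by gcongr; exact hdle t ht
          _ = t⁻¹ := by field_simp)
  have hslope : Filter.Tendsto (fun t => (d t)⁻¹ * (Real.exp (2 * lamR * d t) - 1)) Filter.atTop
      (nhds (2 * lamR)) :=
    (tendsto_expm1_div (2 * lamR)).comp (tendsto_nhdsWithin_iff.2
      ⟨hdlim, hpos.mono fun t ht => (hd0 t ht).ne'⟩)
  have hexpt : Filter.Tendsto (fun t => Real.exp (-(2 * lamR * t))) Filter.atTop (nhds 0) :=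
    Real.tendsto_exp_neg_atTop_nhds_zero.comp
      (Filter.tendsto_id.const_mul_atTop (by positivity : 0 < 2 * lamR))
  have hexpd : Filter.Tendsto (fun t => Real.exp (-(2 * lamR * d t))) Filter.atTop (nhds 1) := by
    have := (Real.continuous_exp.tendsto _).comp ((hdlim.const_mul (2 * lamR)).neg)
    simpa [Function.comp_def] using this
  have hLlim : Filter.Tendsto L Filter.atTop (nhds (gossipBound N lamR lamC σ)) := by
    have h1 := ((((hexpt.const_mul (N : ℝ)).add_const 1).add ((hslope.mul
      (((hexpt.mul hexpd).const_mul C |>.const_add (g 0)).add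
        ((htd.add (hdlim.pow 2)).const_mul C))).const_mul ((N : ℝ) - 1))).const_sub
          (N : ℝ)).const_mul (σ ^ 2 / (N : ℝ) ^ 2)
    convert h1 using 2
    rw [hbound σ]
    ring
  rw [← ((ENNReal.continuous_ofReal.tendsto _).comp hLlim).liminf_eq]
  exact Filter.liminf_le_liminf (hpos.mono hlow)

end Model

end

theorem mainTheorem4 :
    -- the matrix inverted in the bound is invertible
    (∀ (N : ℕ) (lamR lamC : ℝ), 2 ≤ N → 0 < lamR → 0 < lamC →
      IsUnit (shiftedMatrix N lamR lamC)) ∧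
    -- the bound on the limit inferior, for every algorithm computed on the knowledge sets
    (∀ (N : ℕ) (lamR lamC σ : ℝ) (ν : Measure ℝ) (Ω : Type*) [MeasurableSpace Ω]
      (μ : Measure Ω) [IsProbabilityMeasure μ] (E : Ω → EventSeq N)
      (y : Fin N → ℝ → Set (Info N) → ℝ),
      2 ≤ N → 0 < lamR → 0 < lamC →
      MemLp (fun x : ℝ => x) 2 ν → ∫ x, x ∂ν = 0 → ∫ x, x ^ 2 ∂ν = σ ^ 2 →
      IsGossipModel μ lamR lamC ν E →
      (∀ i t, Measurable[knowledgeSigma N] (y i t)) →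
      ENNReal.ofReal (gossipBound N lamR lamC σ) ≤
        Filter.liminf (fun t : ℝ => ∫⁻ ω, ENNReal.ofReal (squaredError y (E ω) t) ∂μ)
          Filter.atTop) ∧
    -- its asymptotic lower bound in `ρ = lamC / lamR`, with a remainder `O(N / ρ²) σ²` whose
    -- constant `K` is absolute
    (∃ K : ℝ, ∀ (N : ℕ) (lamR lamC σ : ℝ), 3 ≤ N → 0 < lamR → 0 < lamC →
      ((N : ℝ) - 1) / (N : ℝ) ^ 2 *
          (7 / 2 + Real.log (((N : ℝ) - 2) / 2)
            + ((N : ℝ) - 5) / (((N : ℝ) - 1) * ((N : ℝ) - 2))) *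
          (lamC / lamR)⁻¹ * σ ^ 2
        - K * ((N : ℝ) / (lamC / lamR) ^ 2) * σ ^ 2 ≤ gossipBound N lamR lamC σ) := by
  refine ⟨fun N lamR lamC hN hr hc => isUnit_shiftedMatrix hN hr hc, ?_,
    ⟨6, fun N lamR lamC σ hN hr hc => gossipBound_asymptotic σ hN hr hc⟩⟩
  intro N lamR lamC σ ν Ω _ μ _ E y hN hr hc hν hν1 hν2 h hy
  exact h.gossipBound_le_liminf hN hr hc hν hν1 hν2 hy
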